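/- Let $\mathbb{R}^3$ carry the standard contact form $dz - y\,dx$. A Legendrian knot is a smooth embedding $S^1=\mathbb{R}/\mathbb{Z}\to\mathbb{R}^3$ tangent everywhere to $\ker(dz-y\,dx)$; two Legendrian knots are Legendrian isotopic if they are joined by a smooth family of Legendrian knots. The front projection of $K=(x,y,z)$ is the curve $(x,z)$; assume, as usual, that its only singularities are left cusps (points where $x'$ vanishes and changes sign from negative to positive), right cusps (where $x'$ vanishes and changes sign from positive to negative) and double points (crossings), with no triple points and no double point at a cusp. The Lagrangian projection of a Legendrian knot is its projection to the $xy$ plane, when this is a smooth immersed curve whose only self-intersections are transverse double points, made into a knot diagram by letting the strand with larger $z$ pass over. A resolution of a front is a knot diagram (a smooth immersed closed plane curve whose only self-intersections are transverse double points, with crossing information) obtained as follows. Enclose the cusps in pairwise disjoint closed rectangles, each of which meets the front in exactly one arc, this arc containing the cusp and having no self-crossing. Leave the front unchanged outside the rectangles, and inside each rectangle move the points of the arc only vertically, within the rectangle, so that a left cusp is replaced by a smooth arc without self-crossing, and a right cusp by a smooth arc with exactly one self-crossing, at which the two branches of the cusp cross before they join, forming a simple loop. At every crossing (those of the front and those created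 at the right cusps), the strand of smaller slope passes over. Proposition. Let $K$ be a Legendrian knot whose front projection is as above. Then the front projection of $K$ has a resolution, and every resolution $D$ of it is, up to planar isotopy of knot diagrams, the Lagrangian projection of a Legendrian knot $K'$ that is Legendrian isotopic to $K$. Here a planar isotopy is a smooth family of closed immersed plane curves whose only self-intersections are transverse double points, along which the crossing information is preserved. -/

import Mathlib

open Set Filter Topology
open scoped ContDiff

/-- Two real parameters represent the same point of the circle `ℝ / ℤ`. Closed curves are
parametrised by `1`-periodic maps defined on `ℝ`. -/
def SameParam (s t : ℝ) : Prop := ∃ n : ℤ, s = t + n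

/-- A (parametrised) Legendrian knot in `ℝ³` with the contact form `dz - y dx`: a smooth embedding
of the circle `ℝ / ℤ` which is everywhere tangent to the kernel of the form. -/
@[ext]
structure LegendrianKnot where
  x : ℝ → ℝ
  y : ℝ → ℝ
  z : ℝ → ℝ
  smooth_x : ContDiff ℝ ∞ x
  smooth_y : ContDiff ℝ ∞ y
  smooth_z : ContDiff ℝ ∞ z
  periodic_x : Function.Periodic x 1
  periodic_y : Function.Periodic y 1
  periodic_z : Function.Periodic z 1
  immersed : ∀ t, ¬ (deriv x t = 0 ∧ deriv y t = 0 ∧ deriv z t = 0)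
  embedded : ∀ s t, x s = x t → y s = y t → z s = z t → SameParam s t
  legendrian : ∀ t, deriv z t = y t * deriv x t

/-- Legendrian isotopy: a smooth family of Legendrian knots joining `K` to `K'`. (A family
over `[0, 1]` can always be made to extend over `ℝ` by making it stationary at both ends.) -/
def LegendrianIsotopic (K K' : LegendrianKnot) : Prop :=
  ∃ Γ : ℝ → LegendrianKnot,
    ContDiff ℝ ∞ (fun q : ℝ × ℝ => (Γ q.1).x q.2) ∧
    ContDiff ℝ ∞ (fun q : ℝ × ℝ => (Γ q.1).y q.2) ∧
    ContDiff ℝ ∞ (fun q : ℝ × ℝ => (Γ q.1).z q.2) ∧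
    Γ 0 = K ∧ Γ 1 = K'

/-- The front projection, to the `xz` plane. -/
def LegendrianKnot.front (K : LegendrianKnot) : ℝ → ℝ × ℝ := fun t => (K.x t, K.z t)

/-- `p` is (the parameter of) a left cusp of the front `F`: a parameter at which the derivative of
the horizontal coordinate vanishes and changes sign from negative to positive. -/
def IsLeftCusp (F : ℝ → ℝ × ℝ) (p : ℝ) : Prop :=
  deriv (fun t => (F t).1) p = 0 ∧
  (∀ᶠ t in 𝓝[<] p, deriv (fun t => (F t).1) t < 0) ∧
  (∀ᶠ t in 𝓝[>] p, 0 < deriv (fun t => (F t).1) t)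

/-- `p` is (the parameter of) a right cusp of the front `F`. -/
def IsRightCusp (F : ℝ → ℝ × ℝ) (p : ℝ) : Prop :=
  deriv (fun t => (F t).1) p = 0 ∧
  (∀ᶠ t in 𝓝[<] p, 0 < deriv (fun t => (F t).1) t) ∧
  (∀ᶠ t in 𝓝[>] p, deriv (fun t => (F t).1) t < 0)

/-- The cusps of a front, each listed once. -/
def cusps (F : ℝ → ℝ × ℝ) : Set ℝ := {p | p ∈ Ico (0 : ℝ) 1 ∧ (IsLeftCusp F p ∨ IsRightCusp F p)}

/-- The only singularities of the front projection of `K` are left cusps, right cusps and ordinary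
double points (crossings). Double points are automatically transverse, since the slope of the front
is the coordinate `y` and `K` is embedded. -/
structure LegendrianKnot.HasGenericFront (K : LegendrianKnot) : Prop where
  cusp : ∀ t, deriv K.x t = 0 → IsLeftCusp K.front t ∨ IsRightCusp K.front t
  crossing_regular : ∀ s t, deriv K.x s = 0 → K.front s = K.front t → SameParam s t
  no_triple : ∀ r s t, K.front r = K.front s → K.front s = K.front t →
    SameParam r s ∨ SameParam s t ∨ SameParam r t

/-- Smooth closed immersed plane curves whose only self-intersections are transverse double
points. -/
structure IsGenericClosedCurve (c : ℝ → ℝ × ℝ) : Prop where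
  smooth : ContDiff ℝ ∞ c
  periodic : Function.Periodic c 1
  immersed : ∀ t, deriv c t ≠ 0
  transverse : ∀ s t, ¬ SameParam s t → c s = c t →
    (deriv c s).1 * (deriv c t).2 - (deriv c s).2 * (deriv c t).1 ≠ 0
  no_triple : ∀ r s t, c r = c s → c s = c t → SameParam r s ∨ SameParam s t ∨ SameParam r t

/-- A (parametrised) knot diagram: a generic closed plane curve together with the choice, at each
double point, of the strand that passes over; `isOver s t` is meaningful when `s` and `t` are the two
parameters of a double point. -/
structure KnotDiagram where
  curve : ℝ → ℝ × ℝ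
  generic : IsGenericClosedCurve curve
  isOver : ℝ → ℝ → Prop
  isOver_congr : ∀ s s' t t', SameParam s s' → SameParam t t' → (isOver s t ↔ isOver s' t')
  isOver_iff_not : ∀ s t, ¬ SameParam s t → curve s = curve t → (isOver s t ↔ ¬ isOver t s)

/-- The slope of the curve of a diagram at a parameter at which the tangent is not vertical. -/
noncomputable def KnotDiagram.slope (D : KnotDiagram) (t : ℝ) : ℝ :=
  (deriv D.curve t).2 / (deriv D.curve t).1

/-- Planar isotopy of knot diagrams: a smooth family of closed curves, each with only transverse
double points, along which every double point keeps its crossing information. A double point is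
followed through the family by the continuous path `(σ, ρ)` of its two parameters. -/
def PlanarIsotopic (D D' : KnotDiagram) : Prop :=
  ∃ C : ℝ → ℝ → ℝ × ℝ,
    ContDiff ℝ ∞ (fun q : ℝ × ℝ => C q.1 q.2) ∧
    (∀ τ, IsGenericClosedCurve (C τ)) ∧
    C 0 = D.curve ∧ C 1 = D'.curve ∧
    ∀ σ ρ : ℝ → ℝ, ContinuousOn σ (Icc 0 1) → ContinuousOn ρ (Icc 0 1) →
      (∀ τ ∈ Icc (0 : ℝ) 1, ¬ SameParam (σ τ) (ρ τ) ∧ C τ (σ τ) = C τ (ρ τ)) →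
      (D.isOver (σ 0) (ρ 0) ↔ D'.isOver (σ 1) (ρ 1))

/-- The diagram `D` is the Lagrangian projection of `K`: the projection to the `xy` plane, where at
each double point the strand with the larger `z` coordinate passes over. -/
def LegendrianKnot.IsLagrangianProjection (K : LegendrianKnot) (D : KnotDiagram) : Prop :=
  (∀ t, D.curve t = (K.x t, K.y t)) ∧
  ∀ s t, ¬ SameParam s t → D.curve s = D.curve t → (D.isOver s t ↔ K.z t < K.z s)

/-- The closed rectangle with lower left corner `u` and upper right corner `v` cuts out of the
front `F` exactly one arc, with parameters in `[a, b]`; this arc contains the cusp `p` and has no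
self-crossing. -/
structure IsCuspBox (F : ℝ → ℝ × ℝ) (p a b : ℝ) (u v : ℝ × ℝ) : Prop where
  left_lt : a < p
  lt_right : p < b
  mem_box_iff : ∀ t, F t ∈ Icc u v ↔ ∃ n : ℤ, t + n ∈ Icc a b
  injOn : InjOn F (Icc a b)

/-- The knot diagram `D` is (a representative of) the resolution of the front `F`. Each cusp is
enclosed in a rectangle, disjoint from the other rectangles and from the rest of the front. Outside
the rectangles nothing is changed; inside them points are moved only vertically, in such a way
that a left cusp becomes a smooth arc without self-crossing and the two branches at a right cusp
cross exactly once before they join in a smooth arc, so that they form a simple loop. At each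
crossing of `D` (a crossing of the front, or one coming from a right cusp) the strand of smaller
slope passes over. -/
def IsResolution (F : ℝ → ℝ × ℝ) (D : KnotDiagram) : Prop :=
  (∀ t, (D.curve t).1 = (F t).1) ∧
  (∃ (a b : ℝ → ℝ) (u v : ℝ → ℝ × ℝ),
    (∀ p ∈ cusps F, IsCuspBox F p (a p) (b p) (u p) (v p)) ∧
    (∀ p ∈ cusps F, ∀ q ∈ cusps F, p ≠ q → Disjoint (Icc (u p) (v p)) (Icc (u q) (v q))) ∧
    (∀ t, (∀ p ∈ cusps F, F t ∉ Icc (u p) (v p)) → D.curve t = F t) ∧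
    (∀ p ∈ cusps F, MapsTo D.curve (Icc (a p) (b p)) (Icc (u p) (v p))) ∧
    (∀ p ∈ cusps F, IsLeftCusp F p → InjOn D.curve (Icc (a p) (b p))) ∧
    (∀ p ∈ cusps F, IsRightCusp F p →
      ∃ s₀ ∈ Ioo (a p) p, ∃ t₀ ∈ Ioo p (b p), D.curve s₀ = D.curve t₀ ∧
        ∀ s ∈ Icc (a p) (b p), ∀ t ∈ Icc (a p) (b p), s < t → D.curve s = D.curve t →
          s = s₀ ∧ t = t₀)) ∧
  (∀ s t, ¬ SameParam s t → D.curve s = D.curve t → (D.isOver s t ↔ D.slope s < D.slope t))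

/-! ### Parameters on the circle -/

theorem SameParam.refl (s : ℝ) : SameParam s s := ⟨0, by simp⟩

theorem SameParam.symm {s t : ℝ} (h : SameParam s t) : SameParam t s := by
  obtain ⟨n, rfl⟩ := h
  exact ⟨-n, by push_cast; ring⟩

theorem SameParam.trans {r s t : ℝ} (h : SameParam r s) (h' : SameParam s t) : SameParam r t := by
  obtain ⟨n, rfl⟩ := h
  obtain ⟨m, rfl⟩ := h'
  exact ⟨m + n, by push_cast; ring⟩

theorem SameParam.add_int (s : ℝ) (n : ℤ) : SameParam (s + n) s := ⟨n, rfl⟩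

theorem SameParam.congr {s s' t t' : ℝ} (h : SameParam s s') (h' : SameParam t t') :
    SameParam s t ↔ SameParam s' t' :=
  ⟨fun k => (h.symm.trans k).trans h', fun k => (h.trans k).trans h'.symm⟩

theorem Function.Periodic.add_int {α : Type*} {f : ℝ → α} (hf : Function.Periodic f 1) (t : ℝ)
    (n : ℤ) : f (t + n) = f t := by
  simpa using hf.int_mul n t

theorem SameParam.apply_eq {α : Type*} {s t : ℝ} (h : SameParam s t) {f : ℝ → α}
    (hf : Function.Periodic f 1) : f s = f t := by
  obtain ⟨n, rfl⟩ := h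
  exact hf.add_int t n

theorem Function.Periodic.deriv_one {f : ℝ → ℝ} (hf : Function.Periodic f 1) :
    Function.Periodic (deriv f) 1 := by
  intro t
  have : (fun u => f (u + 1)) = f := funext hf
  conv_rhs => rw [← this]
  exact (deriv_comp_add_const f 1 t).symm

/-! ### A ramp function -/

theorem exists_ramp (c m : ℝ) (h : c < m) : ∃ G : ℝ → ℝ, ContDiff ℝ ∞ G ∧ (∀ ξ ≤ c, G ξ = 0) ∧
    (∀ ξ, 0 ≤ G ξ) ∧ (∀ ξ ≥ m, 0 < G ξ) ∧ (∀ ξ, 0 ≤ deriv G ξ) ∧ (∀ ξ < m, deriv G ξ < 1) ∧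
    (∀ᶠ ξ in 𝓝 m, deriv G ξ = 1 + (ξ - m)) ∧ (∀ ξ ≥ m, deriv G ξ = 1 + (ξ - m)) := by
  obtain ⟨d, hcd, hdm, hd⟩ : ∃ d, c ≤ d ∧ d < m ∧ m - 1 / 2 ≤ d :=
    ⟨max c (m - 1 / 2), le_max_left _ _, max_lt h (by linarith), le_max_right _ _⟩
  set k : ℝ → ℝ := fun ξ => Real.smoothTransition ((ξ - d) / ((m - d) / 2)) * (1 + (ξ - m)) with hk
  have hkc : ContDiff ℝ ∞ k := by
    have := Real.smoothTransition.contDiff (n := ⊤)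
    have h2 : ContDiff ℝ ∞ (fun ξ : ℝ => (ξ - d) / ((m - d) / 2)) := by fun_prop
    have h3 := (this.comp h2)
    exact h3.mul (by fun_prop)
  have hk0 : ∀ ξ ≤ d, k ξ = 0 := fun ξ hξ => by
    have : (ξ - d) / ((m - d) / 2) ≤ 0 :=
      div_nonpos_of_nonpos_of_nonneg (by linarith) (by linarith)
    simp [hk, Real.smoothTransition.zero_of_nonpos this]
  have hk1 : ∀ ξ, (m + d) / 2 ≤ ξ → k ξ = 1 + (ξ - m) := fun ξ hξ => by
    have : 1 ≤ (ξ - d) / ((m - d) / 2) := by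
      rw [le_div_iff₀ (by linarith)]; linarith
    simp [hk, Real.smoothTransition.one_of_one_le this]
  have hknn : ∀ ξ, 0 ≤ k ξ := fun ξ => by
    rcases le_or_gt ξ d with hξ | hξ
    · rw [hk0 ξ hξ]
    · exact mul_nonneg (Real.smoothTransition.nonneg _) (by linarith)
  have hklt : ∀ ξ < m, k ξ < 1 := fun ξ hξ => by
    rcases le_or_gt ξ d with h1 | h1
    · rw [hk0 ξ h1]; norm_num
    · have h2 := Real.smoothTransition.le_one ((ξ - d) / ((m - d) / 2))
      have h3 : (0 : ℝ) ≤ 1 + (ξ - m) := by linarith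
      calc k ξ ≤ 1 * (1 + (ξ - m)) := mul_le_mul_of_nonneg_right h2 h3
        _ < 1 := by linarith
  have hG : ∀ ξ, HasDerivAt (fun ξ => ∫ u in d..ξ, k u) (k ξ) ξ := fun ξ =>
    hkc.continuous.integral_hasStrictDerivAt d ξ |>.hasDerivAt
  have hG' : deriv (fun ξ => ∫ u in d..ξ, k u) = k := funext fun ξ => (hG ξ).deriv
  refine ⟨fun ξ => ∫ u in d..ξ, k u, ?_, ?_, ?_, ?_, ?_, ?_, ?_, ?_⟩
  · rw [contDiff_infty_iff_deriv, hG']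
    exact ⟨fun ξ => (hG ξ).differentiableAt, hkc⟩
  · intro ξ hξ
    simp only
    rw [intervalIntegral.integral_congr (g := fun _ => (0 : ℝ))]
    · simp
    · intro u hu
      rw [uIcc_of_ge (by linarith)] at hu
      exact hk0 u hu.2
  · intro ξ
    simp only
    rcases le_total d ξ with h1 | h1
    · exact intervalIntegral.integral_nonneg h1 fun u _ => hknn u
    · rw [intervalIntegral.integral_congr (g := fun _ => (0 : ℝ))]
      · simp
      · intro u hu
        rw [uIcc_of_ge (by linarith)] at hu
        exact hk0 u hu.2
  · intro ξ hξ
    refine intervalIntegral.intervalIntegral_pos_of_pos_on (hkc.continuous.intervalIntegrable _ _)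
      (fun u hu => ?_) (by linarith)
    exact mul_pos (Real.smoothTransition.pos_of_pos (div_pos (by linarith [hu.1]) (by linarith)))
      (by linarith [hu.1])
  · rw [hG']; exact hknn
  · rw [hG']; exact hklt
  · rw [hG']
    filter_upwards [lt_mem_nhds (show (m + d) / 2 < m by linarith)] with ξ hξ using hk1 ξ hξ.le
  · rw [hG']
    exact fun ξ hξ => hk1 ξ (by linarith)

/-! ### The two branches of a valley -/

theorem continuousOn_of_rightInverse {f S : ℝ → ℝ} {I C : Set ℝ} (hf : Continuous f)
    (hC : IsCompact C) (hinj : InjOn f C) (hS : ∀ ξ ∈ I, S ξ ∈ C ∧ f (S ξ) = ξ) :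
    ContinuousOn S I := by
  intro ξ hξ
  refine hC.tendsto_nhds_of_unique_mapClusterPt
    (eventually_mem_nhdsWithin.mono fun η hη => (hS η hη).1) fun y hy hcl => ?_
  refine hinj hy (hS ξ hξ).1 ?_
  rw [(hS ξ hξ).2]
  have h1 : MapClusterPt (f y) (𝓝[I] ξ) (f ∘ S) := hcl.continuousAt_comp hf.continuousAt
  have h2 : Tendsto (f ∘ S) (𝓝[I] ξ) (𝓝 ξ) :=
    (tendsto_nhdsWithin_of_tendsto_nhds tendsto_id : Tendsto id (𝓝[I] ξ) (𝓝 ξ)).congr'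
      (eventually_mem_nhdsWithin.mono fun η hη => (hS η hη).2.symm)
  exact eq_of_nhds_neBot (ClusterPt.mono h1 h2)

/-- The two branches of the inverse of a function that decreases on `[a, p]` and increases on
`[p, b]`. -/
theorem exists_branches {X : ℝ → ℝ} {a p b : ℝ} (hX : Continuous X) (hap : a ≤ p) (hpb : p ≤ b)
    (hanti : StrictAntiOn X (Icc a p)) (hmono : StrictMonoOn X (Icc p b)) :
    ∃ S T : ℝ → ℝ, ContinuousOn S (Icc (X p) (min (X a) (X b))) ∧
      ContinuousOn T (Icc (X p) (min (X a) (X b))) ∧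
      ∀ ξ ∈ Icc (X p) (min (X a) (X b)), (S ξ ∈ Icc a p ∧ X (S ξ) = ξ) ∧
        (T ξ ∈ Icc p b ∧ X (T ξ) = ξ) := by
  have h1 : ∀ ξ ∈ Icc (X p) (min (X a) (X b)), ∃ s, s ∈ Icc a p ∧ X s = ξ := fun ξ hξ =>
    intermediate_value_Icc' hap hX.continuousOn ⟨hξ.1, hξ.2.trans (min_le_left _ _)⟩
  have h2 : ∀ ξ ∈ Icc (X p) (min (X a) (X b)), ∃ s, s ∈ Icc p b ∧ X s = ξ := fun ξ hξ =>
    intermediate_value_Icc hpb hX.continuousOn ⟨hξ.1, hξ.2.trans (min_le_right _ _)⟩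
  choose! S hS using h1
  choose! T hT using h2
  exact ⟨S, T, continuousOn_of_rightInverse hX isCompact_Icc hanti.injOn hS,
    continuousOn_of_rightInverse hX isCompact_Icc hmono.injOn hT, fun ξ hξ => ⟨hS ξ hξ, hT ξ hξ⟩⟩

/-- A continuous function of the pairs of points at the same height of a valley keeps its sign as
long as it does not vanish. -/
theorem valley_sign {X : ℝ → ℝ} {a p b : ℝ} (hX : Continuous X)
    (hanti : StrictAntiOn X (Icc a p)) (hmono : StrictMonoOn X (Icc p b))
    {f : ℝ → ℝ → ℝ} (hf : Continuous fun q : ℝ × ℝ => f q.1 q.2) {s t s' t' : ℝ}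
    (hs : s ∈ Icc a p) (ht : t ∈ Icc p b) (hst : X s = X t)
    (hs' : s' ∈ Icc a p) (ht' : t' ∈ Icc p b) (hst' : X s' = X t') (hle : X s ≤ X s')
    (hne : ∀ σ ∈ Icc a p, ∀ ρ ∈ Icc p b, X σ = X ρ → X s ≤ X σ → X σ ≤ X s' → f σ ρ ≠ 0) :
    0 < f s t * f s' t' := by
  have hap : a ≤ p := hs.1.trans hs.2
  have hpb : p ≤ b := ht.1.trans ht.2
  obtain ⟨S, T, hS, hT, h⟩ := exists_branches hX hap hpb hanti hmono
  have hsub : Icc (X s) (X s') ⊆ Icc (X p) (min (X a) (X b)) := by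
    intro ξ hξ
    refine ⟨le_trans (hanti.antitoneOn hs ⟨hap, le_rfl⟩ hs.2) hξ.1, hξ.2.trans (le_min ?_ ?_)⟩
    · exact hanti.antitoneOn ⟨le_rfl, hap⟩ hs' hs'.1
    · rw [hst']; exact hmono.monotoneOn ht' ⟨hpb, le_rfl⟩ ht'.2
  have hF : ContinuousOn (fun ξ => f (S ξ) (T ξ)) (Icc (X s) (X s')) :=
    hf.comp_continuousOn ((hS.mono hsub).prodMk (hT.mono hsub))
  have key : ∀ {σ ρ : ℝ}, σ ∈ Icc a p → ρ ∈ Icc p b → X σ = X ρ → X σ ∈ Icc (X s) (X s') →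
      S (X σ) = σ ∧ T (X σ) = ρ := fun {σ ρ} hσ hρ e hm =>
    ⟨hanti.injOn (h _ (hsub hm)).1.1 hσ (h _ (hsub hm)).1.2,
      hmono.injOn (h _ (hsub hm)).2.1 hρ ((h _ (hsub hm)).2.2.trans e)⟩
  have hne' : ∀ ξ ∈ Icc (X s) (X s'), f (S ξ) (T ξ) ≠ 0 := fun ξ hξ =>
    hne _ (h _ (hsub hξ)).1.1 _ (h _ (hsub hξ)).2.1
      ((h _ (hsub hξ)).1.2.trans (h _ (hsub hξ)).2.2.symm)
      (by rw [(h _ (hsub hξ)).1.2]; exact hξ.1) (by rw [(h _ (hsub hξ)).1.2]; exact hξ.2)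
  have e1 := key hs ht hst ⟨le_rfl, hle⟩
  have e2 := key hs' ht' hst' ⟨hle, le_rfl⟩
  by_contra hcon
  have hconv := (isPreconnected_Icc (a := X s) (b := X s')).image _ hF |>.ordConnected
  have m1 : f s t ∈ (fun ξ => f (S ξ) (T ξ)) '' Icc (X s) (X s') :=
    ⟨X s, ⟨le_rfl, hle⟩, by simp only [e1.1, e1.2]⟩
  have m2 : f s' t' ∈ (fun ξ => f (S ξ) (T ξ)) '' Icc (X s) (X s') :=
    ⟨X s', ⟨hle, le_rfl⟩, by simp only [e2.1, e2.2]⟩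
  have h0 : (0 : ℝ) ∈ (fun ξ => f (S ξ) (T ξ)) '' Icc (X s) (X s') := by
    rcases le_total (f s t) 0 with h1 | h1
    · rcases le_total (f s' t') 0 with h2 | h2
      · rcases h1.eq_or_lt with h1 | h1
        · rwa [h1] at m1
        rcases h2.eq_or_lt with h2 | h2
        · rwa [h2] at m2
        · exact absurd (mul_pos_of_neg_of_neg h1 h2) hcon
      · exact hconv.out m1 m2 ⟨h1, h2⟩
    · rcases le_total (f s' t') 0 with h2 | h2
      · exact hconv.out m2 m1 ⟨h2, h1⟩
      · rcases h1.eq_or_lt with h1 | h1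
        · rwa [← h1] at m1
        rcases h2.eq_or_lt with h2 | h2
        · rwa [← h2] at m2
        · exact absurd (mul_pos h1 h2) hcon
  obtain ⟨ξ, hξ, e⟩ := h0
  exact hne' ξ hξ e

/-- If the difference of `w` along the two branches of a valley vanishes at one height only, to
first order, and is positive above that height, then its derivative there is positive, and it is
negative just below. -/
theorem valley_crossing {X w : ℝ → ℝ} {a p b s₀ t₀ : ℝ} (hX : Continuous X)
    (hanti : StrictAntiOn X (Icc a p)) (hmono : StrictMonoOn X (Icc p b))
    (hs : s₀ ∈ Ioo a p) (ht : t₀ ∈ Ioo p b) (hst : X s₀ = X t₀)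
    (hw : w s₀ = w t₀) {xs xt ws wt : ℝ} (hxs : HasDerivAt X xs s₀) (hxt : HasDerivAt X xt t₀)
    (hws : HasDerivAt w ws s₀) (hwt : HasDerivAt w wt t₀) (hxs0 : xs ≠ 0) (hxt0 : xt ≠ 0)
    (hne : wt / xt - ws / xs ≠ 0)
    (hpos : ∀ σ ∈ Icc a p, ∀ ρ ∈ Icc p b, X σ = X ρ → X s₀ < X σ → 0 < w ρ - w σ) :
    0 < wt / xt - ws / xs ∧
      ∃ σ ∈ Icc a p, ∃ ρ ∈ Icc p b, X σ = X ρ ∧ X p < X σ ∧ X σ < X s₀ ∧ w ρ - w σ < 0 ∧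
        ∀ η, X σ ≤ η → η < X s₀ → ∃ σ' ∈ Icc a p, ∃ ρ' ∈ Icc p b, X σ' = η ∧ X ρ' = η ∧
          w ρ' - w σ' < 0 := by
  have hap : a ≤ p := (hs.1.trans hs.2).le
  have hpb : p ≤ b := (ht.1.trans ht.2).le
  obtain ⟨S, T, hS, hT, h⟩ := exists_branches hX hap hpb hanti hmono
  have hp1 : X p < X s₀ := hanti ⟨hs.1.le, hs.2.le⟩ ⟨hap, le_rfl⟩ hs.2
  have hp2 : X s₀ < min (X a) (X b) := by
    refine lt_min (hanti ⟨le_rfl, hap⟩ ⟨hs.1.le, hs.2.le⟩ hs.1) ?_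
    rw [hst]; exact hmono ⟨ht.1.le, ht.2.le⟩ ⟨hpb, le_rfl⟩ ht.2
  have hnh : Icc (X p) (min (X a) (X b)) ∈ 𝓝 (X s₀) := Icc_mem_nhds hp1 hp2
  have hmem := mem_of_mem_nhds hnh
  have eS : S (X s₀) = s₀ := hanti.injOn (h _ hmem).1.1 ⟨hs.1.le, hs.2.le⟩ (h _ hmem).1.2
  have eT : T (X s₀) = t₀ :=
    hmono.injOn (h _ hmem).2.1 ⟨ht.1.le, ht.2.le⟩ ((h _ hmem).2.2.trans hst)
  have dS : HasDerivAt S xs⁻¹ (X s₀) :=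
    HasDerivAt.of_local_left_inverse (hS.continuousAt hnh) (by rw [eS]; exact hxs) hxs0
      (eventually_of_mem hnh fun ξ hξ => (h ξ hξ).1.2)
  have dT : HasDerivAt T xt⁻¹ (X s₀) :=
    HasDerivAt.of_local_left_inverse (hT.continuousAt hnh) (by rw [eT]; exact hxt) hxt0
      (eventually_of_mem hnh fun ξ hξ => (h ξ hξ).2.2)
  have dF : HasDerivAt (fun ξ => w (T ξ) - w (S ξ)) (wt / xt - ws / xs) (X s₀) := by
    have h1 : HasDerivAt (fun ξ => w (T ξ)) (wt * xt⁻¹) (X s₀) :=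
      HasDerivAt.comp (X s₀) (by rw [eT]; exact hwt) dT
    have h2 : HasDerivAt (fun ξ => w (S ξ)) (ws * xs⁻¹) (X s₀) :=
      HasDerivAt.comp (X s₀) (by rw [eS]; exact hws) dS
    rw [div_eq_mul_inv, div_eq_mul_inv]
    exact h1.sub h2
  have hF0 : w (T (X s₀)) - w (S (X s₀)) = 0 := by rw [eS, eT, hw, sub_self]
  have hgt : ∀ᶠ ξ in 𝓝[>] (X s₀), 0 < w (T ξ) - w (S ξ) := by
    filter_upwards [nhdsWithin_le_nhds hnh, self_mem_nhdsWithin] with ξ hξ hξ'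
    exact hpos _ (h ξ hξ).1.1 _ (h ξ hξ).2.1 ((h ξ hξ).1.2.trans (h ξ hξ).2.2.symm)
      (by rw [(h ξ hξ).1.2]; exact hξ')
  have hslope := hasDerivAt_iff_tendsto_slope.1 dF
  have hnn : 0 ≤ wt / xt - ws / xs := by
    refine ge_of_tendsto
      (hslope.mono_left (nhdsWithin_mono _ fun ξ (hξ : ξ ∈ Ioi (X s₀)) => ne_of_gt hξ)) ?_
    filter_upwards [hgt, self_mem_nhdsWithin] with ξ h1 h2
    rw [slope_def_field, hF0, sub_zero]
    exact div_nonneg h1.le (sub_nonneg.2 (le_of_lt h2))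
  have hd : 0 < wt / xt - ws / xs := lt_of_le_of_ne hnn hne.symm
  refine ⟨hd, ?_⟩
  have hlt : ∀ᶠ ξ in 𝓝[<] (X s₀), w (T ξ) - w (S ξ) < 0 := by
    have := (hslope.mono_left (nhdsWithin_mono (X s₀) fun ξ (hξ : ξ ∈ Iio (X s₀)) => ne_of_lt hξ)).eventually
      (lt_mem_nhds hd)
    filter_upwards [this, self_mem_nhdsWithin] with ξ h1 h2
    rw [slope_def_field, hF0, sub_zero] at h1
    by_contra hcon
    exact absurd h1 (not_lt.2 (div_nonpos_of_nonneg_of_nonpos (not_lt.1 hcon)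
      (sub_nonpos.2 (le_of_lt h2))))
  obtain ⟨l, hl, hl'⟩ := (mem_nhdsLT_iff_exists_Ico_subset).1
    (inter_mem hlt (nhdsWithin_le_nhds (Ioi_mem_nhds hp1)))
  have hlm : l ∈ Icc (X p) (min (X a) (X b)) :=
    ⟨(hl' ⟨le_rfl, hl⟩).2.le, (le_of_lt hl).trans hp2.le⟩
  refine ⟨S l, (h l hlm).1.1, T l, (h l hlm).2.1, (h l hlm).1.2.trans (h l hlm).2.2.symm, ?_, ?_,
    (hl' ⟨le_rfl, hl⟩).1, ?_⟩
  · rw [(h l hlm).1.2]; exact (hl' ⟨le_rfl, hl⟩).2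
  · rw [(h l hlm).1.2]; exact hl
  · intro η h1 h2
    rw [(h l hlm).1.2] at h1
    have hη : η ∈ Icc (X p) (min (X a) (X b)) := ⟨hlm.1.trans h1, h2.le.trans hp2.le⟩
    exact ⟨S η, (h η hη).1.1, T η, (h η hη).2.1, (h η hη).1.2, (h η hη).2.2, (hl' ⟨h1, h2⟩).1⟩

/-! ### Local properties of pairs and triples of parameters -/

theorem eventually_forall_pairs {P : ℝ → ℝ → ℝ → Prop}
    (hP : ∀ s s' t t' ε, SameParam s s' → SameParam t t' → P s t ε → P s' t' ε)
    (h : ∀ s t, ∀ᶠ q in (𝓝 s ×ˢ 𝓝 t) ×ˢ 𝓝[>] (0 : ℝ), P q.1.1 q.1.2 q.2) :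
    ∀ᶠ ε in 𝓝[>] (0 : ℝ), ∀ s t, P s t ε := by
  obtain ⟨U, hU, hU'⟩ : ∃ U ∈ 𝓝[>] (0 : ℝ), ∀ ε ∈ U, ∀ q ∈ Icc (0 : ℝ) 1 ×ˢ Icc (0 : ℝ) 1,
      P q.1 q.2 ε := by
    have hc : IsCompact (Icc (0 : ℝ) 1 ×ˢ Icc (0 : ℝ) 1) := isCompact_Icc.prod isCompact_Icc
    refine hc.induction_on (p := fun A => ∃ U ∈ 𝓝[>] (0 : ℝ), ∀ ε ∈ U, ∀ q ∈ A, P q.1 q.2 ε)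
      ⟨univ, univ_mem, by simp⟩ ?_ ?_ ?_
    · rintro A B hAB ⟨U, hU, hU'⟩
      exact ⟨U, hU, fun ε hε q hq => hU' ε hε q (hAB hq)⟩
    · rintro A B ⟨U, hU, hU'⟩ ⟨V, hV, hV'⟩
      exact ⟨U ∩ V, inter_mem hU hV, fun ε hε q hq =>
        hq.elim (hU' ε hε.1 q) (hV' ε hε.2 q)⟩
    · rintro ⟨s, t⟩ -
      obtain ⟨A, hA, U, hU, hAU⟩ := mem_prod_iff.1 (h s t)
      refine ⟨A, mem_nhdsWithin_of_mem_nhds (by rwa [nhds_prod_eq]), U, hU, fun ε hε q hq => ?_⟩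
      exact hAU (show (q, ε) ∈ A ×ˢ U from ⟨hq, hε⟩)
  filter_upwards [hU] with ε hε s t
  have := hU' ε hε (Int.fract s, Int.fract t)
    ⟨⟨Int.fract_nonneg s, (Int.fract_lt_one s).le⟩, ⟨Int.fract_nonneg t, (Int.fract_lt_one t).le⟩⟩
  refine hP _ _ _ _ _ ⟨-⌊s⌋, ?_⟩ ⟨-⌊t⌋, ?_⟩ this
  · simp [Int.fract, sub_eq_add_neg]
  · simp [Int.fract, sub_eq_add_neg]

theorem eventually_forall_triples {P : ℝ → ℝ → ℝ → ℝ → Prop}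
    (hP : ∀ r r' s s' t t' ε, SameParam r r' → SameParam s s' → SameParam t t' →
      P r s t ε → P r' s' t' ε)
    (h : ∀ r s t, ∀ᶠ q in (𝓝 r ×ˢ 𝓝 s ×ˢ 𝓝 t) ×ˢ 𝓝[>] (0 : ℝ),
      P q.1.1 q.1.2.1 q.1.2.2 q.2) :
    ∀ᶠ ε in 𝓝[>] (0 : ℝ), ∀ r s t, P r s t ε := by
  obtain ⟨U, hU, hU'⟩ : ∃ U ∈ 𝓝[>] (0 : ℝ), ∀ ε ∈ U,
      ∀ q ∈ Icc (0 : ℝ) 1 ×ˢ (Icc (0 : ℝ) 1 ×ˢ Icc (0 : ℝ) 1), P q.1 q.2.1 q.2.2 ε := by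
    have hc : IsCompact (Icc (0 : ℝ) 1 ×ˢ (Icc (0 : ℝ) 1 ×ˢ Icc (0 : ℝ) 1)) :=
      isCompact_Icc.prod (isCompact_Icc.prod isCompact_Icc)
    refine hc.induction_on
      (p := fun A => ∃ U ∈ 𝓝[>] (0 : ℝ), ∀ ε ∈ U, ∀ q ∈ A, P q.1 q.2.1 q.2.2 ε)
      ⟨univ, univ_mem, by simp⟩ ?_ ?_ ?_
    · rintro A B hAB ⟨U, hU, hU'⟩
      exact ⟨U, hU, fun ε hε q hq => hU' ε hε q (hAB hq)⟩
    · rintro A B ⟨U, hU, hU'⟩ ⟨V, hV, hV'⟩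
      exact ⟨U ∩ V, inter_mem hU hV, fun ε hε q hq =>
        hq.elim (hU' ε hε.1 q) (hV' ε hε.2 q)⟩
    · rintro ⟨r, s, t⟩ -
      obtain ⟨A, hA, U, hU, hAU⟩ := mem_prod_iff.1 (h r s t)
      refine ⟨A, mem_nhdsWithin_of_mem_nhds (by rwa [nhds_prod_eq, nhds_prod_eq]), U, hU,
        fun ε hε q hq => ?_⟩
      exact hAU (show (q, ε) ∈ A ×ˢ U from ⟨hq, hε⟩)
  filter_upwards [hU] with ε hε r s t
  have hf : ∀ u : ℝ, Int.fract u ∈ Icc (0 : ℝ) 1 := fun u =>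
    ⟨Int.fract_nonneg u, (Int.fract_lt_one u).le⟩
  have hfs : ∀ u : ℝ, SameParam (Int.fract u) u := fun u =>
    ⟨-⌊u⌋, by simp [Int.fract, sub_eq_add_neg]⟩
  exact hP _ _ _ _ _ _ _ (hfs r) (hfs s) (hfs t)
    (hU' ε hε (Int.fract r, Int.fract s, Int.fract t) ⟨hf r, hf s, hf t⟩)

/-! ### Local behaviour of functions -/

theorem ContDiff.hasDerivAt_top {f : ℝ → ℝ} (hf : ContDiff ℝ ∞ f) (t : ℝ) :
    HasDerivAt f (deriv f t) t :=
  (hf.differentiable (by simp) t).hasDerivAt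

theorem ContDiff.continuous_deriv_top {f : ℝ → ℝ} (hf : ContDiff ℝ ∞ f) : Continuous (deriv f) :=
  hf.continuous_deriv (by simp)

theorem eventually_sub_pos {f : ℝ → ℝ} (hf : ContDiff ℝ ∞ f) {p : ℝ} (h : deriv f p ≠ 0) :
    ∀ᶠ q in 𝓝 p ×ˢ 𝓝 p, q.1 < q.2 → 0 < deriv f p * (f q.2 - f q.1) := by
  have hc : ∀ᶠ t in 𝓝 p, 0 < deriv f p * deriv f t :=
    (continuous_const.mul hf.continuous_deriv_top).continuousAt.eventually
      (lt_mem_nhds (mul_self_pos.2 h))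
  obtain ⟨δ, hδ, hδ'⟩ := Metric.eventually_nhds_iff_ball.1 hc
  have hb : Metric.ball p δ ∈ 𝓝 p := Metric.ball_mem_nhds p hδ
  filter_upwards [prod_mem_prod hb hb] with q hq hlt
  have hmono : StrictMonoOn (fun t => deriv f p * f t) (Metric.ball p δ) := by
    refine strictMonoOn_of_deriv_pos (convex_ball p δ)
      (continuous_const.mul hf.continuous).continuousOn fun t ht => ?_
    rw [deriv_const_mul_field]
    exact hδ' t (interior_subset ht)
  have := hmono hq.1 hq.2 hlt
  simp only at this
  linarith

theorem eventually_injective {f : ℝ → ℝ} (hf : ContDiff ℝ ∞ f) {p : ℝ} (h : deriv f p ≠ 0) :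
    ∀ᶠ q in 𝓝 p ×ˢ 𝓝 p, f q.1 = f q.2 → q.1 = q.2 := by
  have h1 := eventually_sub_pos hf h
  have h2 : ∀ᶠ q in 𝓝 p ×ˢ 𝓝 p, q.2 < q.1 → 0 < deriv f p * (f q.1 - f q.2) :=
    Filter.tendsto_prod_swap.eventually h1
  filter_upwards [h1, h2] with q h1 h2 e
  rcases lt_trichotomy q.1 q.2 with h | h | h
  · simpa [e] using h1 h
  · exact h
  · simpa [e] using h2 h

/-- Near a point where the slope `y` of the front is strictly monotone and where `x` has an
extremum, the front has two branches, and the sign of their difference is known. -/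
theorem eventually_branch_order {x y z : ℝ → ℝ} (hx : ContDiff ℝ ∞ x) (hy : ContDiff ℝ ∞ y)
    (hz : ContDiff ℝ ∞ z) (hl : ∀ t, deriv z t = y t * deriv x t) {p e : ℝ}
    (hyp : deriv y p ≠ 0) (h1 : ∀ᶠ t in 𝓝[<] p, e * deriv x t < 0)
    (h2 : ∀ᶠ t in 𝓝[>] p, 0 < e * deriv x t) :
    ∀ᶠ q in 𝓝 p ×ˢ 𝓝 p, q.1 < p → p < q.2 → x q.1 = x q.2 →
      0 < e * deriv y p * (z q.2 - z q.1) := by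
  have hs := eventually_sub_pos hy hyp
  obtain ⟨A, hA, A', hA', hAA⟩ := mem_prod_iff.1 hs
  have h1' : {t | t < p → e * deriv x t < 0} ∈ 𝓝 p := eventually_nhdsWithin_iff.1 h1
  have h2' : {t | p < t → 0 < e * deriv x t} ∈ 𝓝 p := eventually_nhdsWithin_iff.1 h2
  obtain ⟨δ, hδ, hδ'⟩ := Metric.mem_nhds_iff.1
    (inter_mem (inter_mem hA hA') (inter_mem h1' h2'))
  have hb : Metric.ball p δ ∈ 𝓝 p := Metric.ball_mem_nhds p hδ
  filter_upwards [prod_mem_prod hb hb] with q hq hq1 hq2 hqx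
  set g : ℝ → ℝ := fun t => e * deriv y p * (z t - y p * x t) with hg
  have hgd : ∀ t, HasDerivAt g (deriv y p * (y t - y p) * (e * deriv x t)) t := fun t => by
    have := ((hz.hasDerivAt_top t).sub ((hx.hasDerivAt_top t).const_mul (y p))).const_mul
      (e * deriv y p)
    rw [hl] at this
    exact this.congr_deriv (by ring)
  have hgc : Continuous g := by
    have := hz.continuous; have := hx.continuous; fun_prop
  have hpb : p ∈ Metric.ball p δ := Metric.mem_ball_self hδ
  have hconv : Convex ℝ (Metric.ball p δ) := convex_ball p δ
  have m1 : StrictMonoOn g (Icc q.1 p) := by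
    refine strictMonoOn_of_deriv_pos (convex_Icc _ _) hgc.continuousOn fun t ht => ?_
    rw [interior_Icc] at ht
    have htb : t ∈ Metric.ball p δ := hconv.ordConnected.out hq.1 hpb ⟨ht.1.le, ht.2.le⟩
    rw [(hgd t).deriv]
    have k1 := hAA (show (t, p) ∈ A ×ˢ A' from ⟨(hδ' htb).1.1, (hδ' hpb).1.2⟩) ht.2
    simp only at k1
    have k2 := (hδ' htb).2.1 ht.2
    nlinarith
  have m2 : StrictMonoOn g (Icc p q.2) := by
    refine strictMonoOn_of_deriv_pos (convex_Icc _ _) hgc.continuousOn fun t ht => ?_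
    rw [interior_Icc] at ht
    have htb : t ∈ Metric.ball p δ := hconv.ordConnected.out hpb hq.2 ⟨ht.1.le, ht.2.le⟩
    rw [(hgd t).deriv]
    have k1 := hAA (show (p, t) ∈ A ×ˢ A' from ⟨(hδ' hpb).1.1, (hδ' htb).1.2⟩) ht.1
    simp only at k1
    have k2 := (hδ' htb).2.2 ht.1
    exact mul_pos k1 k2
  have := (m1 ⟨le_rfl, hq1.le⟩ ⟨hq1.le, le_rfl⟩ hq1).trans (m2 ⟨le_rfl, hq2.le⟩ ⟨hq2.le, le_rfl⟩ hq2)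
  simp only [hg] at this
  rw [hqx] at this
  linarith

/-! ### Cusps -/

theorem LegendrianKnot.continuous_front (K : LegendrianKnot) : Continuous K.front :=
  K.smooth_x.continuous.prodMk K.smooth_z.continuous

theorem LegendrianKnot.periodic_front (K : LegendrianKnot) : Function.Periodic K.front 1 :=
  fun t => Prod.ext (K.periodic_x t) (K.periodic_z t)

theorem LegendrianKnot.deriv_y_ne_zero (K : LegendrianKnot) {t : ℝ} (h : deriv K.x t = 0) :
    deriv K.y t ≠ 0 := fun h' => K.immersed t ⟨h, h', by rw [K.legendrian, h, mul_zero]⟩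

theorem LegendrianKnot.HasGenericFront.eventually_ne {K : LegendrianKnot} (hK : K.HasGenericFront)
    {t : ℝ} (ht : deriv K.x t = 0) : ∀ᶠ s in 𝓝[≠] t, deriv K.x s ≠ 0 := by
  rw [← Iio_union_Ioi, nhdsWithin_union, eventually_sup]
  rcases hK.cusp t ht with h | h
  · exact ⟨h.2.1.mono fun s hs => hs.ne, h.2.2.mono fun s hs => hs.ne'⟩
  · exact ⟨h.2.1.mono fun s hs => hs.ne', h.2.2.mono fun s hs => hs.ne⟩

theorem LegendrianKnot.deriv_x_of_mem_cusps {K : LegendrianKnot} {p : ℝ} (hp : p ∈ cusps K.front) :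
    deriv K.x p = 0 := hp.2.elim (fun h => h.1) (fun h => h.1)

theorem LegendrianKnot.HasGenericFront.finite_cusps {K : LegendrianKnot}
    (hK : K.HasGenericFront) : (cusps K.front).Finite := by
  by_contra hinf
  obtain ⟨t, -, ht⟩ := Set.Infinite.exists_accPt_of_subset_isCompact hinf
    (isCompact_Icc (a := (0 : ℝ)) (b := 1)) fun p hp => ⟨hp.1.1, hp.1.2.le⟩
  have hfr : ∃ᶠ s in 𝓝[≠] t, s ∈ cusps K.front := accPt_iff_frequently_nhdsNE.1 ht
  have h0 : ∃ᶠ s in 𝓝[≠] t, deriv K.x s = 0 :=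
    hfr.mono fun s hs => LegendrianKnot.deriv_x_of_mem_cusps hs
  have ht0 : deriv K.x t = 0 := by
    by_contra hne
    exact h0 (nhdsWithin_le_nhds
      (K.smooth_x.continuous_deriv_top.continuousAt.eventually_ne hne))
  exact h0 (hK.eventually_ne ht0)

theorem IsLeftCusp.of_sameParam {K : LegendrianKnot} {p : ℝ} (n : ℤ)
    (h : IsLeftCusp K.front (p + n)) : IsLeftCusp K.front p := by
  have hx : ∀ t : ℝ, deriv K.x (t + n) = deriv K.x t := fun t => K.periodic_x.deriv_one.add_int t n
  refine ⟨(hx p).symm.trans h.1, ?_, ?_⟩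
  · have := h.2.1
    rw [← map_add_right_nhdsLT, eventually_map] at this
    exact this.mono fun t ht => (hx t).symm.trans_lt ht
  · have := h.2.2
    rw [← map_add_right_nhdsGT, eventually_map] at this
    exact this.mono fun t ht => ht.trans_eq (hx t)

theorem IsRightCusp.of_sameParam {K : LegendrianKnot} {p : ℝ} (n : ℤ)
    (h : IsRightCusp K.front (p + n)) : IsRightCusp K.front p := by
  have hx : ∀ t : ℝ, deriv K.x (t + n) = deriv K.x t := fun t => K.periodic_x.deriv_one.add_int t n
  refine ⟨(hx p).symm.trans h.1, ?_, ?_⟩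
  · have := h.2.1
    rw [← map_add_right_nhdsLT, eventually_map] at this
    exact this.mono fun t ht => ht.trans_eq (hx t)
  · have := h.2.2
    rw [← map_add_right_nhdsGT, eventually_map] at this
    exact this.mono fun t ht => (hx t).symm.trans_lt ht

theorem LegendrianKnot.HasGenericFront.exists_cusp {K : LegendrianKnot} (hK : K.HasGenericFront)
    {t : ℝ} (ht : deriv K.x t = 0) : ∃ p ∈ cusps K.front, SameParam t p := by
  refine ⟨Int.fract t, ⟨⟨Int.fract_nonneg t, Int.fract_lt_one t⟩, ?_⟩, ⌊t⌋, by simp⟩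
  have : Int.fract t + (⌊t⌋ : ℤ) = t := by simp
  refine (hK.cusp t ht).imp (fun h => ?_) fun h => ?_
  · exact IsLeftCusp.of_sameParam ⌊t⌋ (by rwa [this])
  · exact IsRightCusp.of_sameParam ⌊t⌋ (by rwa [this])

/-! ### Boxes around the cusps -/

/-- A generic front together with pairwise disjoint boxes around its cusps. -/
structure FrontBoxes (K : LegendrianKnot) where
  generic : K.HasGenericFront
  a : ℝ → ℝ
  b : ℝ → ℝ
  u : ℝ → ℝ × ℝ
  v : ℝ → ℝ × ℝ
  isCuspBox : ∀ p ∈ cusps K.front, IsCuspBox K.front p (a p) (b p) (u p) (v p)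
  disjoint : ∀ p ∈ cusps K.front, ∀ q ∈ cusps K.front, p ≠ q →
    Disjoint (Icc (u p) (v p)) (Icc (u q) (v q))

namespace FrontBoxes

variable {K : LegendrianKnot} (B : FrontBoxes K)

/-- The parameters of the points of the front in the box of `p`. -/
def params (p : ℝ) : Set ℝ := K.front ⁻¹' Icc (B.u p) (B.v p)

theorem mem_params_iff {p : ℝ} (hp : p ∈ cusps K.front) {t : ℝ} :
    t ∈ B.params p ↔ ∃ n : ℤ, t + n ∈ Icc (B.a p) (B.b p) :=
  (B.isCuspBox p hp).mem_box_iff t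

theorem mem_params {p : ℝ} (hp : p ∈ cusps K.front) {t : ℝ} (ht : t ∈ Icc (B.a p) (B.b p)) :
    t ∈ B.params p := (B.mem_params_iff hp).2 ⟨0, by simpa using ht⟩

theorem params_congr {p s t : ℝ} (h : SameParam s t) : s ∈ B.params p ↔ t ∈ B.params p := by
  simp only [params, mem_preimage, h.apply_eq K.periodic_front]

theorem isClosed_params (p : ℝ) : IsClosed (B.params p) := isClosed_Icc.preimage K.continuous_front

theorem notMem_params_of_mem {p q : ℝ} (hp : p ∈ cusps K.front) (hq : q ∈ cusps K.front)
    (hpq : q ≠ p) {t : ℝ} (ht : t ∈ B.params p) : t ∉ B.params q := fun h =>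
  Set.disjoint_left.1 (B.disjoint p hp q hq hpq.symm) ht h

theorem eventually_notMem {t : ℝ} (h : ∀ p ∈ cusps K.front, t ∉ B.params p) :
    ∀ᶠ s in 𝓝 t, ∀ p ∈ cusps K.front, s ∉ B.params p :=
  (eventually_all_finite B.generic.finite_cusps).2 fun p hp =>
    (B.isClosed_params p).isOpen_compl.mem_nhds (h p hp)

section Cusp

variable {p : ℝ} (hp : p ∈ cusps K.front)
include hp

theorem a_lt : B.a p < p := (B.isCuspBox p hp).left_lt

theorem lt_b : p < B.b p := (B.isCuspBox p hp).lt_right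

theorem self_mem : p ∈ Icc (B.a p) (B.b p) := ⟨(B.a_lt hp).le, (B.lt_b hp).le⟩

theorem a_mem : B.a p ∈ Icc (B.a p) (B.b p) := ⟨le_rfl, ((B.a_lt hp).trans (B.lt_b hp)).le⟩

theorem b_mem : B.b p ∈ Icc (B.a p) (B.b p) := ⟨((B.a_lt hp).trans (B.lt_b hp)).le, le_rfl⟩

theorem eq_of_sameParam {s t : ℝ} (hs : s ∈ Icc (B.a p) (B.b p)) (ht : t ∈ Icc (B.a p) (B.b p))
    (h : SameParam s t) : s = t :=
  (B.isCuspBox p hp).injOn hs ht (h.apply_eq K.periodic_front)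

theorem b_sub_a_lt : B.b p < B.a p + 1 := by
  by_contra! h
  have h1 := B.eq_of_sameParam hp (s := B.a p + 1) (t := B.a p)
    ⟨by linarith, h⟩ (B.a_mem hp) ⟨1, by simp⟩
  linarith

theorem eq_of_deriv_eq_zero {t : ℝ} (ht : t ∈ Icc (B.a p) (B.b p)) (h : deriv K.x t = 0) :
    t = p := by
  obtain ⟨q, hq, hqt⟩ := B.generic.exists_cusp h
  have h1 : t ∈ B.params q := (B.params_congr hqt).2 (B.mem_params hq (B.self_mem hq))
  by_cases hpq : q = p
  · subst hpq
    exact B.eq_of_sameParam hq ht (B.self_mem hq) hqt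
  · exact absurd h1 (B.notMem_params_of_mem hp hq hpq (B.mem_params hp ht))

theorem z_ne {s t : ℝ} (hs : s ∈ Icc (B.a p) (B.b p)) (ht : t ∈ Icc (B.a p) (B.b p))
    (hx : K.x s = K.x t) (hne : s ≠ t) : K.z s ≠ K.z t := fun h =>
  hne ((B.isCuspBox p hp).injOn hs ht (Prod.ext hx h))

/-- Next to the endpoints of the arc in a box, the front is outside the box. -/
theorem eventually_notMem_left : ∀ᶠ t in 𝓝[<] (B.a p), t ∉ B.params p := by
  have h1 : Ioo (B.b p - 1) (B.a p) ∈ 𝓝[<] (B.a p) :=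
    Ioo_mem_nhdsLT (by linarith [B.b_sub_a_lt hp])
  filter_upwards [h1] with t ht hmem
  obtain ⟨n, hn⟩ := (B.mem_params_iff hp).1 hmem
  have h2 : (0 : ℝ) < n := by linarith [hn.1, ht.2]
  have h3 : (n : ℝ) < 1 := by linarith [hn.2, ht.1]
  norm_cast at h2 h3
  omega

theorem eventually_notMem_right : ∀ᶠ t in 𝓝[>] (B.b p), t ∉ B.params p := by
  have h1 : Ioo (B.b p) (B.a p + 1) ∈ 𝓝[>] (B.b p) :=
    Ioo_mem_nhdsGT (by linarith [B.b_sub_a_lt hp])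
  filter_upwards [h1] with t ht hmem
  obtain ⟨n, hn⟩ := (B.mem_params_iff hp).1 hmem
  have h2 : (n : ℝ) < 0 := by linarith [hn.2, ht.1]
  have h3 : (-1 : ℝ) < n := by linarith [hn.1, ht.2]
  norm_cast at h2 h3
  omega

/-- The other boxes stay away from the points of a box. -/
theorem eventually_notMem_other {t : ℝ} (ht : t ∈ B.params p) :
    ∀ᶠ s in 𝓝 t, ∀ q ∈ cusps K.front, q ≠ p → s ∉ B.params q := by
  refine (eventually_all_finite B.generic.finite_cusps).2 fun q hq => ?_
  by_cases hqp : q = p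
  · simp [hqp]
  · filter_upwards [(B.isClosed_params q).isOpen_compl.mem_nhds
      (B.notMem_params_of_mem hp hq hqp ht)] with s hs _ using hs

/-- The horizontal coordinate near a left cusp (`e = 1`) or a right cusp (`e = -1`). -/
theorem exists_sign : ∃ e : ℝ, ((e = 1 ∧ IsLeftCusp K.front p) ∨ (e = -1 ∧ IsRightCusp K.front p)) ∧
    (∀ t ∈ Ico (B.a p) p, e * deriv K.x t < 0) ∧ (∀ t ∈ Ioc p (B.b p), 0 < e * deriv K.x t) := by
  have key : ∀ e : ℝ, e ≠ 0 → (∀ᶠ t in 𝓝[<] p, e * deriv K.x t < 0) →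
      (∀ᶠ t in 𝓝[>] p, 0 < e * deriv K.x t) →
      (∀ t ∈ Ico (B.a p) p, e * deriv K.x t < 0) ∧ (∀ t ∈ Ioc p (B.b p), 0 < e * deriv K.x t) := by
    intro e he h1 h2
    have hc : Continuous fun t => e * deriv K.x t :=
      continuous_const.mul K.smooth_x.continuous_deriv_top
    have hne : ∀ t ∈ Icc (B.a p) (B.b p), t ≠ p → e * deriv K.x t ≠ 0 := fun t ht htp h =>
      htp (B.eq_of_deriv_eq_zero hp ht ((mul_eq_zero.1 h).resolve_left he))
    constructor
    · intro t ht
      by_contra! hcon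
      obtain ⟨s, hs, hst⟩ := (h1.and (Ioo_mem_nhdsLT ht.2)).exists
      obtain ⟨r, hr, hr0⟩ := intermediate_value_Icc' hst.1.le hc.continuousOn ⟨hs.le, hcon⟩
      exact hne r ⟨ht.1.trans hr.1, (hr.2.trans hst.2.le).trans (B.lt_b hp).le⟩
        (hr.2.trans_lt hst.2).ne hr0
    · intro t ht
      by_contra! hcon
      obtain ⟨s, hs, hst⟩ := (h2.and (Ioo_mem_nhdsGT ht.1)).exists
      obtain ⟨r, hr, hr0⟩ := intermediate_value_Icc' hst.2.le hc.continuousOn ⟨hcon, hs.le⟩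
      exact hne r ⟨(B.a_lt hp).le.trans (hst.1.le.trans hr.1), hr.2.trans ht.2⟩
        (hst.1.trans_le hr.1).ne' hr0
  rcases hp.2 with h | h
  · exact ⟨1, Or.inl ⟨rfl, h⟩, key 1 one_ne_zero
      (h.2.1.mono fun t (ht : deriv K.x t < 0) => by linarith)
      (h.2.2.mono fun t (ht : 0 < deriv K.x t) => by linarith)⟩
  · exact ⟨-1, Or.inr ⟨rfl, h⟩, key (-1) (by norm_num)
      (h.2.1.mono fun t (ht : 0 < deriv K.x t) => by linarith)
      (h.2.2.mono fun t (ht : deriv K.x t < 0) => by linarith)⟩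

end Cusp

end FrontBoxes

namespace FrontBoxes

variable {K : LegendrianKnot} (B : FrontBoxes K)

/-- `e = 1` at a left cusp, where `x` has a minimum, and `e = -1` at a right cusp. -/
structure IsCuspSign (p e : ℝ) : Prop where
  cases : (e = 1 ∧ IsLeftCusp K.front p) ∨ (e = -1 ∧ IsRightCusp K.front p)
  neg : ∀ t ∈ Ico (B.a p) p, e * deriv K.x t < 0
  pos : ∀ t ∈ Ioc p (B.b p), 0 < e * deriv K.x t

theorem exists_isCuspSign {p : ℝ} (hp : p ∈ cusps K.front) : ∃ e, B.IsCuspSign p e :=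
  let ⟨e, h1, h2, h3⟩ := B.exists_sign hp
  ⟨e, h1, h2, h3⟩

namespace IsCuspSign

variable {B} {p e : ℝ}

theorem continuous (_ : B.IsCuspSign p e) : Continuous fun t => e * K.x t :=
  continuous_const.mul K.smooth_x.continuous

variable (he : B.IsCuspSign p e)
include he

theorem ne_zero : e ≠ 0 := by
  rcases he.cases with h | h <;> rw [h.1] <;> norm_num

theorem eq_neg_one (h : IsRightCusp K.front p) : e = -1 := by
  rcases he.cases with h' | h'
  · obtain ⟨t, h1, h2⟩ := (h.2.1.and h'.2.2.1).exists
    exact absurd h1 (not_lt.2 h2.le)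
  · exact h'.1

theorem eq_one (h : IsLeftCusp K.front p) : e = 1 := by
  rcases he.cases with h' | h'
  · exact h'.1
  · obtain ⟨t, h1, h2⟩ := (h.2.1.and h'.2.2.1).exists
    exact absurd h1 (not_lt.2 h2.le)

theorem anti : StrictAntiOn (fun t => e * K.x t) (Icc (B.a p) p) := by
  refine strictAntiOn_of_deriv_neg (convex_Icc _ _)
    (continuous_const.mul K.smooth_x.continuous).continuousOn fun t ht => ?_
  rw [interior_Icc] at ht
  rw [deriv_const_mul_field]
  exact he.neg t ⟨ht.1.le, ht.2⟩

theorem mono : StrictMonoOn (fun t => e * K.x t) (Icc p (B.b p)) := by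
  refine strictMonoOn_of_deriv_pos (convex_Icc _ _)
    (continuous_const.mul K.smooth_x.continuous).continuousOn fun t ht => ?_
  rw [interior_Icc] at ht
  rw [deriv_const_mul_field]
  exact he.pos t ⟨ht.1, ht.2.le⟩

/-- The points of the arc on the same vertical line. -/
theorem eq_or_branches (hp : p ∈ cusps K.front) {s t : ℝ} (hs : s ∈ Icc (B.a p) (B.b p))
    (ht : t ∈ Icc (B.a p) (B.b p)) (hx : K.x s = K.x t) :
    s = t ∨ (s ∈ Ico (B.a p) p ∧ t ∈ Ioc p (B.b p)) ∨ (t ∈ Ico (B.a p) p ∧ s ∈ Ioc p (B.b p)) := by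
  have hxe : e * K.x s = e * K.x t := by rw [hx]
  have hap : p ∈ Icc (B.a p) p := ⟨(B.a_lt hp).le, le_rfl⟩
  have hpb : p ∈ Icc p (B.b p) := ⟨le_rfl, (B.lt_b hp).le⟩
  rcases le_or_gt s p with h1 | h1
  · rcases le_or_gt t p with h2 | h2
    · exact Or.inl (he.anti.injOn ⟨hs.1, h1⟩ ⟨ht.1, h2⟩ hxe)
    · rcases h1.eq_or_lt with rfl | h1
      · exact Or.inl (he.mono.injOn hpb ⟨h2.le, ht.2⟩ hxe)
      · exact Or.inr (Or.inl ⟨⟨hs.1, h1⟩, ⟨h2, ht.2⟩⟩)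
  · rcases lt_or_ge t p with h2 | h2
    · exact Or.inr (Or.inr ⟨⟨ht.1, h2⟩, ⟨h1, hs.2⟩⟩)
    · exact Or.inl (he.mono.injOn ⟨h1.le, hs.2⟩ ⟨h2, ht.2⟩ hxe)

theorem height_pos (hp : p ∈ cusps K.front) {s : ℝ} (hs : s ∈ Ico (B.a p) p) :
    e * K.x p < e * K.x s :=
  he.anti ⟨hs.1, hs.2.le⟩ ⟨(B.a_lt hp).le, le_rfl⟩ hs.2

/-- There are pairs of points on the same vertical line as close to the cusp as one wants. -/
theorem exists_pair_near (hp : p ∈ cusps K.front) {U : Set ℝ} (hU : U ∈ 𝓝 p) {h : ℝ}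
    (hh : e * K.x p < h) : ∃ s ∈ Ico (B.a p) p ∩ U, ∃ t ∈ Ioc p (B.b p) ∩ U,
      K.x s = K.x t ∧ e * K.x s < h := by
  obtain ⟨ρ, hρ, hρU⟩ : ∃ ρ ∈ Ioc p (B.b p), Icc p ρ ⊆ U := by
    obtain ⟨c, hc, hcU⟩ := mem_nhdsGE_iff_exists_Icc_subset.1
      (mem_nhdsWithin_of_mem_nhds hU)
    refine ⟨min c (B.b p), ⟨lt_min hc (B.lt_b hp), min_le_right _ _⟩, fun t ht => hcU ?_⟩
    exact ⟨ht.1, ht.2.trans (min_le_left _ _)⟩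
  have hρX : e * K.x p < e * K.x ρ :=
    he.mono ⟨le_rfl, (B.lt_b hp).le⟩ ⟨hρ.1.le, hρ.2⟩ hρ.1
  have h1 : ∀ᶠ s in 𝓝[<] p, s ∈ U ∧ e * K.x s < min h (e * K.x ρ) :=
    nhdsWithin_le_nhds ((eventually_of_mem hU fun _ h => h).and
      (he.continuous.continuousAt.eventually (gt_mem_nhds (lt_min hh hρX))))
  obtain ⟨s, ⟨hsU, hsX⟩, hs⟩ := (h1.and (Ico_mem_nhdsLT (B.a_lt hp))).exists
  obtain ⟨t, ht, htX⟩ := intermediate_value_Icc hρ.1.le he.continuous.continuousOn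
    ⟨(he.height_pos hp hs).le, (hsX.trans_le (min_le_right _ _)).le⟩
  simp only at htX
  have htp : t ≠ p := by
    rintro rfl
    exact (he.height_pos hp hs).ne htX
  exact ⟨s, ⟨hs, hsU⟩, t, ⟨⟨lt_of_le_of_ne ht.1 htp.symm, ht.2.trans hρ.2⟩, hρU ht⟩,
    (mul_left_cancel₀ he.ne_zero htX).symm, hsX.trans_le (min_le_left _ _)⟩

/-- `valley_sign` for the arc in a box. -/
theorem sign (hp : p ∈ cusps K.front) {f : ℝ → ℝ → ℝ}
    (hf : Continuous fun q : ℝ × ℝ => f q.1 q.2) {s t s' t' : ℝ}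
    (hs : s ∈ Ico (B.a p) p) (ht : t ∈ Ioc p (B.b p)) (hst : K.x s = K.x t)
    (hs' : s' ∈ Ico (B.a p) p) (ht' : t' ∈ Ioc p (B.b p)) (hst' : K.x s' = K.x t')
    (hle : e * K.x s ≤ e * K.x s')
    (hne : ∀ σ ∈ Ico (B.a p) p, ∀ ρ ∈ Ioc p (B.b p), K.x σ = K.x ρ → e * K.x s ≤ e * K.x σ →
      e * K.x σ ≤ e * K.x s' → f σ ρ ≠ 0) :
    0 < f s t * f s' t' := by
  refine valley_sign he.continuous he.anti he.mono hf ⟨hs.1, hs.2.le⟩ ⟨ht.1.le, ht.2⟩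
    (by simp only [hst]) ⟨hs'.1, hs'.2.le⟩ ⟨ht'.1.le, ht'.2⟩ (by simp only [hst']) hle ?_
  intro σ hσ ρ hρ e1 e2 e3
  have hlt : e * K.x p < e * K.x σ := (he.height_pos hp hs).trans_le e2
  refine hne σ ⟨hσ.1, lt_of_le_of_ne hσ.2 ?_⟩ ρ ⟨lt_of_le_of_ne hρ.1 ?_, hρ.2⟩
    (mul_left_cancel₀ he.ne_zero e1) e2 e3
  · rintro rfl; exact hlt.ne rfl
  · rintro rfl; exact hlt.ne e1.symm

/-- The order of the two branches at a cusp. -/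
theorem z_order (hp : p ∈ cusps K.front) {s t : ℝ} (hs : s ∈ Ico (B.a p) p)
    (ht : t ∈ Ioc p (B.b p)) (hst : K.x s = K.x t) :
    0 < e * deriv K.y p * (K.z t - K.z s) := by
  have hx0 : deriv K.x p = 0 := LegendrianKnot.deriv_x_of_mem_cusps hp
  have hev := eventually_branch_order K.smooth_x K.smooth_y K.smooth_z K.legendrian
    (K.deriv_y_ne_zero hx0)
    (eventually_of_mem (Ico_mem_nhdsLT (B.a_lt hp)) he.neg)
    (eventually_of_mem (Ioc_mem_nhdsGT (B.lt_b hp)) he.pos)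
  obtain ⟨A, hA, A', hA', hAA⟩ := mem_prod_iff.1 hev
  obtain ⟨σ, hσ, ρ, hρ, hx, hlt⟩ := he.exists_pair_near hp (inter_mem hA hA')
    (he.height_pos hp hs)
  have h1 := hAA (show (σ, ρ) ∈ A ×ˢ A' from ⟨hσ.2.1, hρ.2.2⟩) hσ.1.2 hρ.1.1 hx
  have hz := K.smooth_z.continuous
  have h2 := he.sign hp (f := fun s t => e * deriv K.y p * (K.z t - K.z s)) (by fun_prop)
    hσ.1 hρ.1 hx hs ht hst hlt.le fun σ hσ ρ hρ hx _ _ => by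
      refine mul_ne_zero (mul_ne_zero he.ne_zero (K.deriv_y_ne_zero hx0)) (sub_ne_zero.2 ?_)
      exact (B.z_ne hp ⟨hσ.1, hσ.2.le.trans (B.lt_b hp).le⟩
        ⟨(B.a_lt hp).le.trans hρ.1.le, hρ.2⟩ hx (hσ.2.trans hρ.1).ne).symm
  exact pos_of_mul_pos_right h2 h1.le

end IsCuspSign

/-- A function `w` such that the curve `(x, w)` is a resolution of the front with the given boxes. -/
structure IsResolutionHeight (w : ℝ → ℝ) : Prop where
  smooth : ContDiff ℝ ∞ w
  periodic : Function.Periodic w 1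
  immersed : ∀ t, deriv K.x t = 0 → deriv w t ≠ 0
  eq_of_notMem : ∀ t, (∀ p ∈ cusps K.front, t ∉ B.params p) → w t = K.z t
  maps : ∀ p ∈ cusps K.front, ∀ t ∈ Icc (B.a p) (B.b p), w t ∈ Icc (B.u p).2 (B.v p).2
  left : ∀ p ∈ cusps K.front, IsLeftCusp K.front p → ∀ s ∈ Icc (B.a p) (B.b p),
    ∀ t ∈ Icc (B.a p) (B.b p), K.x s = K.x t → w s = w t → s = t
  right : ∀ p ∈ cusps K.front, IsRightCusp K.front p →
    ∃ s₀ ∈ Ioo (B.a p) p, ∃ t₀ ∈ Ioo p (B.b p), K.x s₀ = K.x t₀ ∧ w s₀ = w t₀ ∧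
      ∀ s ∈ Icc (B.a p) (B.b p), ∀ t ∈ Icc (B.a p) (B.b p), s < t → K.x s = K.x t → w s = w t →
        s = s₀ ∧ t = t₀
  transverse : ∀ s t, ¬ SameParam s t → K.x s = K.x t → w s = w t →
    deriv K.x s * deriv w t - deriv w s * deriv K.x t ≠ 0

theorem deriv_x_ne_zero_of_notMem {t : ℝ} (h : ∀ p ∈ cusps K.front, t ∉ B.params p) :
    deriv K.x t ≠ 0 := fun h0 => by
  obtain ⟨q, hq, hqt⟩ := B.generic.exists_cusp h0
  exact h q hq ((B.params_congr hqt).2 (B.mem_params hq (B.self_mem hq)))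

theorem mem_Icc_fst {p t : ℝ} (ht : t ∈ B.params p) : K.x t ∈ Icc (B.u p).1 (B.v p).1 :=
  ⟨ht.1.1, ht.2.1⟩

theorem mem_Icc_snd {p t : ℝ} (ht : t ∈ B.params p) : K.z t ∈ Icc (B.u p).2 (B.v p).2 :=
  ⟨ht.1.2, ht.2.2⟩

theorem mem_params_of_mem {p t : ℝ} (h1 : K.x t ∈ Icc (B.u p).1 (B.v p).1)
    (h2 : K.z t ∈ Icc (B.u p).2 (B.v p).2) : t ∈ B.params p :=
  ⟨⟨h1.1, h2.1⟩, ⟨h1.2, h2.2⟩⟩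

theorem eventually_mem_params {p t : ℝ} (h1 : K.x t ∈ Ioo (B.u p).1 (B.v p).1)
    (h2 : K.z t ∈ Ioo (B.u p).2 (B.v p).2) : ∀ᶠ s in 𝓝 t, s ∈ B.params p := by
  filter_upwards [K.smooth_x.continuous.continuousAt.preimage_mem_nhds (Icc_mem_nhds h1.1 h1.2),
    K.smooth_z.continuous.continuousAt.preimage_mem_nhds (Icc_mem_nhds h2.1 h2.2)] with s k1 k2
  exact B.mem_params_of_mem k1 k2

namespace IsResolutionHeight

variable {B} {w : ℝ → ℝ} (hw : B.IsResolutionHeight w)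
include hw

theorem mem_Icc {p t : ℝ} (hp : p ∈ cusps K.front) (ht : t ∈ B.params p) :
    w t ∈ Icc (B.u p).2 (B.v p).2 := by
  obtain ⟨n, hn⟩ := (B.mem_params_iff hp).1 ht
  rw [← hw.periodic.add_int t n]
  exact hw.maps p hp _ hn

theorem eq_left {p : ℝ} (hp : p ∈ cusps K.front) : w (B.a p) = K.z (B.a p) := by
  have h1 : ∀ᶠ t in 𝓝[<] (B.a p), K.z t = w t := by
    filter_upwards [B.eventually_notMem_left hp, nhdsWithin_le_nhds
      (B.eventually_notMem_other hp (B.mem_params hp (B.a_mem hp)))] with t h1 h2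
    refine (hw.eq_of_notMem t fun q hq => ?_).symm
    by_cases hqp : q = p
    · rwa [hqp]
    · exact h2 q hq hqp
  refine tendsto_nhds_unique (f := w) (l := 𝓝[<] (B.a p)) ?_ ?_
  · exact hw.smooth.continuous.continuousAt.mono_left nhdsWithin_le_nhds
  · exact (K.smooth_z.continuous.continuousAt.mono_left nhdsWithin_le_nhds).congr' h1

theorem eq_right {p : ℝ} (hp : p ∈ cusps K.front) : w (B.b p) = K.z (B.b p) := by
  have h1 : ∀ᶠ t in 𝓝[>] (B.b p), K.z t = w t := by
    filter_upwards [B.eventually_notMem_right hp, nhdsWithin_le_nhds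
      (B.eventually_notMem_other hp (B.mem_params hp (B.b_mem hp)))] with t h1 h2
    refine (hw.eq_of_notMem t fun q hq => ?_).symm
    by_cases hqp : q = p
    · rwa [hqp]
    · exact h2 q hq hqp
  refine tendsto_nhds_unique (f := w) (l := 𝓝[>] (B.b p)) ?_ ?_
  · exact hw.smooth.continuous.continuousAt.mono_left nhdsWithin_le_nhds
  · exact (K.smooth_z.continuous.continuousAt.mono_left nhdsWithin_le_nhds).congr' h1

/-- At an endpoint `c` of the arc the two branches of `w` are ordered like those of `z`. -/
theorem order_of_endpoint {p e c d r : ℝ} (hp : p ∈ cusps K.front) (he : B.IsCuspSign p e)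
    (hc : c ∈ Icc (B.a p) (B.b p)) (hd : d ∈ Icc (B.a p) (B.b p)) (hr : r ∈ Icc (B.a p) (B.b p))
    (hwc : w c = K.z c) (hwd : w d = K.z d) (hout : ∃ᶠ t in 𝓝 c, t ∉ B.params p)
    (hpc : e * K.x p < e * K.x c) (hrd : r ≠ d → e * K.x r < e * K.x d)
    (hx : K.x r = K.x c) (hrc : r ≠ c) (hne : w r ≠ w c) :
    0 < (w r - w c) * (K.z r - K.z c) := by
  have hz : K.z r ≠ K.z c := B.z_ne hp hr hc hx hrc
  have hpm := B.mem_params hp (B.self_mem hp)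
  by_cases hrd' : r = d
  · rw [hrd', hwd, hwc, ← hrd']
    exact mul_self_pos.2 (sub_ne_zero.2 hz)
  have hlt := hrd hrd'
  have hcm := B.mem_params hp hc
  have hdm := B.mem_params hp hd
  have hxo : K.x c ∈ Ioo (B.u p).1 (B.v p).1 := by
    rw [hx] at hlt
    have h1 := B.mem_Icc_fst hpm
    have h2 := B.mem_Icc_fst hdm
    rcases he.cases with h | h
    · rw [h.1] at hlt hpc
      exact ⟨by linarith [h1.1], by linarith [h2.2]⟩
    · rw [h.1] at hlt hpc
      exact ⟨by linarith [h2.1], by linarith [h1.2]⟩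
  have hzo : K.z c ∉ Ioo (B.u p).2 (B.v p).2 := fun hzo =>
    hout ((B.eventually_mem_params hxo hzo).mono fun t ht => not_not.2 ht)
  have hzc := B.mem_Icc_snd hcm
  have hzr := B.mem_Icc_snd (B.mem_params hp hr)
  have hwr := hw.maps p hp r hr
  rw [hwc] at hne ⊢
  rcases hzc.1.eq_or_lt with h1 | h1
  · rw [h1] at hwr hzr
    exact mul_pos (sub_pos.2 (lt_of_le_of_ne hwr.1 hne.symm))
      (sub_pos.2 (lt_of_le_of_ne hzr.1 hz.symm))
  · have h2 : K.z c = (B.v p).2 := le_antisymm hzc.2 (not_lt.1 fun h2 => hzo ⟨h1, h2⟩)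
    rw [← h2] at hwr hzr
    exact mul_pos_of_neg_of_neg (sub_neg.2 (lt_of_le_of_ne hwr.2 hne))
      (sub_neg.2 (lt_of_le_of_ne hzr.2 hz))

/-- The outermost pair of points of the arc on the same vertical line. -/
theorem exists_top_pair {p e : ℝ} (hp : p ∈ cusps K.front) (he : B.IsCuspSign p e)
    (hne : ∀ s ∈ Ico (B.a p) p, ∀ t ∈ Ioc p (B.b p), K.x s = K.x t → (s = B.a p ∨ t = B.b p) →
      w s ≠ w t) :
    ∃ s ∈ Ico (B.a p) p, ∃ t ∈ Ioc p (B.b p), K.x s = K.x t ∧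
      0 < (w t - w s) * (K.z t - K.z s) ∧
      ∀ s' ∈ Ico (B.a p) p, ∀ t' ∈ Ioc p (B.b p), K.x s' = K.x t' → e * K.x s' ≤ e * K.x s := by
  have hap := B.a_lt hp
  have hpb := B.lt_b hp
  have hpa : e * K.x p < e * K.x (B.a p) := he.height_pos hp ⟨le_rfl, hap⟩
  have hpb' : e * K.x p < e * K.x (B.b p) := he.mono ⟨le_rfl, hpb.le⟩ ⟨hpb.le, le_rfl⟩ hpb
  rcases le_total (e * K.x (B.a p)) (e * K.x (B.b p)) with hle | hle
  · obtain ⟨t, ht, htX⟩ := intermediate_value_Icc hpb.le he.continuous.continuousOn ⟨hpa.le, hle⟩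
    simp only at htX
    have hxt : K.x t = K.x (B.a p) := mul_left_cancel₀ he.ne_zero htX
    have htp : p < t := lt_of_le_of_ne ht.1 fun h => by rw [← h] at htX; exact hpa.ne htX
    refine ⟨B.a p, ⟨le_rfl, hap⟩, t, ⟨htp, ht.2⟩, hxt.symm, ?_, ?_⟩
    · refine hw.order_of_endpoint hp he (B.a_mem hp) (B.b_mem hp) ⟨hap.le.trans ht.1, ht.2⟩
        (hw.eq_left hp) (hw.eq_right hp) ?_ hpa ?_ hxt (hap.trans htp).ne' ?_
      · exact (B.eventually_notMem_left hp).frequently.filter_mono nhdsWithin_le_nhds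
      · exact fun h => he.mono ht ⟨hpb.le, le_rfl⟩ (lt_of_le_of_ne ht.2 h)
      · exact (hne _ ⟨le_rfl, hap⟩ _ ⟨htp, ht.2⟩ hxt.symm (Or.inl rfl)).symm
    · exact fun s' hs' t' _ _ => he.anti.antitoneOn ⟨le_rfl, hap.le⟩ ⟨hs'.1, hs'.2.le⟩ hs'.1
  · obtain ⟨s, hs, hsX⟩ := intermediate_value_Icc' hap.le he.continuous.continuousOn
      ⟨hpb'.le, hle⟩
    simp only at hsX
    have hxs : K.x s = K.x (B.b p) := mul_left_cancel₀ he.ne_zero hsX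
    have hsp : s < p := lt_of_le_of_ne hs.2 fun h => by rw [h] at hsX; exact hpb'.ne hsX
    refine ⟨s, ⟨hs.1, hsp⟩, B.b p, ⟨hpb, le_rfl⟩, hxs, ?_, ?_⟩
    · have := hw.order_of_endpoint hp he (B.b_mem hp) (B.a_mem hp) ⟨hs.1, hs.2.trans hpb.le⟩
        (hw.eq_right hp) (hw.eq_left hp) ?_ hpb' ?_ hxs (hsp.trans hpb).ne ?_
      · linarith
      · exact (B.eventually_notMem_right hp).frequently.filter_mono nhdsWithin_le_nhds
      · exact fun h => he.anti ⟨le_rfl, hap.le⟩ hs (lt_of_le_of_ne hs.1 h.symm)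
      · exact hne _ ⟨hs.1, hsp⟩ _ ⟨hpb, le_rfl⟩ hxs (Or.inr rfl)
    · intro s' _ t' ht' h
      rw [h, hsX]
      exact he.mono.monotoneOn ⟨ht'.1.le, ht'.2⟩ ⟨hpb.le, le_rfl⟩ ht'.2

/-- Above every height above which `w` has no crossing, the branches of `w` are ordered like those
of `z`. -/
theorem order_of_forall_ne {p e h : ℝ} (hp : p ∈ cusps K.front) (he : B.IsCuspSign p e)
    (hne : ∀ s ∈ Ico (B.a p) p, ∀ t ∈ Ioc p (B.b p), K.x s = K.x t → h < e * K.x s → w s ≠ w t)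
    (hend : ∀ s ∈ Ico (B.a p) p, ∀ t ∈ Ioc p (B.b p), K.x s = K.x t → (s = B.a p ∨ t = B.b p) →
      w s ≠ w t)
    {s t : ℝ} (hs : s ∈ Ico (B.a p) p) (ht : t ∈ Ioc p (B.b p)) (hx : K.x s = K.x t)
    (hh : h < e * K.x s) : 0 < (w t - w s) * (K.z t - K.z s) := by
  obtain ⟨s', hs', t', ht', hx', hpos, hmax⟩ := hw.exists_top_pair hp he hend
  have hwc := hw.smooth.continuous
  have hzc := K.smooth_z.continuous
  have := he.sign hp (f := fun s t => (w t - w s) * (K.z t - K.z s)) (by fun_prop) hs ht hx hs' ht'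
    hx' (hmax s hs t ht hx) fun σ hσ ρ hρ hxσ h1 h2 =>
      mul_ne_zero (sub_ne_zero.2 (hne σ hσ ρ hρ hxσ (hh.trans_le h1)).symm)
        (sub_ne_zero.2 (B.z_ne hp ⟨hσ.1, hσ.2.le.trans (B.lt_b hp).le⟩
        ⟨(B.a_lt hp).le.trans hρ.1.le, hρ.2⟩ hxσ (hσ.2.trans hρ.1).ne).symm)
  exact pos_of_mul_pos_left this hpos.le

theorem order_left {p : ℝ} (hp : p ∈ cusps K.front) (hl : IsLeftCusp K.front p)
    {s t : ℝ} (hs : s ∈ Ico (B.a p) p) (ht : t ∈ Ioc p (B.b p)) (hx : K.x s = K.x t) :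
    0 < (w t - w s) * (K.z t - K.z s) := by
  obtain ⟨e, he⟩ := B.exists_isCuspSign hp
  have hne : ∀ s ∈ Ico (B.a p) p, ∀ t ∈ Ioc p (B.b p), K.x s = K.x t → w s ≠ w t :=
    fun s hs t ht hx h => (hs.2.trans ht.1).ne
      (hw.left p hp hl s ⟨hs.1, hs.2.le.trans (B.lt_b hp).le⟩ t
        ⟨(B.a_lt hp).le.trans ht.1.le, ht.2⟩ hx h)
  exact hw.order_of_forall_ne hp he (h := e * K.x s - 1) (fun s hs t ht hx _ => hne s hs t ht hx)
    (fun s hs t ht hx _ => hne s hs t ht hx) hs ht hx (by linarith)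

/-- The crossing of the resolution at a right cusp. -/
theorem order_right {p : ℝ} (hp : p ∈ cusps K.front) (hr : IsRightCusp K.front p) :
    ∃ s₀ ∈ Ioo (B.a p) p, ∃ t₀ ∈ Ioo p (B.b p), K.x s₀ = K.x t₀ ∧ w s₀ = w t₀ ∧
      (∀ s ∈ Ico (B.a p) p, ∀ t ∈ Ioc p (B.b p), K.x s = K.x t → K.x s < K.x s₀ →
        0 < (w t - w s) * (K.z t - K.z s)) ∧
      (∀ s ∈ Ico (B.a p) p, ∀ t ∈ Ioc p (B.b p), K.x s = K.x t → K.x s₀ < K.x s →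
        (w t - w s) * (K.z t - K.z s) < 0) ∧
      (deriv w t₀ / deriv K.x t₀ - deriv w s₀ / deriv K.x s₀) * (K.z t₀ - K.z s₀) < 0 := by
  obtain ⟨e, he⟩ := B.exists_isCuspSign hp
  obtain rfl := he.eq_neg_one hr
  obtain ⟨s₀, hs₀, t₀, ht₀, hx₀, hw₀, huniq⟩ := hw.right p hp hr
  have hap := B.a_lt hp
  have hpb := B.lt_b hp
  have huniq' : ∀ s ∈ Ico (B.a p) p, ∀ t ∈ Ioc p (B.b p), K.x s = K.x t → w s = w t →
      s = s₀ ∧ t = t₀ := fun s hs t ht hx h =>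
    huniq s ⟨hs.1, hs.2.le.trans hpb.le⟩ t ⟨hap.le.trans ht.1.le, ht.2⟩ (hs.2.trans ht.1) hx h
  have habove : ∀ s ∈ Ico (B.a p) p, ∀ t ∈ Ioc p (B.b p), K.x s = K.x t → K.x s < K.x s₀ →
      0 < (w t - w s) * (K.z t - K.z s) := by
    intro s hs t ht hx hlt
    refine hw.order_of_forall_ne hp he (h := -1 * K.x s₀) (fun s hs t ht hx hlt h => ?_)
      (fun s hs t ht hx hend h => ?_) hs ht hx (by linarith)
    · rw [(huniq' s hs t ht hx h).1] at hlt
      exact hlt.ne rfl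
    · rcases hend with rfl | rfl
      · exact hs₀.1.ne (huniq' _ hs _ ht hx h).1
      · exact ht₀.2.ne' (huniq' _ hs _ ht hx h).2
  set o : ℝ := -1 * deriv K.y p with ho
  have hzo : ∀ s ∈ Ico (B.a p) p, ∀ t ∈ Ioc p (B.b p), K.x s = K.x t → 0 < o * (K.z t - K.z s) :=
    fun s hs t ht hx => he.z_order hp hs ht hx
  have hs₀' : s₀ ∈ Ico (B.a p) p := ⟨hs₀.1.le, hs₀.2⟩
  have ht₀' : t₀ ∈ Ioc p (B.b p) := ⟨ht₀.1, ht₀.2.le⟩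
  have hxs : deriv K.x s₀ ≠ 0 := fun h => by
    have := he.neg s₀ hs₀'; simp [h] at this
  have hxt : deriv K.x t₀ ≠ 0 := fun h => by
    have := he.pos t₀ ht₀'; simp [h] at this
  have ho0 : o ≠ 0 := fun h => by
    have := hzo s₀ hs₀' t₀ ht₀' hx₀; simp [h] at this
  have htr := hw.transverse s₀ t₀ (fun h => (hs₀.2.trans ht₀.1).ne
    (B.eq_of_sameParam hp ⟨hs₀.1.le, hs₀.2.le.trans hpb.le⟩ ⟨hap.le.trans ht₀.1.le, ht₀.2.le⟩ h))
    hx₀ hw₀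
  have hpos : ∀ σ ∈ Icc (B.a p) p, ∀ ρ ∈ Icc p (B.b p), -1 * K.x σ = -1 * K.x ρ →
      -1 * K.x s₀ < -1 * K.x σ → 0 < o * w ρ - o * w σ := by
    intro σ hσ ρ hρ e1 e2
    have hx : K.x σ = K.x ρ := by linarith
    have h3 := he.height_pos hp hs₀'
    have hσ' : σ ∈ Ico (B.a p) p := ⟨hσ.1, lt_of_le_of_ne hσ.2 (by rintro rfl; linarith)⟩
    have hρ' : ρ ∈ Ioc p (B.b p) := ⟨lt_of_le_of_ne hρ.1 (by rintro rfl; linarith), hρ.2⟩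
    have k1 := habove σ hσ' ρ hρ' hx (by linarith)
    have k2 := hzo σ hσ' ρ hρ' hx
    have k3 : 0 < (o * (w ρ - w σ)) * (K.z ρ - K.z σ) ^ 2 := by
      have := mul_pos k1 k2; nlinarith
    have := pos_of_mul_pos_left k3 (sq_nonneg _)
    linarith
  obtain ⟨hd, σ, hσ, ρ, hρ, hX, hσp, hσs, -, hbelow⟩ := valley_crossing (X := fun t => -1 * K.x t)
    (w := fun t => o * w t) he.continuous he.anti he.mono hs₀ ht₀ (by simp only [hx₀])
    (by simp only [hw₀]) ((K.smooth_x.hasDerivAt_top s₀).const_mul (-1))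
    ((K.smooth_x.hasDerivAt_top t₀).const_mul (-1)) ((hw.smooth.hasDerivAt_top s₀).const_mul o)
    ((hw.smooth.hasDerivAt_top t₀).const_mul o) (by simpa using hxs) (by simpa using hxt)
    (fun h => htr (by
      field_simp at h
      have h2 : o * (deriv K.x s₀ * deriv w t₀ - deriv w s₀ * deriv K.x t₀) = 0 := by linarith
      exact (mul_eq_zero.1 h2).resolve_left ho0)) hpos
  refine ⟨s₀, hs₀, t₀, ht₀, hx₀, hw₀, habove, ?_, ?_⟩
  · intro s hs t ht hx hlt
    have hps := he.height_pos hp hs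
    obtain ⟨σ', hσ', ρ', hρ', h1, h2, h3⟩ := hbelow (max (-1 * K.x s) (-1 * K.x σ))
      (le_max_right _ _) (max_lt (by linarith) hσs)
    have hm : -1 * K.x s ≤ -1 * K.x σ' := h1 ▸ le_max_left _ _
    have hm2 : -1 * K.x σ' < -1 * K.x s₀ := h1 ▸ max_lt (by linarith) hσs
    have hσ'' : σ' ∈ Ico (B.a p) p := ⟨hσ'.1, lt_of_le_of_ne hσ'.2 (by rintro rfl; linarith)⟩
    have hρ'' : ρ' ∈ Ioc p (B.b p) := ⟨lt_of_le_of_ne hρ'.1 (by rintro rfl; linarith), hρ'.2⟩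
    have hwc := hw.smooth.continuous
    have := he.sign hp (f := fun s t => o * w t - o * w s) (by fun_prop) hs ht hx hσ'' hρ''
      (by linarith) hm fun r hr q hq hxr _ k2 => by
        rw [← mul_sub]
        refine mul_ne_zero ho0 (sub_ne_zero.2 fun h => ?_)
        have := (huniq' r hr q hq hxr h.symm).1
        rw [this] at k2
        linarith
    have k1 : o * w t - o * w s < 0 := by
      by_contra! hcon
      exact absurd this (not_lt.2 (mul_nonpos_of_nonneg_of_nonpos hcon h3.le))
    have k2 := hzo s hs t ht hx
    have k3 : ((w t - w s) * (K.z t - K.z s)) * o ^ 2 < 0 := by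
      have := mul_neg_of_neg_of_pos k1 k2; nlinarith
    by_contra! hcon
    exact absurd k3 (not_lt.2 (mul_nonneg hcon (sq_nonneg _)))
  · have k2 := hzo s₀ hs₀' t₀ ht₀' hx₀
    have k1 : o * (deriv w t₀ / deriv K.x t₀ - deriv w s₀ / deriv K.x s₀) < 0 := by
      have e1 : o * deriv w t₀ / (-1 * deriv K.x t₀) - o * deriv w s₀ / (-1 * deriv K.x s₀) =
          -(o * (deriv w t₀ / deriv K.x t₀ - deriv w s₀ / deriv K.x s₀)) := by
        field_simp; ring
      rw [e1] at hd
      linarith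
    have k3 := mul_neg_of_neg_of_pos k1 k2
    by_contra! hcon
    have := mul_nonneg hcon (sq_nonneg o)
    nlinarith

/-- At a cusp the resolution turns in the same direction as the slope of the front. -/
theorem deriv_mul_pos {p : ℝ} (hp : p ∈ cusps K.front) : 0 < deriv w p * deriv K.y p := by
  obtain ⟨e, he⟩ := B.exists_isCuspSign hp
  have hx0 : deriv K.x p = 0 := LegendrianKnot.deriv_x_of_mem_cusps hp
  obtain ⟨A, hA, A', hA', hAA⟩ := mem_prod_iff.1 (eventually_sub_pos hw.smooth (hw.immersed p hx0))
  have main : ∀ s ∈ Ico (B.a p) p ∩ (A ∩ A'), ∀ t ∈ Ioc p (B.b p) ∩ (A ∩ A'), K.x s = K.x t →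
      0 < e * ((w t - w s) * (K.z t - K.z s)) → 0 < deriv w p * deriv K.y p := by
    intro s hs t ht hx h
    have h1 := hAA (show (s, t) ∈ A ×ˢ A' from ⟨hs.2.1, ht.2.2⟩) (hs.1.2.trans ht.1.1)
    simp only at h1
    have h2 := he.z_order hp hs.1 ht.1 hx
    have h3 := mul_pos (mul_pos h1 h2) h
    have h4 : 0 < (deriv w p * deriv K.y p) * (e * (w t - w s) * (K.z t - K.z s)) ^ 2 := by
      nlinarith
    exact pos_of_mul_pos_left h4 (sq_nonneg _)
  rcases hp.2 with h | h
  · obtain rfl := he.eq_one h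
    obtain ⟨s, hs, t, ht, hx, -⟩ := he.exists_pair_near hp (inter_mem hA hA')
      (h := 1 * K.x p + 1) (by linarith)
    exact main s hs t ht hx (by rw [one_mul]; exact hw.order_left hp h hs.1 ht.1 hx)
  · obtain rfl := he.eq_neg_one h
    obtain ⟨s₀, hs₀, t₀, ht₀, -, -, -, hlow, -⟩ := hw.order_right hp h
    obtain ⟨s, hs, t, ht, hx, hlt⟩ := he.exists_pair_near hp (inter_mem hA hA')
      (he.height_pos hp ⟨hs₀.1.le, hs₀.2⟩)
    exact main s hs t ht hx (by linarith [hlow s hs.1 t ht.1 hx (by linarith)])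

end IsResolutionHeight

end FrontBoxes

namespace FrontBoxes

variable {K : LegendrianKnot} (B : FrontBoxes K)

/-! ### Functions supported in the arcs around the cusps -/

/-- Periodic functions `φ p`, one for each cusp, vanishing near the ends of the arc around `p`. -/
structure IsArcFamily (φ : ℝ → ℝ → ℝ) : Prop where
  periodic : ∀ p ∈ cusps K.front, Function.Periodic (φ p) 1
  left : ∀ p ∈ cusps K.front, ∀ᶠ t in 𝓝 (B.a p), φ p t = 0
  right : ∀ p ∈ cusps K.front, ∀ᶠ t in 𝓝 (B.b p), φ p t = 0

open Classical in
/-- The function that equals `φ p` in the arc around `p`, for each cusp `p`, and vanishes outside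
these arcs. -/
noncomputable def glue (φ : ℝ → ℝ → ℝ) (t : ℝ) : ℝ :=
  ∑ p ∈ B.generic.finite_cusps.toFinset, (B.params p).indicator (φ p) t

variable {B}

theorem IsArcFamily.indicator_eventuallyEq {φ : ℝ → ℝ → ℝ} (hφ : B.IsArcFamily φ) {p : ℝ}
    (hp : p ∈ cusps K.front) {t : ℝ} (ht : t ∈ B.params p) :
    (B.params p).indicator (φ p) =ᶠ[𝓝 t] φ p := by
  obtain ⟨n, hn⟩ := (B.mem_params_iff hp).1 ht
  have hend : ∀ c, (∀ᶠ t in 𝓝 c, φ p t = 0) → t + n = c →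
      (B.params p).indicator (φ p) =ᶠ[𝓝 t] φ p := by
    rintro c hc rfl
    have h1 : ∀ᶠ s in 𝓝 t, φ p (s + n) = 0 :=
      (continuous_add_const (n : ℝ)).continuousAt.eventually hc
    filter_upwards [h1] with s hs
    rw [(hφ.periodic p hp).add_int] at hs
    simp [indicator, hs]
  rcases hn.1.eq_or_lt with h1 | h1
  · exact hend _ (hφ.left p hp) h1.symm
  rcases hn.2.eq_or_lt with h2 | h2
  · exact hend _ (hφ.right p hp) h2
  have h3 : ∀ᶠ s in 𝓝 t, s + (n : ℝ) ∈ Ioo (B.a p) (B.b p) :=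
    (continuous_add_const (n : ℝ)).continuousAt.eventually (Ioo_mem_nhds h1 h2)
  filter_upwards [h3] with s hs
  exact indicator_of_mem ((B.mem_params_iff hp).2 ⟨n, hs.1.le, hs.2.le⟩) _

theorem glue_of_notMem {φ : ℝ → ℝ → ℝ} {t : ℝ} (ht : ∀ p ∈ cusps K.front, t ∉ B.params p) :
    B.glue φ =ᶠ[𝓝 t] 0 := by
  filter_upwards [B.eventually_notMem ht] with s hs
  exact Finset.sum_eq_zero fun p hp =>
    indicator_of_notMem (hs p (B.generic.finite_cusps.mem_toFinset.1 hp)) _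

theorem IsArcFamily.glue_of_mem {φ : ℝ → ℝ → ℝ} (hφ : B.IsArcFamily φ) {p : ℝ}
    (hp : p ∈ cusps K.front) {t : ℝ} (ht : t ∈ B.params p) : B.glue φ =ᶠ[𝓝 t] φ p := by
  filter_upwards [hφ.indicator_eventuallyEq hp ht, B.eventually_notMem_other hp ht] with s h1 h2
  rw [glue, Finset.sum_eq_single p, h1]
  · exact fun q hq hqp =>
      indicator_of_notMem (h2 q (B.generic.finite_cusps.mem_toFinset.1 hq) hqp) _
  · exact fun h => absurd (B.generic.finite_cusps.mem_toFinset.2 hp) h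

theorem IsArcFamily.contDiff_glue {φ : ℝ → ℝ → ℝ} (hφ : B.IsArcFamily φ)
    (h : ∀ p ∈ cusps K.front, ContDiff ℝ ∞ (φ p)) : ContDiff ℝ ∞ (B.glue φ) := by
  rw [contDiff_iff_contDiffAt]
  intro t
  by_cases ht : ∃ p ∈ cusps K.front, t ∈ B.params p
  · obtain ⟨p, hp, ht⟩ := ht
    exact (h p hp).contDiffAt.congr_of_eventuallyEq (hφ.glue_of_mem hp ht)
  · push Not at ht
    exact (contDiffAt_const (c := (0 : ℝ))).congr_of_eventuallyEq (glue_of_notMem ht)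

theorem IsArcFamily.periodic_glue {φ : ℝ → ℝ → ℝ} (hφ : B.IsArcFamily φ) :
    Function.Periodic (B.glue φ) 1 := by
  intro t
  refine Finset.sum_congr rfl fun p hp => ?_
  have hp' := B.generic.finite_cusps.mem_toFinset.1 hp
  have h1 : t + 1 ∈ B.params p ↔ t ∈ B.params p := B.params_congr ⟨1, by simp⟩
  by_cases h : t ∈ B.params p
  · rw [indicator_of_mem h, indicator_of_mem (h1.2 h), hφ.periodic p hp']
  · rw [indicator_of_notMem h, indicator_of_notMem (h1.not.2 h)]

variable (B)

/-! ### The deformation of the front -/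

/-- The crossing `(s₀, t₀)` of the resolution `w` in the arc around the right cusp `p`, together with
a ramp `g` that starts before the crossing and whose slope exceeds `1` precisely beyond it. -/
structure IsRampCrossing (w : ℝ → ℝ) (r : ℝ) (g : ℝ → ℝ) (p s₀ t₀ : ℝ) : Prop where
  mem_left : s₀ ∈ Ioo (B.a p) p
  mem_right : t₀ ∈ Ioo p (B.b p)
  x_eq : K.x s₀ = K.x t₀
  before : ∀ s ∈ Ico (B.a p) p, ∀ t ∈ Ioc p (B.b p), K.x s = K.x t → K.x s < K.x s₀ →
    0 < (w t - w s) * (K.z t - K.z s)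
  beyond : ∀ s ∈ Ico (B.a p) p, ∀ t ∈ Ioc p (B.b p), K.x s = K.x t → K.x s₀ < K.x s →
    (w t - w s) * (K.z t - K.z s) < 0
  slope : (deriv w t₀ / deriv K.x t₀ - deriv w s₀ / deriv K.x s₀) * (K.z t₀ - K.z s₀) < 0
  ratio : r * (K.z t₀ - K.z s₀) = K.y t₀ - K.y s₀
  ramp_pos : ∀ ξ ≥ K.x s₀, 0 < g ξ
  deriv_lt : ∀ ξ < K.x s₀, deriv g ξ < 1
  deriv_near : ∀ᶠ ξ in 𝓝 (K.x s₀), deriv g ξ = 1 + (ξ - K.x s₀)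
  deriv_eq : ∀ ξ ≥ K.x s₀, deriv g ξ = 1 + (ξ - K.x s₀)

/-- The data of a deformation of `K` near its right cusps, adapted to the resolution `w`. -/
structure Deformation (w : ℝ → ℝ) where
  R : ℝ → ℝ
  G : ℝ → ℝ → ℝ
  smooth : ∀ p ∈ cusps K.front, ContDiff ℝ ∞ (G p)
  zero_left : ∀ p ∈ cusps K.front, ∀ᶠ ξ in 𝓝 (K.x (B.a p)), G p ξ = 0
  zero_right : ∀ p ∈ cusps K.front, ∀ᶠ ξ in 𝓝 (K.x (B.b p)), G p ξ = 0
  nonneg : ∀ p ∈ cusps K.front, ∀ ξ, 0 ≤ G p ξ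
  deriv_nonneg : ∀ p ∈ cusps K.front, ∀ ξ, 0 ≤ deriv (G p) ξ
  left : ∀ p ∈ cusps K.front, IsLeftCusp K.front p → G p = fun _ => 0
  right : ∀ p ∈ cusps K.front, IsRightCusp K.front p →
    ∃ s₀ t₀, B.IsRampCrossing w (R p) (G p) p s₀ t₀

theorem IsResolutionHeight.nonempty_deformation {w : ℝ → ℝ} (hw : B.IsResolutionHeight w) :
    Nonempty (B.Deformation w) := by
  have key : ∀ p ∈ cusps K.front, ∃ (r : ℝ) (g : ℝ → ℝ), ContDiff ℝ ∞ g ∧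
      (∀ᶠ ξ in 𝓝 (K.x (B.a p)), g ξ = 0) ∧ (∀ᶠ ξ in 𝓝 (K.x (B.b p)), g ξ = 0) ∧
      (∀ ξ, 0 ≤ g ξ) ∧ (∀ ξ, 0 ≤ deriv g ξ) ∧ (IsLeftCusp K.front p → g = fun _ => 0) ∧
      (IsRightCusp K.front p →
    ∃ s₀ t₀, B.IsRampCrossing w r g p s₀ t₀) := by
    intro p hp
    obtain ⟨e, he⟩ := B.exists_isCuspSign hp
    rcases hp.2 with h | h
    · refine ⟨0, fun _ => 0, contDiff_const, by simp, by simp, by simp, by simp, fun _ => rfl, ?_⟩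
      intro h'
      have h1 := he.eq_one h
      have h2 := he.eq_neg_one h'
      norm_num [h1] at h2
    · obtain rfl := he.eq_neg_one h
      obtain ⟨s₀, hs₀, t₀, ht₀, hx₀, -, h1, h2, h3⟩ := hw.order_right hp h
      have hap := B.a_lt hp
      have hpb := B.lt_b hp
      have ha : K.x (B.a p) < K.x s₀ := by
        have := he.anti ⟨le_rfl, hap.le⟩ ⟨hs₀.1.le, hs₀.2.le⟩ hs₀.1
        simp only at this; linarith
      have hb : K.x (B.b p) < K.x s₀ := by
        have := he.mono ⟨ht₀.1.le, ht₀.2.le⟩ ⟨hpb.le, le_rfl⟩ ht₀.2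
        simp only at this; linarith
      obtain ⟨c, hc, hcm⟩ := exists_between (max_lt ha hb)
      obtain ⟨g, g1, g2, g3, g4, g5, g6, g7, g8⟩ := exists_ramp c (K.x s₀) hcm
      have hz : K.z t₀ - K.z s₀ ≠ 0 := sub_ne_zero.2 (B.z_ne hp
        ⟨hs₀.1.le, hs₀.2.le.trans hpb.le⟩ ⟨hap.le.trans ht₀.1.le, ht₀.2.le⟩ hx₀
        (hs₀.2.trans ht₀.1).ne).symm
      refine ⟨(K.y t₀ - K.y s₀) / (K.z t₀ - K.z s₀), g, g1, ?_, ?_, g3, g5, ?_, fun _ =>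
        ⟨s₀, t₀, hs₀, ht₀, hx₀, h1, h2, h3, by field_simp, g4, g6, g7, g8⟩⟩
      · filter_upwards [gt_mem_nhds ((le_max_left _ _).trans_lt hc)] with ξ hξ using g2 ξ hξ.le
      · filter_upwards [gt_mem_nhds ((le_max_right _ _).trans_lt hc)] with ξ hξ using g2 ξ hξ.le
      · intro h'
        have h1 := he.eq_one h'
        norm_num at h1
  choose! r g h1 h2 h3 h4 h5 h6 h7 using key
  exact ⟨⟨r, g, h1, h2, h3, h4, h5, h6, h7⟩⟩

namespace Deformation

variable {B} {w : ℝ → ℝ} (Δ : B.Deformation w)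

noncomputable def κ (ε p t : ℝ) : ℝ := Real.exp (-((1 / ε + Δ.R p) * Δ.G p (K.x t)))

/-- The height of the deformed front in the arc around `p`. -/
noncomputable def arcZ (ε p t : ℝ) : ℝ := K.z p + Δ.κ ε p t * (K.z t - K.z p)

/-- The slope of the deformed front in the arc around `p`. -/
noncomputable def arcY (ε p t : ℝ) : ℝ :=
  Δ.κ ε p t * (K.y t - (1 / ε + Δ.R p) * deriv (Δ.G p) (K.x t) * (K.z t - K.z p))

/-- `Z + ε Y` in the arc around `p`. -/
noncomputable def arcW (ε p t : ℝ) : ℝ :=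
  K.z p + Δ.κ ε p t *
    ((1 - (1 + ε * Δ.R p) * deriv (Δ.G p) (K.x t)) * (K.z t - K.z p) + ε * K.y t)

noncomputable def Z (ε t : ℝ) : ℝ := K.z t + B.glue (fun p t => Δ.arcZ ε p t - K.z t) t

noncomputable def Y (ε t : ℝ) : ℝ := K.y t + B.glue (fun p t => Δ.arcY ε p t - K.y t) t

noncomputable def W (ε t : ℝ) : ℝ := Δ.Z ε t + ε * Δ.Y ε t

theorem κ_pos (ε p t : ℝ) : 0 < Δ.κ ε p t := Real.exp_pos _

theorem hasDerivAt_κ {p : ℝ} (hp : p ∈ cusps K.front) (ε t : ℝ) : HasDerivAt (Δ.κ ε p)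
    (-((1 / ε + Δ.R p) * deriv (Δ.G p) (K.x t)) * Δ.κ ε p t * deriv K.x t) t := by
  have h1 := ((Δ.smooth p hp).hasDerivAt_top (K.x t)).comp t (K.smooth_x.hasDerivAt_top t)
  have h2 := (h1.const_mul (1 / ε + Δ.R p)).neg.exp
  refine h2.congr_deriv ?_
  simp only [κ, Function.comp, Pi.neg_apply]
  ring

theorem contDiff_κ {p : ℝ} (hp : p ∈ cusps K.front) (ε : ℝ) : ContDiff ℝ ∞ (Δ.κ ε p) :=
  (contDiff_const.mul ((Δ.smooth p hp).comp K.smooth_x)).neg.exp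

theorem contDiff_slope {p : ℝ} (hp : p ∈ cusps K.front) :
    ContDiff ℝ ∞ fun t => deriv (Δ.G p) (K.x t) :=
  (contDiff_infty_iff_deriv.1 (Δ.smooth p hp)).2.comp K.smooth_x

theorem contDiff_arcZ {p : ℝ} (hp : p ∈ cusps K.front) (ε : ℝ) : ContDiff ℝ ∞ (Δ.arcZ ε p) :=
  contDiff_const.add ((Δ.contDiff_κ hp ε).mul (K.smooth_z.sub contDiff_const))

theorem contDiff_arcY {p : ℝ} (hp : p ∈ cusps K.front) (ε : ℝ) : ContDiff ℝ ∞ (Δ.arcY ε p) :=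
  (Δ.contDiff_κ hp ε).mul (K.smooth_y.sub ((contDiff_const.mul (Δ.contDiff_slope hp)).mul
    (K.smooth_z.sub contDiff_const)))

theorem hasDerivAt_arcZ {p : ℝ} (hp : p ∈ cusps K.front) (ε t : ℝ) :
    HasDerivAt (Δ.arcZ ε p) (Δ.arcY ε p t * deriv K.x t) t := by
  have h := ((Δ.hasDerivAt_κ hp ε t).mul ((K.smooth_z.hasDerivAt_top t).sub_const
    (K.z p))).const_add (K.z p)
  refine h.congr_deriv ?_
  rw [K.legendrian]
  simp only [arcY]
  ring

theorem arcZ_add_arcY {ε : ℝ} (hε : ε ≠ 0) (p t : ℝ) :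
    Δ.arcZ ε p t + ε * Δ.arcY ε p t = Δ.arcW ε p t := by
  simp only [arcZ, arcY, arcW]
  field_simp
  ring

theorem eventually_zero {p c : ℝ} (h : ∀ᶠ ξ in 𝓝 (K.x c), Δ.G p ξ = 0) :
    ∀ᶠ t in 𝓝 c, Δ.G p (K.x t) = 0 ∧ deriv (Δ.G p) (K.x t) = 0 := by
  have h2 : ∀ᶠ ξ in 𝓝 (K.x c), deriv (Δ.G p) ξ = 0 := by
    filter_upwards [h.eventually_nhds] with ξ hξ
    rw [EventuallyEq.deriv_eq (f := fun _ => (0 : ℝ)) hξ, deriv_const]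
  exact K.smooth_x.continuous.continuousAt.eventually (h.and h2)

theorem arcZ_eq {p t : ℝ} (h : Δ.G p (K.x t) = 0) (ε : ℝ) : Δ.arcZ ε p t = K.z t := by
  simp [arcZ, κ, h]

theorem arcY_eq {p t : ℝ} (h : Δ.G p (K.x t) = 0) (h' : deriv (Δ.G p) (K.x t) = 0) (ε : ℝ) :
    Δ.arcY ε p t = K.y t := by
  simp [arcY, κ, h, h']

theorem κ_congr {s t : ℝ} (h : K.x s = K.x t) (ε p : ℝ) : Δ.κ ε p s = Δ.κ ε p t := by
  rw [κ, κ, h]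

theorem isArcFamily_Z (ε : ℝ) : B.IsArcFamily fun p t => Δ.arcZ ε p t - K.z t where
  periodic p _ t := by simp only [arcZ, κ, K.periodic_x t, K.periodic_z t]
  left p hp := (Δ.eventually_zero (Δ.zero_left p hp)).mono fun t ht => by
    rw [Δ.arcZ_eq ht.1, sub_self]
  right p hp := (Δ.eventually_zero (Δ.zero_right p hp)).mono fun t ht => by
    rw [Δ.arcZ_eq ht.1, sub_self]

theorem isArcFamily_Y (ε : ℝ) : B.IsArcFamily fun p t => Δ.arcY ε p t - K.y t where
  periodic p _ t := by simp only [arcY, κ, K.periodic_x t, K.periodic_y t, K.periodic_z t]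
  left p hp := (Δ.eventually_zero (Δ.zero_left p hp)).mono fun t ht => by
    rw [Δ.arcY_eq ht.1 ht.2, sub_self]
  right p hp := (Δ.eventually_zero (Δ.zero_right p hp)).mono fun t ht => by
    rw [Δ.arcY_eq ht.1 ht.2, sub_self]

theorem contDiff_Z (ε : ℝ) : ContDiff ℝ ∞ (Δ.Z ε) :=
  K.smooth_z.add ((Δ.isArcFamily_Z ε).contDiff_glue fun _ hp =>
    (Δ.contDiff_arcZ hp ε).sub K.smooth_z)

theorem contDiff_Y (ε : ℝ) : ContDiff ℝ ∞ (Δ.Y ε) :=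
  K.smooth_y.add ((Δ.isArcFamily_Y ε).contDiff_glue fun _ hp =>
    (Δ.contDiff_arcY hp ε).sub K.smooth_y)

theorem contDiff_W (ε : ℝ) : ContDiff ℝ ∞ (Δ.W ε) :=
  (Δ.contDiff_Z ε).add (contDiff_const.mul (Δ.contDiff_Y ε))

theorem periodic_Z (ε : ℝ) : Function.Periodic (Δ.Z ε) 1 :=
  K.periodic_z.add (Δ.isArcFamily_Z ε).periodic_glue

theorem periodic_Y (ε : ℝ) : Function.Periodic (Δ.Y ε) 1 :=
  K.periodic_y.add (Δ.isArcFamily_Y ε).periodic_glue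

theorem periodic_W (ε : ℝ) : Function.Periodic (Δ.W ε) 1 := fun t => by
  simp only [W, Δ.periodic_Z ε t, Δ.periodic_Y ε t]

theorem Z_of_mem {p t : ℝ} (hp : p ∈ cusps K.front) (ht : t ∈ B.params p) (ε : ℝ) :
    Δ.Z ε =ᶠ[𝓝 t] Δ.arcZ ε p := by
  filter_upwards [(Δ.isArcFamily_Z ε).glue_of_mem hp ht] with s hs
  rw [Z, hs, add_sub_cancel]

theorem Y_of_mem {p t : ℝ} (hp : p ∈ cusps K.front) (ht : t ∈ B.params p) (ε : ℝ) :
    Δ.Y ε =ᶠ[𝓝 t] Δ.arcY ε p := by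
  filter_upwards [(Δ.isArcFamily_Y ε).glue_of_mem hp ht] with s hs
  rw [Y, hs, add_sub_cancel]

theorem Z_of_notMem {t : ℝ} (ht : ∀ p ∈ cusps K.front, t ∉ B.params p) (ε : ℝ) :
    Δ.Z ε t = K.z t := by
  rw [Z, (glue_of_notMem ht).eq_of_nhds, Pi.zero_apply, add_zero]

theorem Y_of_notMem {t : ℝ} (ht : ∀ p ∈ cusps K.front, t ∉ B.params p) (ε : ℝ) :
    Δ.Y ε t = K.y t := by
  rw [Y, (glue_of_notMem ht).eq_of_nhds, Pi.zero_apply, add_zero]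

theorem W_of_mem {p t ε : ℝ} (hp : p ∈ cusps K.front) (ht : t ∈ B.params p) (hε : ε ≠ 0) :
    Δ.W ε =ᶠ[𝓝 t] Δ.arcW ε p := by
  filter_upwards [Δ.Z_of_mem hp ht ε, Δ.Y_of_mem hp ht ε] with s h1 h2
  rw [W, h1, h2, Δ.arcZ_add_arcY hε]

theorem W_of_notMem {t : ℝ} (ht : ∀ p ∈ cusps K.front, t ∉ B.params p) (ε : ℝ) :
    Δ.W ε t = K.z t + ε * K.y t := by
  rw [W, Δ.Z_of_notMem ht, Δ.Y_of_notMem ht]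

theorem hasDerivAt_Z (ε t : ℝ) : HasDerivAt (Δ.Z ε) (Δ.Y ε t * deriv K.x t) t := by
  by_cases ht : ∃ p ∈ cusps K.front, t ∈ B.params p
  · obtain ⟨p, hp, ht⟩ := ht
    rw [(Δ.Y_of_mem hp ht ε).eq_of_nhds]
    exact (Δ.hasDerivAt_arcZ hp ε t).congr_of_eventuallyEq (Δ.Z_of_mem hp ht ε)
  · push Not at ht
    rw [Δ.Y_of_notMem ht, ← K.legendrian]
    refine (K.smooth_z.hasDerivAt_top t).congr_of_eventuallyEq ?_
    filter_upwards [B.eventually_notMem ht] with s hs using Δ.Z_of_notMem hs ε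

/-- The formulas in the arc around `p` remain valid in a neighbourhood of the arc that does not
depend on `ε`. -/
theorem eventually_arc {p t : ℝ} (hp : p ∈ cusps K.front) (ht : t ∈ Icc (B.a p) (B.b p)) :
    ∀ᶠ s in 𝓝 t, ∀ ε, Δ.Z ε s = Δ.arcZ ε p s ∧ Δ.Y ε s = Δ.arcY ε p s := by
  have hz : ∀ᶠ s in 𝓝 t, s ∈ B.params p ∨
      (Δ.G p (K.x s) = 0 ∧ deriv (Δ.G p) (K.x s) = 0) := by
    rcases ht.1.eq_or_lt with rfl | h1
    · exact (Δ.eventually_zero (Δ.zero_left p hp)).mono fun s hs => Or.inr hs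
    rcases ht.2.eq_or_lt with rfl | h2
    · exact (Δ.eventually_zero (Δ.zero_right p hp)).mono fun s hs => Or.inr hs
    · filter_upwards [Ioo_mem_nhds h1 h2] with s hs
      exact Or.inl (B.mem_params hp ⟨hs.1.le, hs.2.le⟩)
  filter_upwards [hz, B.eventually_notMem_other hp (B.mem_params hp ht)] with s h1 h2 ε
  by_cases hs : s ∈ B.params p
  · exact ⟨(Δ.Z_of_mem hp hs ε).eq_of_nhds, (Δ.Y_of_mem hp hs ε).eq_of_nhds⟩
  · have h3 := h1.resolve_left hs
    have h4 : ∀ q ∈ cusps K.front, s ∉ B.params q := fun q hq => by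
      by_cases hqp : q = p
      · rwa [hqp]
      · exact h2 q hq hqp
    rw [Δ.Z_of_notMem h4, Δ.Y_of_notMem h4, Δ.arcZ_eq h3.1, Δ.arcY_eq h3.1 h3.2]
    exact ⟨rfl, rfl⟩

end Deformation

end FrontBoxes

theorem prod_nhdsGT_le (t : ℝ) : 𝓝 t ×ˢ 𝓝[>] (0 : ℝ) ≤ 𝓝 (t, (0 : ℝ)) := by
  rw [nhds_prod_eq]
  exact prod_mono le_rfl nhdsWithin_le_nhds

theorem prod_prod_nhdsGT_le (s t : ℝ) :
    (𝓝 s ×ˢ 𝓝 t) ×ˢ 𝓝[>] (0 : ℝ) ≤ 𝓝 ((s, t), (0 : ℝ)) := by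
  rw [nhds_prod_eq, nhds_prod_eq]
  exact prod_mono le_rfl nhdsWithin_le_nhds

theorem ContinuousAt.eventually_pos_pairs {f : (ℝ × ℝ) × ℝ → ℝ} {s t : ℝ}
    (hf : ContinuousAt f ((s, t), 0)) (h : 0 < f ((s, t), 0)) :
    ∀ᶠ q in (𝓝 s ×ˢ 𝓝 t) ×ˢ 𝓝[>] (0 : ℝ), 0 < f q :=
  prod_prod_nhdsGT_le s t (hf.eventually (lt_mem_nhds h))

theorem tendsto_pairs_fst (s t : ℝ) :
    Tendsto (fun q : (ℝ × ℝ) × ℝ => (q.1.1, q.2)) ((𝓝 s ×ˢ 𝓝 t) ×ˢ 𝓝[>] (0 : ℝ))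
      (𝓝 s ×ˢ 𝓝[>] (0 : ℝ)) :=
  (tendsto_fst.comp tendsto_fst).prodMk tendsto_snd

theorem tendsto_pairs_snd (s t : ℝ) :
    Tendsto (fun q : (ℝ × ℝ) × ℝ => (q.1.2, q.2)) ((𝓝 s ×ˢ 𝓝 t) ×ˢ 𝓝[>] (0 : ℝ))
      (𝓝 t ×ˢ 𝓝[>] (0 : ℝ)) :=
  (tendsto_snd.comp tendsto_fst).prodMk tendsto_snd

theorem eventually_pairs_fst {s t : ℝ} {P : ℝ → Prop} (h : ∀ᶠ r in 𝓝 s, P r) :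
    ∀ᶠ q in (𝓝 s ×ˢ 𝓝 t) ×ˢ 𝓝[>] (0 : ℝ), P q.1.1 :=
  (tendsto_fst.comp tendsto_fst).eventually h

theorem eventually_pairs_snd {s t : ℝ} {P : ℝ → Prop} (h : ∀ᶠ r in 𝓝 t, P r) :
    ∀ᶠ q in (𝓝 s ×ˢ 𝓝 t) ×ˢ 𝓝[>] (0 : ℝ), P q.1.2 :=
  (tendsto_snd.comp tendsto_fst).eventually h

theorem eventually_pairs_eps {s t : ℝ} {P : ℝ → Prop} (h : ∀ᶠ r in 𝓝[>] (0 : ℝ), P r) :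
    ∀ᶠ q in (𝓝 s ×ˢ 𝓝 t) ×ˢ 𝓝[>] (0 : ℝ), P q.2 :=
  tendsto_snd.eventually h

theorem eventually_eps_pos : ∀ᶠ ε in 𝓝[>] (0 : ℝ), 0 < ε := self_mem_nhdsWithin

namespace FrontBoxes.Deformation

variable {K : LegendrianKnot} {B : FrontBoxes K} {w : ℝ → ℝ} (Δ : B.Deformation w)

theorem eventually_add_pos (r : ℝ) : ∀ᶠ ε in 𝓝[>] (0 : ℝ), 0 < 1 / ε + r := by
  have h : Tendsto (fun ε : ℝ => ε⁻¹ + r) (𝓝[>] 0) atTop :=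
    tendsto_inv_nhdsGT_zero.atTop_add tendsto_const_nhds
  filter_upwards [h.eventually_gt_atTop 0] with ε hε
  rwa [one_div]

theorem eventually_κ_le_one {p : ℝ} (hp : p ∈ cusps K.front) :
    ∀ᶠ ε in 𝓝[>] (0 : ℝ), ∀ t, Δ.κ ε p t ≤ 1 := by
  filter_upwards [eventually_add_pos (Δ.R p)] with ε hε t
  exact Real.exp_le_one_iff.2 (neg_nonpos.2 (mul_nonneg hε.le (Δ.nonneg p hp _)))

theorem tendsto_κ_zero {p t : ℝ} (hp : p ∈ cusps K.front) (h : 0 < Δ.G p (K.x t)) :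
    Tendsto (fun q : ℝ × ℝ => Δ.κ q.2 p q.1) (𝓝 t ×ˢ 𝓝[>] 0) (𝓝 0) := by
  have h1 : Tendsto (fun ε : ℝ => 1 / ε + Δ.R p) (𝓝[>] 0) atTop := by
    simp only [one_div]
    exact tendsto_inv_nhdsGT_zero.atTop_add tendsto_const_nhds
  have h2 : Tendsto (fun s => Δ.G p (K.x s)) (𝓝 t) (𝓝 (Δ.G p (K.x t))) :=
    ((Δ.smooth p hp).continuous.comp K.smooth_x.continuous).continuousAt
  exact Real.tendsto_exp_atBot.comp (tendsto_neg_atTop_atBot.comp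
    ((h1.comp tendsto_snd).atTop_mul_pos h (h2.comp tendsto_fst)))

theorem exists_slope {p : ℝ} (hp : p ∈ cusps K.front) :
    ∃ g : ℝ → ℝ, Continuous g ∧ ∀ t, deriv (Δ.G p) (K.x t) = g t :=
  ⟨_, (Δ.contDiff_slope hp).continuous, fun _ => rfl⟩

theorem eventually_W_eq_arcW {p t : ℝ} (hp : p ∈ cusps K.front)
    (ht : t ∈ Icc (B.a p) (B.b p)) :
    ∀ᶠ s in 𝓝 t, ∀ ε, 0 < ε → Δ.W ε s = Δ.arcW ε p s :=
  (Δ.eventually_arc hp ht).mono fun s hs ε hε => by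
    rw [W, (hs ε).1, (hs ε).2, Δ.arcZ_add_arcY hε.ne']

/-- The deformed curve is close to the box if `ε` is small. -/
theorem eventually_W_mem_box {p t δ : ℝ} (hp : p ∈ cusps K.front) (ht : t ∈ B.params p)
    (hδ : 0 < δ) : ∀ᶠ q in 𝓝 t ×ˢ 𝓝[>] (0 : ℝ),
      Δ.W q.2 q.1 ∈ Icc ((B.u p).2 - δ) ((B.v p).2 + δ) := by
  obtain ⟨n, hn⟩ := (B.mem_params_iff hp).1 ht
  suffices h : ∀ t ∈ Icc (B.a p) (B.b p), ∀ᶠ q in 𝓝 t ×ˢ 𝓝[>] (0 : ℝ),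
      Δ.W q.2 q.1 ∈ Icc ((B.u p).2 - δ) ((B.v p).2 + δ) by
    have h1 : Tendsto (fun q : ℝ × ℝ => (q.1 + n, q.2)) (𝓝 t ×ˢ 𝓝[>] (0 : ℝ))
        (𝓝 (t + n) ×ˢ 𝓝[>] (0 : ℝ)) :=
      (((continuous_add_const (n : ℝ)).tendsto t).comp tendsto_fst).prodMk tendsto_snd
    filter_upwards [h1.eventually (h _ hn)] with q hq
    simpa only [(Δ.periodic_W q.2).add_int] using hq
  clear hn n ht
  intro t ht
  have hzp := B.mem_Icc_snd (B.mem_params hp (B.self_mem hp))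
  have hzt := B.mem_Icc_snd (B.mem_params hp ht)
  have hW : ∀ᶠ q in 𝓝 t ×ˢ 𝓝[>] (0 : ℝ), Δ.W q.2 q.1 = Δ.arcW q.2 p q.1 :=
    ((Δ.eventually_W_eq_arcW hp ht).prod_mk eventually_eps_pos).mono fun q hq => hq.1 q.2 hq.2
  have hκ : ∀ᶠ q in 𝓝 t ×ˢ 𝓝[>] (0 : ℝ), Δ.κ q.2 p q.1 ≤ 1 :=
    tendsto_snd.eventually ((Δ.eventually_κ_le_one hp).mono fun ε h t => h t) |>.mono
      fun q h => h q.1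
  have hy := K.smooth_y.continuous
  have hz := K.smooth_z.continuous
  have hG0 := fun t => Δ.deriv_nonneg p hp (K.x t)
  obtain ⟨g, hgc, hg⟩ := Δ.exists_slope hp
  simp only [arcW] at hW
  simp only [hg] at hG0 hW ⊢
  rcases lt_or_ge (g t) 1 with h | h
  · have c1 : ∀ᶠ q in 𝓝 t ×ˢ 𝓝[>] (0 : ℝ),
        0 < 1 - (1 + q.2 * Δ.R p) * g q.1 := by
      refine prod_nhdsGT_le t (Continuous.continuousAt (by fun_prop) |>.eventually
        (lt_mem_nhds ?_))
      simpa using h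
    have c2 : ∀ᶠ q in 𝓝 t ×ˢ 𝓝[>] (0 : ℝ), 0 < 1 + q.2 * Δ.R p :=
      prod_nhdsGT_le t ((Continuous.continuousAt (by fun_prop)).eventually
        (lt_mem_nhds (by simp)))
    have c3 : ∀ᶠ q in 𝓝 t ×ˢ 𝓝[>] (0 : ℝ), K.z q.1 ∈ Ioo ((B.u p).2 - δ / 2) ((B.v p).2 + δ / 2) :=
      tendsto_fst.eventually (hz.continuousAt.eventually
        (Ioo_mem_nhds (by linarith [hzt.1]) (by linarith [hzt.2])))
    have c4 : ∀ᶠ q in 𝓝 t ×ˢ 𝓝[>] (0 : ℝ), |q.2 * K.y q.1| < δ / 2 :=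
      prod_nhdsGT_le t ((Continuous.continuousAt (by fun_prop)).eventually
        (gt_mem_nhds (by simpa using hδ)))
    filter_upwards [hW, hκ, c1, c2, c3, c4] with q hW hκ c1 c2 c3 c4
    rw [hW]
    have hκ0 := Δ.κ_pos q.2 p q.1
    have hG0 := hG0 q.1
    set A := 1 - (1 + q.2 * Δ.R p) * g q.1 with hA
    have hA1 : A ≤ 1 := by rw [hA]; linarith [mul_nonneg c2.le hG0]
    set k := Δ.κ q.2 p q.1
    have hkA0 : 0 ≤ k * A := (mul_pos hκ0 c1).le
    have hkA1 : k * A ≤ 1 := mul_le_one₀ hκ c1.le hA1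
    have hky : |k * (q.2 * K.y q.1)| ≤ δ / 2 := by
      rw [abs_mul, abs_of_pos hκ0]
      nlinarith [abs_nonneg (q.2 * K.y q.1)]
    have e : K.z p + k * (A * (K.z q.1 - K.z p) + q.2 * K.y q.1) =
        (1 - k * A) * K.z p + k * A * K.z q.1 + k * (q.2 * K.y q.1) := by ring
    rw [e]
    obtain ⟨hk1, hk2⟩ := abs_le.1 hky
    constructor
    · nlinarith [mul_le_mul_of_nonneg_left hzp.1 (sub_nonneg.2 hkA1),
        mul_le_mul_of_nonneg_left c3.1.le hkA0]
    · nlinarith [mul_le_mul_of_nonneg_left hzp.2 (sub_nonneg.2 hkA1),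
        mul_le_mul_of_nonneg_left c3.2.le hkA0]
  · rw [← hg] at h
    have hG0 : 0 < Δ.G p (K.x t) := by
      rcases hp.2 with hl | hr
      · rw [Δ.left p hp hl] at h
        simp at h
        linarith
      · obtain ⟨s₀, t₀, hc⟩ := Δ.right p hp hr
        exact hc.ramp_pos _ (not_lt.1 fun hlt => absurd (hc.deriv_lt _ hlt) (not_lt.2 h))
    have c1 : Tendsto (fun q : ℝ × ℝ => (1 - (1 + q.2 * Δ.R p) * g q.1) *
        (K.z q.1 - K.z p) + q.2 * K.y q.1) (𝓝 t ×ˢ 𝓝[>] (0 : ℝ))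
        (𝓝 ((1 - (1 + 0 * Δ.R p) * g t) * (K.z t - K.z p) + 0 * K.y t)) :=
      Tendsto.mono_left (Continuous.tendsto (by fun_prop :
        Continuous fun q : ℝ × ℝ => (1 - (1 + q.2 * Δ.R p) * g q.1) *
        (K.z q.1 - K.z p) + q.2 * K.y q.1) (t, (0 : ℝ))) (prod_nhdsGT_le t)
    have c2 := ((Δ.tendsto_κ_zero hp hG0).mul c1).const_add (K.z p)
    rw [zero_mul, add_zero] at c2
    filter_upwards [hW, c2.eventually (Icc_mem_nhds (show (B.u p).2 - δ < K.z p by linarith [hzp.1])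
      (show K.z p < (B.v p).2 + δ by linarith [hzp.2]))] with q h1 h2
    rw [h1]
    exact h2

/-- A vertical interval that contains the point over `t`, and also the box if `t` is in a box. -/
theorem exists_hull (hw : B.IsResolutionHeight w) (t : ℝ) : ∃ l m : ℝ, l ≤ m ∧
    (∀ δ > 0, ∀ᶠ q in 𝓝 t ×ˢ 𝓝[>] (0 : ℝ), w q.1 ∈ Icc (l - δ) (m + δ) ∧
      Δ.W q.2 q.1 ∈ Icc (l - δ) (m + δ)) ∧
    ∀ p ∈ cusps K.front, (t ∈ B.params p → l = (B.u p).2 ∧ m = (B.v p).2) ∧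
      (t ∉ B.params p → K.x t ∈ Icc (B.u p).1 (B.v p).1 → m < (B.u p).2 ∨ (B.v p).2 < l) := by
  have hwc := hw.smooth.continuous
  by_cases ht : ∃ q ∈ cusps K.front, t ∈ B.params q
  · obtain ⟨q, hq, ht⟩ := ht
    have hwt := hw.mem_Icc hq ht
    refine ⟨(B.u q).2, (B.v q).2, hwt.1.trans hwt.2, fun δ hδ => ?_, fun p hp => ⟨fun h => ?_,
      fun h hx => ?_⟩⟩
    · refine Eventually.and (tendsto_fst.eventually (hwc.continuousAt.eventually
        (Icc_mem_nhds (by linarith [hwt.1]) (by linarith [hwt.2]))))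
        (Δ.eventually_W_mem_box hq ht hδ)
    · by_cases hpq : p = q
      · rw [hpq]; exact ⟨rfl, rfl⟩
      · exact absurd h (B.notMem_params_of_mem hq hp hpq ht)
    · by_contra! hcon
      have hpq : p ≠ q := by rintro rfl; exact h ht
      have hpm := B.mem_Icc_snd (B.mem_params hp (B.self_mem hp))
      have hx' := B.mem_Icc_fst ht
      have m1 : (K.x t, max (B.u p).2 (B.u q).2) ∈ Icc (B.u p) (B.v p) :=
        ⟨⟨hx.1, le_max_left _ _⟩, ⟨hx.2, max_le (hpm.1.trans hpm.2) hcon.2⟩⟩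
      exact Set.disjoint_left.1 (B.disjoint p hp q hq hpq) m1
        ⟨⟨hx'.1, le_max_right _ _⟩, ⟨hx'.2, max_le hcon.1 (hwt.1.trans hwt.2)⟩⟩
  · push Not at ht
    refine ⟨K.z t, K.z t, le_rfl, fun δ hδ => ?_, fun p hp => ⟨fun h => absurd h (ht p hp),
      fun h hx => ?_⟩⟩
    · have hy := K.smooth_y.continuous
      have hz := K.smooth_z.continuous
      have h1 : ∀ᶠ q in 𝓝 t ×ˢ 𝓝[>] (0 : ℝ), K.z q.1 ∈ Icc (K.z t - δ) (K.z t + δ) :=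
        tendsto_fst.eventually (hz.continuousAt.eventually
          (Icc_mem_nhds (by linarith) (by linarith)))
      have h2 : ∀ᶠ q in 𝓝 t ×ˢ 𝓝[>] (0 : ℝ), K.z q.1 + q.2 * K.y q.1 ∈
          Icc (K.z t - δ) (K.z t + δ) := by
        refine prod_nhdsGT_le t ((Continuous.continuousAt (by fun_prop)).eventually
          (Icc_mem_nhds ?_ ?_)) <;> simp [hδ]
      filter_upwards [h1, h2, tendsto_fst.eventually (B.eventually_notMem ht)] with q h1 h2 h3
      rw [hw.eq_of_notMem _ h3, Δ.W_of_notMem h3]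
      exact ⟨h1, h2⟩
    · by_contra! hcon
      exact h (B.mem_params_of_mem hx ⟨hcon.1, hcon.2⟩)

/-! ### Good pairs -/

/-- The pairs of points on a vertical line for which the linear interpolation between `w` and `W`
is under control: they are ordered in the same way in both curves, or their slopes are. -/
def GoodPair (ε s t : ℝ) : Prop :=
  0 < (w s - w t) * (Δ.W ε s - Δ.W ε t) ∨
  (deriv K.x s ≠ 0 ∧ deriv K.x t ≠ 0 ∧
    0 < (deriv w s / deriv K.x s - deriv w t / deriv K.x t) *
      (deriv (Δ.W ε) s / deriv K.x s - deriv (Δ.W ε) t / deriv K.x t) ∧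
    0 < (deriv w s / deriv K.x s - deriv w t / deriv K.x t) * (Δ.Y ε s - Δ.Y ε t) ∧
    ∀ p ∈ cusps K.front, (s ∈ B.params p ↔ t ∈ B.params p))

variable {Δ} in
theorem GoodPair.symm {ε s t : ℝ} (h : Δ.GoodPair ε s t) : Δ.GoodPair ε t s := by
  rcases h with h | ⟨h1, h2, h3, h4, h5⟩
  · left; linarith
  · exact Or.inr ⟨h2, h1, by linarith, by linarith, fun p hp => (h5 p hp).symm⟩

variable {Δ} in
theorem GoodPair.of_sameParam (hw : Function.Periodic w 1) {ε s t s' t' : ℝ}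
    (h : Δ.GoodPair ε s t) (hs : SameParam s s') (ht : SameParam t t') : Δ.GoodPair ε s' t' := by
  have hx := K.periodic_x.deriv_one
  have hW := Δ.periodic_W ε
  have hY := Δ.periodic_Y ε
  unfold GoodPair at h ⊢
  simpa only [hs.apply_eq hx, ht.apply_eq hx, hs.apply_eq hw, ht.apply_eq hw, hs.apply_eq hW,
    ht.apply_eq hW, hs.apply_eq hY, ht.apply_eq hY, hs.apply_eq hw.deriv_one,
    ht.apply_eq hw.deriv_one, hs.apply_eq hW.deriv_one, ht.apply_eq hW.deriv_one,
    B.params_congr hs, B.params_congr ht] using h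

/-- One point in a box, the other one outside. -/
theorem eventually_good_of_mem_of_notMem (hw : B.IsResolutionHeight w) {p s t : ℝ}
    (hp : p ∈ cusps K.front) (hs : s ∈ B.params p) (ht : t ∉ B.params p) (hx : K.x s = K.x t) :
    ∀ᶠ q in (𝓝 s ×ˢ 𝓝 t) ×ˢ 𝓝[>] (0 : ℝ), Δ.GoodPair q.2 q.1.1 q.1.2 := by
  obtain ⟨l, m, hlm, h1, h2⟩ := Δ.exists_hull hw s
  obtain ⟨l', m', hlm', h1', h2'⟩ := Δ.exists_hull hw t
  obtain ⟨rfl, rfl⟩ := (h2 p hp).1 hs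
  have h3 := (h2' p hp).2 ht (hx ▸ B.mem_Icc_fst hs)
  rcases h3 with h3 | h3
  · have hδ : 0 < ((B.u p).2 - m') / 3 := by linarith
    filter_upwards [(tendsto_pairs_fst s t).eventually (h1 _ hδ),
      (tendsto_pairs_snd s t).eventually (h1' _ hδ)] with q k1 k2
    refine Or.inl (mul_pos ?_ ?_)
    · linarith [k1.1.1, k2.1.2]
    · linarith [k1.2.1, k2.2.2]
  · have hδ : 0 < (l' - (B.v p).2) / 3 := by linarith
    filter_upwards [(tendsto_pairs_fst s t).eventually (h1 _ hδ),
      (tendsto_pairs_snd s t).eventually (h1' _ hδ)] with q k1 k2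
    refine Or.inl (mul_pos_of_neg_of_neg ?_ ?_)
    · linarith [k1.1.2, k2.1.1]
    · linarith [k1.2.2, k2.2.1]

theorem deriv_W_of_notMem {t : ℝ} (ht : ∀ p ∈ cusps K.front, t ∉ B.params p) (ε : ℝ) :
    deriv (Δ.W ε) t = K.y t * deriv K.x t + ε * deriv K.y t := by
  have h : Δ.W ε =ᶠ[𝓝 t] fun t => K.z t + ε * K.y t := by
    filter_upwards [B.eventually_notMem ht] with s hs using Δ.W_of_notMem hs ε
  have h2 := (K.smooth_z.hasDerivAt_top t).add ((K.smooth_y.hasDerivAt_top t).const_mul ε)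
  rw [h.deriv_eq, ← K.legendrian]
  exact h2.deriv

theorem _root_.FrontBoxes.IsResolutionHeight.deriv_of_notMem (hw : B.IsResolutionHeight w) {t : ℝ}
    (ht : ∀ p ∈ cusps K.front, t ∉ B.params p) : deriv w t = K.y t * deriv K.x t := by
  have h : w =ᶠ[𝓝 t] K.z := by
    filter_upwards [B.eventually_notMem ht] with s hs using hw.eq_of_notMem s hs
  rw [h.deriv_eq, K.legendrian]

/-- Both points outside the boxes. -/
theorem eventually_good_of_notMem (hw : B.IsResolutionHeight w) {s t : ℝ}
    (hs : ∀ p ∈ cusps K.front, s ∉ B.params p) (ht : ∀ p ∈ cusps K.front, t ∉ B.params p)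
    (hst : ¬ SameParam s t) (hx : K.x s = K.x t) :
    ∀ᶠ q in (𝓝 s ×ˢ 𝓝 t) ×ˢ 𝓝[>] (0 : ℝ), Δ.GoodPair q.2 q.1.1 q.1.2 := by
  have hy := K.smooth_y.continuous
  have hz := K.smooth_z.continuous
  have hs' := eventually_pairs_fst (t := t) (B.eventually_notMem hs)
  have ht' := eventually_pairs_snd (s := s) (B.eventually_notMem ht)
  by_cases hzst : K.z s = K.z t
  · have hyst : K.y s - K.y t ≠ 0 := sub_ne_zero.2 fun h => hst (K.embedded s t hx h hzst)
    have hxs := B.deriv_x_ne_zero_of_notMem hs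
    have hxt := B.deriv_x_ne_zero_of_notMem ht
    have hx' := K.smooth_x.continuous_deriv_top
    have hy' := K.smooth_y.continuous_deriv_top
    have h1 : ∀ᶠ q in (𝓝 s ×ˢ 𝓝 t) ×ˢ 𝓝[>] (0 : ℝ), 0 < (K.y q.1.1 - K.y q.1.2) *
        ((K.y q.1.1 + q.2 * (deriv K.y q.1.1 / deriv K.x q.1.1)) -
          (K.y q.1.2 + q.2 * (deriv K.y q.1.2 / deriv K.x q.1.2))) := by
      refine ContinuousAt.eventually_pos_pairs (f := fun q => (K.y q.1.1 - K.y q.1.2) *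
        ((K.y q.1.1 + q.2 * (deriv K.y q.1.1 / deriv K.x q.1.1)) -
          (K.y q.1.2 + q.2 * (deriv K.y q.1.2 / deriv K.x q.1.2)))) ?_ ?_
      · fun_prop (disch := assumption)
      · simpa using mul_self_pos.2 hyst
    have h2 : ∀ᶠ q in (𝓝 s ×ˢ 𝓝 t) ×ˢ 𝓝[>] (0 : ℝ), 0 < (K.y q.1.1 - K.y q.1.2) ^ 2 :=
      ContinuousAt.eventually_pos_pairs (f := fun q => (K.y q.1.1 - K.y q.1.2) ^ 2)
        (by fun_prop) (by positivity)
    filter_upwards [h1, h2, hs', ht'] with q h1 h2 hs' ht'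
    have k1 := B.deriv_x_ne_zero_of_notMem hs'
    have k2 := B.deriv_x_ne_zero_of_notMem ht'
    refine Or.inr ⟨k1, k2, ?_, ?_, fun p hp => by simp [hs' p hp, ht' p hp]⟩
    · rw [hw.deriv_of_notMem hs', hw.deriv_of_notMem ht', Δ.deriv_W_of_notMem hs',
        Δ.deriv_W_of_notMem ht', add_div, add_div, mul_div_assoc q.2, mul_div_assoc q.2,
        mul_div_cancel_right₀ _ k1, mul_div_cancel_right₀ _ k2]
      exact h1
    · rw [hw.deriv_of_notMem hs', hw.deriv_of_notMem ht', Δ.Y_of_notMem hs', Δ.Y_of_notMem ht',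
        mul_div_cancel_right₀ _ k1, mul_div_cancel_right₀ _ k2, ← sq]
      exact h2
  · have h1 : ∀ᶠ q in (𝓝 s ×ˢ 𝓝 t) ×ˢ 𝓝[>] (0 : ℝ), 0 < (K.z q.1.1 - K.z q.1.2) *
        ((K.z q.1.1 + q.2 * K.y q.1.1) - (K.z q.1.2 + q.2 * K.y q.1.2)) := by
      refine ContinuousAt.eventually_pos_pairs (f := fun q => (K.z q.1.1 - K.z q.1.2) *
        ((K.z q.1.1 + q.2 * K.y q.1.1) - (K.z q.1.2 + q.2 * K.y q.1.2))) (by fun_prop) ?_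
      simpa using mul_self_pos.2 (sub_ne_zero.2 hzst)
    filter_upwards [h1, hs', ht'] with q h1 hs' ht'
    left
    rw [hw.eq_of_notMem _ hs', hw.eq_of_notMem _ ht', Δ.W_of_notMem hs', Δ.W_of_notMem ht']
    exact h1

/-- Two points near the same regular point. -/
theorem eventually_sameParam_of_regular {s t : ℝ} (h : deriv K.x s ≠ 0) (hst : SameParam s t) :
    ∀ᶠ q in 𝓝 s ×ˢ 𝓝 t, K.x q.1 = K.x q.2 → SameParam q.1 q.2 := by
  obtain ⟨n, rfl⟩ := hst
  have h1 : Tendsto (fun q : ℝ × ℝ => (q.1, q.2 + n)) (𝓝 (t + n) ×ˢ 𝓝 t)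
      (𝓝 (t + n) ×ˢ 𝓝 (t + n)) :=
    tendsto_fst.prodMk (((continuous_add_const (n : ℝ)).tendsto t).comp tendsto_snd)
  filter_upwards [h1.eventually (eventually_injective K.smooth_x h)] with q hq hx
  exact ⟨n, hq (by rw [hx, K.periodic_x.add_int])⟩

theorem arcW_sub_arcW {ε p s t : ℝ} (hx : K.x s = K.x t) : Δ.arcW ε p t - Δ.arcW ε p s =
    Δ.κ ε p t * ((1 - (1 + ε * Δ.R p) * deriv (Δ.G p) (K.x t)) * (K.z t - K.z s) +
      ε * (K.y t - K.y s)) := by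
  rw [arcW, arcW, Δ.κ_congr hx, hx]
  ring

theorem arcW_of_left {p : ℝ} (hp : p ∈ cusps K.front) (h : IsLeftCusp K.front p) (ε t : ℝ) :
    Δ.arcW ε p t = K.z t + ε * K.y t := by
  simp only [arcW, κ, Δ.left p hp h, deriv_const]
  simp
  ring

end FrontBoxes.Deformation

theorem exists_abs_sub_le {x f : ℝ → ℝ} (hx : ContDiff ℝ ∞ x) (hf : ContDiff ℝ ∞ f) {c : ℝ}
    (h : deriv x c ≠ 0) : ∃ L, ∀ᶠ t in 𝓝 c, |f t - f c| ≤ L * |x t - x c| := by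
  have h1 : (fun t => f t - f c) =O[𝓝 c] fun t => t - c := (hf.hasDerivAt_top c).isBigO_sub
  have h2 : (fun t => t - c) =O[𝓝 c] fun t => x t - x c :=
    (HasDerivAtFilter.isTheta_sub (hx.hasDerivAt_top c) h).2.comp_tendsto prod_pure.ge
  obtain ⟨L, hL⟩ := (h1.trans h2).bound
  exact ⟨L, by simpa [Real.norm_eq_abs] using hL⟩

namespace FrontBoxes.Deformation

variable {K : LegendrianKnot} {B : FrontBoxes K} {w : ℝ → ℝ} (Δ : B.Deformation w)

/-- Two points on the two branches at a left cusp. -/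
theorem eventually_good_left (hw : B.IsResolutionHeight w) {p s t : ℝ} (hp : p ∈ cusps K.front)
    (hl : IsLeftCusp K.front p) (hs : s ∈ Ico (B.a p) p) (ht : t ∈ Ioc p (B.b p))
    (hx : K.x s = K.x t) :
    ∀ᶠ q in (𝓝 s ×ˢ 𝓝 t) ×ˢ 𝓝[>] (0 : ℝ), Δ.GoodPair q.2 q.1.1 q.1.2 := by
  have hap := B.a_lt hp
  have hpb := B.lt_b hp
  have hy := K.smooth_y.continuous
  have hz := K.smooth_z.continuous
  have hwc := hw.smooth.continuous
  have h1 : ∀ᶠ q in (𝓝 s ×ˢ 𝓝 t) ×ˢ 𝓝[>] (0 : ℝ), 0 < (w q.1.1 - w q.1.2) *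
      ((K.z q.1.1 + q.2 * K.y q.1.1) - (K.z q.1.2 + q.2 * K.y q.1.2)) := by
    refine ContinuousAt.eventually_pos_pairs (f := fun q => (w q.1.1 - w q.1.2) *
      ((K.z q.1.1 + q.2 * K.y q.1.1) - (K.z q.1.2 + q.2 * K.y q.1.2))) (by fun_prop) ?_
    have := hw.order_left hp hl hs ht hx
    simp only [zero_mul, add_zero]
    linarith
  filter_upwards [h1, eventually_pairs_fst (t := t)
    (Δ.eventually_W_eq_arcW hp ⟨hs.1, hs.2.le.trans hpb.le⟩), eventually_pairs_snd (s := s)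
    (Δ.eventually_W_eq_arcW hp ⟨hap.le.trans ht.1.le, ht.2⟩),
    eventually_pairs_eps eventually_eps_pos] with q h1 h2 h3 h4
  left
  rwa [h2 _ h4, h3 _ h4, Δ.arcW_of_left hp hl, Δ.arcW_of_left hp hl]

/-- The derivative of `W` where the slope of the ramp is `1`. -/
theorem hasDerivAt_arcW {ε p t : ℝ} (hp : p ∈ cusps K.front)
    (h : ∀ᶠ ξ in 𝓝 (K.x t), deriv (Δ.G p) ξ = 1 + (ξ - K.x t)) :
    HasDerivAt (Δ.arcW ε p) (Δ.κ ε p t * (-((1 / ε + Δ.R p) *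
      (-(ε * Δ.R p) * (K.z t - K.z p) + ε * K.y t) * deriv K.x t) -
      (1 + ε * Δ.R p) * deriv K.x t * (K.z t - K.z p) - ε * Δ.R p * K.y t * deriv K.x t +
      ε * deriv K.y t)) t := by
  have h1 : deriv (Δ.G p) (K.x t) = 1 := by simpa using h.self_of_nhds
  have h2 : HasDerivAt (fun s => deriv (Δ.G p) (K.x s)) (deriv K.x t) t := by
    have h3 : HasDerivAt (fun s => 1 + (K.x s - K.x t)) (deriv K.x t) t :=
      ((K.smooth_x.hasDerivAt_top t).sub_const _).const_add _
    exact h3.congr_of_eventuallyEq (K.smooth_x.continuous.continuousAt.eventually h)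
  have h3 := ((Δ.hasDerivAt_κ hp ε t).mul ((((h2.const_mul (1 + ε * Δ.R p)).const_sub 1).mul
    ((K.smooth_z.hasDerivAt_top t).sub_const (K.z p))).add
    ((K.smooth_y.hasDerivAt_top t).const_mul ε))).const_add (K.z p)
  refine h3.congr_deriv ?_
  simp only [Pi.mul_apply, Pi.add_apply, h1, K.legendrian]
  ring

/-- The crossing at a right cusp. -/
theorem good_crossing {p s t ε : ℝ} (hp : p ∈ cusps K.front) (hε : 0 < ε)
    (hc : B.IsRampCrossing w (Δ.R p) (Δ.G p) p s t) (hxs : deriv K.x s ≠ 0)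
    (hxt : deriv K.x t ≠ 0) (h : 0 < (1 + ε * Δ.R p) *
        (K.z t - K.z s) ^ 2 - ε * ((K.z t - K.z s) * (deriv K.y t / deriv K.x t -
          deriv K.y s / deriv K.x s - Δ.R p * (K.y t - K.y s)))) :
    Δ.GoodPair ε s t := by
  have hx := hc.x_eq
  have hPs := B.mem_params hp ⟨hc.mem_left.1.le, hc.mem_left.2.le.trans (B.lt_b hp).le⟩
  have hPt := B.mem_params hp ⟨(B.a_lt hp).le.trans hc.mem_right.1.le, hc.mem_right.2.le⟩
  have hκ := Δ.κ_pos ε p t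
  have hG3t : ∀ᶠ ξ in 𝓝 (K.x t), deriv (Δ.G p) ξ = 1 + (ξ - K.x t) := hx ▸ hc.deriv_near
  have ds := (Δ.W_of_mem hp hPs hε.ne').deriv_eq.trans
    (Δ.hasDerivAt_arcW hp hc.deriv_near).deriv
  have dt := (Δ.W_of_mem hp hPt hε.ne').deriv_eq.trans (Δ.hasDerivAt_arcW hp hG3t).deriv
  have hG1s : deriv (Δ.G p) (K.x s) = 1 := by simpa using hc.deriv_near.self_of_nhds
  have hG1t : deriv (Δ.G p) (K.x t) = 1 := hx ▸ hG1s
  have key : ∀ A D : ℝ, A * (K.z t - K.z s) < 0 → D * (K.z t - K.z s) < 0 → 0 < A * D := by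
    intro A D h1 h2
    have h3 := mul_pos_of_neg_of_neg h1 h2
    have h4 : 0 < (A * D) * (K.z t - K.z s) ^ 2 := by linarith
    exact pos_of_mul_pos_left h4 (sq_nonneg _)
  have e1 : (deriv w s / deriv K.x s - deriv w t / deriv K.x t) =
    -(deriv w t / deriv K.x t - deriv w s / deriv K.x s) := by ring
  refine Or.inr ⟨hxs, hxt, ?_, ?_, ?_⟩
  · rw [e1, neg_mul, ← mul_neg]
    refine key _ _ hc.slope ?_
    rw [ds, dt, Δ.κ_congr hx]
    have e2 : -(Δ.κ ε p t * (-((1 / ε + Δ.R p) *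
        (-(ε * Δ.R p) * (K.z s - K.z p) + ε * K.y s) * deriv K.x s) -
        (1 + ε * Δ.R p) * deriv K.x s * (K.z s - K.z p) - ε * Δ.R p * K.y s * deriv K.x s +
        ε * deriv K.y s) / deriv K.x s - Δ.κ ε p t * (-((1 / ε + Δ.R p) *
        (-(ε * Δ.R p) * (K.z t - K.z p) + ε * K.y t) * deriv K.x t) -
        (1 + ε * Δ.R p) * deriv K.x t * (K.z t - K.z p) - ε * Δ.R p * K.y t * deriv K.x t +
        ε * deriv K.y t) / deriv K.x t) * (K.z t - K.z s) =
        -(Δ.κ ε p t * ((1 + ε * Δ.R p) *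
      (K.z t - K.z s) ^ 2 - ε * ((K.z t - K.z s) * (deriv K.y t / deriv K.x t -
      deriv K.y s / deriv K.x s - Δ.R p * (K.y t - K.y s))))) -
        Δ.κ ε p t * (K.z t - K.z s) * ε * (1 / ε + Δ.R p) *
          ((K.y t - K.y s) - Δ.R p * (K.z t - K.z s)) := by
      field_simp
      ring
    rw [e2, hc.ratio, sub_self, mul_zero, sub_zero]
    exact neg_neg_of_pos (mul_pos hκ h)
  · rw [e1, neg_mul, ← mul_neg]
    refine key _ _ hc.slope ?_
    rw [(Δ.Y_of_mem hp hPs ε).eq_of_nhds, (Δ.Y_of_mem hp hPt ε).eq_of_nhds, arcY, arcY,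
      Δ.κ_congr hx, hG1s, hG1t]
    have e2 : -(Δ.κ ε p t * (K.y s - (1 / ε + Δ.R p) * 1 * (K.z s - K.z p)) -
        Δ.κ ε p t * (K.y t - (1 / ε + Δ.R p) * 1 * (K.z t - K.z p))) * (K.z t - K.z s) =
        -(Δ.κ ε p t * (1 / ε) * (K.z t - K.z s) ^ 2) + Δ.κ ε p t * (K.z t - K.z s) *
          ((K.y t - K.y s) - Δ.R p * (K.z t - K.z s)) := by
      ring
    rw [e2, hc.ratio, sub_self, mul_zero, add_zero]
    have hz0 : K.z t - K.z s ≠ 0 := fun h0 => by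
      have := hc.slope
      rw [h0, mul_zero] at this
      exact lt_irrefl _ this
    exact neg_neg_of_pos (by positivity)
  · intro q hq
    by_cases hqp : q = p
    · rw [hqp]; exact iff_of_true hPs hPt
    · exact iff_of_false (B.notMem_params_of_mem hp hq hqp hPs)
        (B.notMem_params_of_mem hp hq hqp hPt)

/-- An elementary estimate: the sign of a perturbed product. -/
theorem perturbed_sign {ε r L D Q d : ℝ} (hε : 0 < ε) (hd : d ≠ 0)
    (h : 0 < (1 + ε * r) * D ^ 2 - ε * (L * |D|)) (hQ : |Q| ≤ L * |d|) :
    (-(1 + ε * r) * d * D + ε * Q) * D * d < 0 := by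
  have h1 : |Q * D * d| ≤ L * |D| * d ^ 2 := by
    rw [abs_mul, abs_mul, ← sq_abs d]
    have := mul_le_mul_of_nonneg_right hQ (mul_nonneg (abs_nonneg D) (abs_nonneg d))
    linarith
  have h2 := mul_le_mul_of_nonneg_left (le_of_abs_le h1) hε.le
  have h3 := mul_pos h (by positivity : 0 < d ^ 2)
  linarith

/-- Two points on the two branches at a right cusp, near the crossing. -/
theorem eventually_good_right_crossing {p s t : ℝ}
    (hp : p ∈ cusps K.front) (hc : B.IsRampCrossing w (Δ.R p) (Δ.G p) p s t) :
    ∀ᶠ q in (𝓝 s ×ˢ 𝓝 t) ×ˢ 𝓝[>] (0 : ℝ), K.x q.1.1 = K.x q.1.2 →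
      Δ.GoodPair q.2 q.1.1 q.1.2 := by
  obtain ⟨e, he⟩ := B.exists_isCuspSign hp
  have hap := B.a_lt hp
  have hpb := B.lt_b hp
  have hz := K.smooth_z.continuous
  have hx := hc.x_eq
  have hs : s ∈ Ico (B.a p) p := ⟨hc.mem_left.1.le, hc.mem_left.2⟩
  have ht : t ∈ Ioc p (B.b p) := ⟨hc.mem_right.1, hc.mem_right.2.le⟩
  have hsI : s ∈ Icc (B.a p) (B.b p) := ⟨hs.1, hs.2.le.trans hpb.le⟩
  have htI : t ∈ Icc (B.a p) (B.b p) := ⟨hap.le.trans ht.1.le, ht.2⟩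
  have hne : K.z t - K.z s ≠ 0 :=
    sub_ne_zero.2 (B.z_ne hp hsI htI hx (hs.2.trans ht.1).ne).symm
  have hxs : deriv K.x s ≠ 0 := fun h => by have := he.neg s hs; simp [h] at this
  have hxt : deriv K.x t ≠ 0 := fun h => by have := he.pos t ht; simp [h] at this
  have hf : ContDiff ℝ ∞ fun t => K.y t - Δ.R p * K.z t :=
    K.smooth_y.sub (contDiff_const.mul K.smooth_z)
  obtain ⟨L₁, hL₁⟩ := exists_abs_sub_le K.smooth_x hf hxs
  obtain ⟨L₂, hL₂⟩ := exists_abs_sub_le K.smooth_x hf hxt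
  have c1 : ∀ᶠ q in (𝓝 s ×ˢ 𝓝 t) ×ˢ 𝓝[>] (0 : ℝ), 0 < (1 + q.2 * Δ.R p) *
      (K.z q.1.2 - K.z q.1.1) ^ 2 - q.2 * ((L₁ + L₂) * |K.z q.1.2 - K.z q.1.1|) := by
    refine ContinuousAt.eventually_pos_pairs (f := fun q => (1 + q.2 * Δ.R p) *
      (K.z q.1.2 - K.z q.1.1) ^ 2 - q.2 * ((L₁ + L₂) * |K.z q.1.2 - K.z q.1.1|))
      (by fun_prop) ?_
    simp only [zero_mul, add_zero, one_mul, sub_zero]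
    positivity
  have c2 : ∀ᶠ q in (𝓝 s ×ˢ 𝓝 t) ×ˢ 𝓝[>] (0 : ℝ), 0 < (1 + q.2 * Δ.R p) *
      (K.z t - K.z s) ^ 2 - q.2 * ((K.z t - K.z s) * (deriv K.y t / deriv K.x t -
        deriv K.y s / deriv K.x s - Δ.R p * (K.y t - K.y s))) := by
    refine ContinuousAt.eventually_pos_pairs (f := fun q => (1 + q.2 * Δ.R p) *
      (K.z t - K.z s) ^ 2 - q.2 * ((K.z t - K.z s) * (deriv K.y t / deriv K.x t -
        deriv K.y s / deriv K.x s - Δ.R p * (K.y t - K.y s)))) (by fun_prop) ?_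
    simp only [zero_mul, add_zero, one_mul, sub_zero]
    positivity
  filter_upwards [eventually_pairs_fst (t := t) (Δ.eventually_W_eq_arcW hp hsI),
    eventually_pairs_snd (s := s) (Δ.eventually_W_eq_arcW hp htI),
    eventually_pairs_eps (s := s) (t := t) eventually_eps_pos, c1, c2,
    eventually_pairs_fst (t := t) hL₁, eventually_pairs_snd (s := s) hL₂,
    eventually_pairs_fst (t := t) (Ioo_mem_nhds hc.mem_left.1 hc.mem_left.2),
    eventually_pairs_snd (s := s) (Ioo_mem_nhds hc.mem_right.1 hc.mem_right.2),
    eventually_pairs_fst (t := t) (K.smooth_x.continuous.continuousAt.eventually hc.deriv_near)]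
    with q hWs hWt hε c1 c2 hL₁ hL₂ hqs hqt hG3 hqx
  have hσ : q.1.1 ∈ Ico (B.a p) p := ⟨hqs.1.le, hqs.2⟩
  have hρ : q.1.2 ∈ Ioc p (B.b p) := ⟨hqt.1, hqt.2.le⟩
  by_cases hσs : K.x q.1.1 = K.x s
  · have e1 : q.1.1 = s := he.anti.injOn ⟨hσ.1, hσ.2.le⟩ ⟨hs.1, hs.2.le⟩ (by simp only [hσs])
    have e2 : q.1.2 = t := he.mono.injOn ⟨hρ.1.le, hρ.2⟩ ⟨ht.1.le, ht.2⟩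
      (by simp only [← hx, ← hqx, hσs])
    rw [e1, e2]
    exact Δ.good_crossing hp hε hc hxs hxt c2
  · left
    rw [hWs _ hε, hWt _ hε]
    have e1 := Δ.arcW_sub_arcW (ε := q.2) (p := p) hqx
    rw [← hqx, hG3] at e1
    set d := K.x q.1.1 - K.x s with hd
    have hd0 : d ≠ 0 := sub_ne_zero.2 hσs
    have hdt : K.x q.1.2 - K.x t = d := by rw [hd, hqx, hx]
    rw [hdt] at hL₂
    have hQ : |(K.y q.1.2 - K.y q.1.1) - Δ.R p * (K.z q.1.2 - K.z q.1.1)| ≤ (L₁ + L₂) * |d| := by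
      have e2 : (K.y q.1.2 - K.y q.1.1) - Δ.R p * (K.z q.1.2 - K.z q.1.1) =
          ((K.y q.1.2 - Δ.R p * K.z q.1.2) - (K.y t - Δ.R p * K.z t)) -
          ((K.y q.1.1 - Δ.R p * K.z q.1.1) - (K.y s - Δ.R p * K.z s)) := by
        linarith [hc.ratio]
      rw [e2]
      refine (abs_sub _ _).trans ?_
      linarith
    have hprod := perturbed_sign hε hd0 c1 hQ
    have hWprod : (Δ.arcW q.2 p q.1.2 - Δ.arcW q.2 p q.1.1) * (K.z q.1.2 - K.z q.1.1) * d < 0 := by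
      rw [e1, mul_assoc, mul_assoc]
      refine mul_neg_of_pos_of_neg (Δ.κ_pos _ _ _) ?_
      linarith
    have hwprod : (w q.1.2 - w q.1.1) * (K.z q.1.2 - K.z q.1.1) * d < 0 := by
      rcases lt_or_gt_of_ne hd0 with h | h
      · exact mul_neg_of_pos_of_neg (hc.before _ hσ _ hρ hqx (by linarith)) h
      · exact mul_neg_of_neg_of_pos (hc.beyond _ hσ _ hρ hqx (by linarith)) h
    have h1 := mul_pos_of_neg_of_neg hWprod hwprod
    have h2 : 0 < ((w q.1.1 - w q.1.2) * (Δ.arcW q.2 p q.1.1 - Δ.arcW q.2 p q.1.2)) *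
        ((K.z q.1.2 - K.z q.1.1) * d) ^ 2 := by linarith
    exact pos_of_mul_pos_left h2 (sq_nonneg _)

/-- Two points on the two branches at a right cusp. -/
theorem eventually_good_right (hw : B.IsResolutionHeight w) {p s t : ℝ} (hp : p ∈ cusps K.front)
    (hr : IsRightCusp K.front p) (hs : s ∈ Ico (B.a p) p) (ht : t ∈ Ioc p (B.b p))
    (hx : K.x s = K.x t) :
    ∀ᶠ q in (𝓝 s ×ˢ 𝓝 t) ×ˢ 𝓝[>] (0 : ℝ), K.x q.1.1 = K.x q.1.2 →
      Δ.GoodPair q.2 q.1.1 q.1.2 := by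
  obtain ⟨e, he⟩ := B.exists_isCuspSign hp
  obtain ⟨s₀, t₀, hc⟩ := Δ.right p hp hr
  have hap := B.a_lt hp
  have hpb := B.lt_b hp
  have hs₀ := hc.mem_left
  have ht₀ := hc.mem_right
  by_cases hs0 : K.x s = K.x s₀
  · obtain rfl : s = s₀ := he.anti.injOn ⟨hs.1, hs.2.le⟩ ⟨hs₀.1.le, hs₀.2.le⟩ (by simp only [hs0])
    obtain rfl : t = t₀ := he.mono.injOn ⟨ht.1.le, ht.2⟩ ⟨ht₀.1.le, ht₀.2.le⟩
      (by simp only [← hx, ← hc.x_eq])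
    exact Δ.eventually_good_right_crossing hp hc
  have hsI : s ∈ Icc (B.a p) (B.b p) := ⟨hs.1, hs.2.le.trans hpb.le⟩
  have htI : t ∈ Icc (B.a p) (B.b p) := ⟨hap.le.trans ht.1.le, ht.2⟩
  have hy := K.smooth_y.continuous
  have hz := K.smooth_z.continuous
  have hwc := hw.smooth.continuous
  obtain ⟨g, hgc, hg⟩ := Δ.exists_slope hp
  have hfac : 0 < (w t - w s) * ((1 - g t) * (K.z t - K.z s)) := by
    rcases lt_or_gt_of_ne hs0 with h | h
    · have h1 := hc.before s hs t ht hx h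
      have h2 := hc.deriv_lt (K.x t) (hx ▸ h)
      rw [hg] at h2
      have := mul_pos (sub_pos.2 h2) h1
      linarith
    · have h1 := hc.beyond s hs t ht hx h
      have h2 := hc.deriv_eq (K.x t) (hx ▸ h.le)
      rw [hg] at h2
      have h3 : 1 - g t < 0 := by rw [h2, ← hx]; linarith
      have := mul_pos_of_neg_of_neg h3 h1
      linarith
  have c1 : ∀ᶠ q in (𝓝 s ×ˢ 𝓝 t) ×ˢ 𝓝[>] (0 : ℝ), 0 < (w q.1.2 - w q.1.1) *
      ((1 - (1 + q.2 * Δ.R p) * g q.1.2) * (K.z q.1.2 - K.z q.1.1) +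
        q.2 * (K.y q.1.2 - K.y q.1.1)) := by
    refine ContinuousAt.eventually_pos_pairs (f := fun q => (w q.1.2 - w q.1.1) *
      ((1 - (1 + q.2 * Δ.R p) * g q.1.2) * (K.z q.1.2 - K.z q.1.1) +
        q.2 * (K.y q.1.2 - K.y q.1.1))) (by fun_prop) ?_
    simpa using hfac
  filter_upwards [eventually_pairs_fst (t := t) (Δ.eventually_W_eq_arcW hp hsI),
    eventually_pairs_snd (s := s) (Δ.eventually_W_eq_arcW hp htI),
    eventually_pairs_eps (s := s) (t := t) eventually_eps_pos, c1] with q hWs hWt hε c1 hqx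
  left
  have e1 := Δ.arcW_sub_arcW (ε := q.2) (p := p) hqx
  rw [hg] at e1
  rw [hWs _ hε, hWt _ hε]
  have := mul_pos (Δ.κ_pos q.2 p q.1.2) c1
  have e2 : (w q.1.1 - w q.1.2) * (Δ.arcW q.2 p q.1.1 - Δ.arcW q.2 p q.1.2) =
    (w q.1.2 - w q.1.1) * (Δ.arcW q.2 p q.1.2 - Δ.arcW q.2 p q.1.1) := by ring
  rw [e2, e1]
  linarith

/-- Two points near a cusp, on different sides. -/
theorem eventually_good_cusp_aux (hw : B.IsResolutionHeight w) {p : ℝ} (hp : p ∈ cusps K.front) :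
    ∀ᶠ q in (𝓝 p ×ˢ 𝓝 p) ×ˢ 𝓝[>] (0 : ℝ), q.1.1 < p → p < q.1.2 → K.x q.1.1 = K.x q.1.2 →
      Δ.GoodPair q.2 q.1.1 q.1.2 := by
  obtain ⟨e, he⟩ := B.exists_isCuspSign hp
  have hx0 : deriv K.x p = 0 := LegendrianKnot.deriv_x_of_mem_cusps hp
  have hyp := K.deriv_y_ne_zero hx0
  have hWs := eventually_pairs_fst (t := p) (Δ.eventually_W_eq_arcW hp (B.self_mem hp))
  have hWt := eventually_pairs_snd (s := p) (Δ.eventually_W_eq_arcW hp (B.self_mem hp))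
  have hε := eventually_pairs_eps (s := p) (t := p) eventually_eps_pos
  have hys : ∀ᶠ q in (𝓝 p ×ˢ 𝓝 p) ×ˢ 𝓝[>] (0 : ℝ), q.1.1 < q.1.2 →
      0 < deriv K.y p * (K.y q.1.2 - K.y q.1.1) :=
    tendsto_fst.eventually (eventually_sub_pos K.smooth_y hyp)
  have hIs := eventually_pairs_fst (t := p) (Ioo_mem_nhds (B.a_lt hp) (B.lt_b hp))
  have hIt := eventually_pairs_snd (s := p) (Ioo_mem_nhds (B.a_lt hp) (B.lt_b hp))
  have hzy : ∀ s ∈ Ico (B.a p) p, ∀ t ∈ Ioc p (B.b p), K.x s = K.x t →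
      0 < deriv K.y p * (K.y t - K.y s) → 0 < e * ((K.y t - K.y s) * (K.z t - K.z s)) := by
    intro s hs t ht hx h
    have h1 := mul_pos h (he.z_order hp hs ht hx)
    have h2 : 0 < (e * ((K.y t - K.y s) * (K.z t - K.z s))) * (deriv K.y p) ^ 2 := by linarith
    exact pos_of_mul_pos_left h2 (sq_nonneg _)
  rcases hp.2 with h | h
  · obtain rfl := he.eq_one h
    filter_upwards [hWs, hWt, hε, hys, hIs, hIt] with q hWs hWt hε hys hIs hIt hqs hqt hqx
    have hs : q.1.1 ∈ Ico (B.a p) p := ⟨hIs.1.le, hqs⟩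
    have ht : q.1.2 ∈ Ioc p (B.b p) := ⟨hqt, hIt.2.le⟩
    have h1 := hzy _ hs _ ht hqx (hys (hqs.trans hqt))
    have h2 := hw.order_left hp h hs ht hqx
    left
    rw [hWs _ hε, hWt _ hε, Δ.arcW_of_left hp h, Δ.arcW_of_left hp h]
    have h3 : 0 < (K.z q.1.2 - K.z q.1.1) *
        ((K.z q.1.2 - K.z q.1.1) + q.2 * (K.y q.1.2 - K.y q.1.1)) := by
      have h4 := mul_pos hε h1
      nlinarith [sq_nonneg (K.z q.1.2 - K.z q.1.1)]
    have h4 := mul_pos h2 h3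
    have h5 : 0 < ((w q.1.1 - w q.1.2) * (K.z q.1.1 + q.2 * K.y q.1.1 -
        (K.z q.1.2 + q.2 * K.y q.1.2))) * (K.z q.1.2 - K.z q.1.1) ^ 2 := by linarith
    exact pos_of_mul_pos_left h5 (sq_nonneg _)
  · obtain rfl := he.eq_neg_one h
    obtain ⟨s₀, t₀, hc⟩ := Δ.right p hp h
    have hs₀ := hc.mem_left
    obtain ⟨g, hgc, hg⟩ := Δ.exists_slope hp
    have hpx : K.x s₀ < K.x p := by
      have := he.height_pos hp ⟨hs₀.1.le, hs₀.2⟩; linarith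
    have hgp : 1 < g p := by rw [← hg, hc.deriv_eq _ hpx.le]; linarith
    have c1 : ∀ᶠ q in (𝓝 p ×ˢ 𝓝 p) ×ˢ 𝓝[>] (0 : ℝ), 0 < (1 + q.2 * Δ.R p) * g q.1.2 - 1 := by
      refine ContinuousAt.eventually_pos_pairs (f := fun q => (1 + q.2 * Δ.R p) * g q.1.2 - 1)
        (by fun_prop) ?_
      simpa using hgp
    have c2 := eventually_pairs_fst (t := p)
      (K.smooth_x.continuous.continuousAt.eventually (lt_mem_nhds hpx))
    filter_upwards [hWs, hWt, hε, hys, hIs, hIt, c1, c2]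
      with q hWs hWt hε hys hIs hIt c1 c2 hqs hqt hqx
    have hs : q.1.1 ∈ Ico (B.a p) p := ⟨hIs.1.le, hqs⟩
    have ht : q.1.2 ∈ Ioc p (B.b p) := ⟨hqt, hIt.2.le⟩
    have h1 := hzy _ hs _ ht hqx (hys (hqs.trans hqt))
    have h2 := hc.beyond _ hs _ ht hqx c2
    left
    have e1 := Δ.arcW_sub_arcW (ε := q.2) (p := p) hqx
    rw [hg] at e1
    rw [hWs _ hε, hWt _ hε]
    have h3 : (Δ.arcW q.2 p q.1.2 - Δ.arcW q.2 p q.1.1) * (K.z q.1.2 - K.z q.1.1) < 0 := by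
      rw [e1, mul_assoc]
      refine mul_neg_of_pos_of_neg (Δ.κ_pos _ _ _) ?_
      have h4 := mul_pos hε h1
      nlinarith [mul_nonneg c1.le (sq_nonneg (K.z q.1.2 - K.z q.1.1))]
    have h4 := mul_pos_of_neg_of_neg h2 h3
    have h5 : 0 < ((w q.1.1 - w q.1.2) * (Δ.arcW q.2 p q.1.1 - Δ.arcW q.2 p q.1.2)) *
        (K.z q.1.2 - K.z q.1.1) ^ 2 := by linarith
    exact pos_of_mul_pos_left h5 (sq_nonneg _)

theorem tendsto_pairs_swap (s t : ℝ) :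
    Tendsto (fun q : (ℝ × ℝ) × ℝ => ((q.1.2, q.1.1), q.2)) ((𝓝 s ×ˢ 𝓝 t) ×ˢ 𝓝[>] (0 : ℝ))
      ((𝓝 t ×ˢ 𝓝 s) ×ˢ 𝓝[>] (0 : ℝ)) :=
  ((tendsto_snd.comp tendsto_fst).prodMk (tendsto_fst.comp tendsto_fst)).prodMk tendsto_snd

/-- Two points in the same arc. -/
theorem eventually_good_arc (hw : B.IsResolutionHeight w) {p s t : ℝ} (hp : p ∈ cusps K.front)
    (hs : s ∈ Icc (B.a p) (B.b p)) (ht : t ∈ Icc (B.a p) (B.b p)) (hx : K.x s = K.x t) :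
    ∀ᶠ q in (𝓝 s ×ˢ 𝓝 t) ×ˢ 𝓝[>] (0 : ℝ), ¬ SameParam q.1.1 q.1.2 → K.x q.1.1 = K.x q.1.2 →
      Δ.GoodPair q.2 q.1.1 q.1.2 := by
  obtain ⟨e, he⟩ := B.exists_isCuspSign hp
  have main : ∀ s ∈ Ico (B.a p) p, ∀ t ∈ Ioc p (B.b p), K.x s = K.x t →
      ∀ᶠ q in (𝓝 s ×ˢ 𝓝 t) ×ˢ 𝓝[>] (0 : ℝ), K.x q.1.1 = K.x q.1.2 →
      Δ.GoodPair q.2 q.1.1 q.1.2 := by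
    intro s hs t ht hx
    rcases hp.2 with h | h
    · exact (Δ.eventually_good_left hw hp h hs ht hx).mono fun q hq _ => hq
    · exact Δ.eventually_good_right hw hp h hs ht hx
  rcases he.eq_or_branches hp hs ht hx with rfl | h | h
  · by_cases hsp : s = p
    · subst hsp
      filter_upwards [Δ.eventually_good_cusp_aux hw hp,
        (tendsto_pairs_swap s s).eventually (Δ.eventually_good_cusp_aux hw hp),
        eventually_pairs_fst (t := s) (Icc_mem_nhds (B.a_lt hp) (B.lt_b hp)),
        eventually_pairs_snd (s := s) (Icc_mem_nhds (B.a_lt hp) (B.lt_b hp))]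
        with q h1 h2 h3 h4 hne hqx
      rcases he.eq_or_branches hp h3 h4 hqx with h | h | h
      · exact absurd (h ▸ SameParam.refl _) hne
      · exact h1 h.1.2 h.2.1 hqx
      · exact (h2 h.1.2 h.2.1 hqx.symm).symm
    · have hreg : deriv K.x s ≠ 0 := fun h => hsp (B.eq_of_deriv_eq_zero hp hs h)
      exact (tendsto_fst.eventually (eventually_sameParam_of_regular hreg (SameParam.refl s))).mono
        fun q h h1 h2 => absurd (h h2) h1
  · exact (main s h.1 t h.2 hx).mono fun q hq _ => hq
  · exact ((tendsto_pairs_swap s t).eventually (main t h.1 s h.2 hx.symm)).mono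
      fun q hq _ h => (hq h.symm).symm

/-- All pairs of points on vertical lines are good if `ε` is small. -/
theorem eventually_good (hw : B.IsResolutionHeight w) : ∀ᶠ ε in 𝓝[>] (0 : ℝ),
    ∀ s t, ¬ SameParam s t → K.x s = K.x t → Δ.GoodPair ε s t := by
  refine eventually_forall_pairs (P := fun s t ε => ¬ SameParam s t → K.x s = K.x t →
    Δ.GoodPair ε s t) ?_ fun s t => ?_
  · intro s s' t t' ε hs ht h h1 h2
    refine (h ((SameParam.congr hs ht).not.2 h1) ?_).of_sameParam hw.periodic hs ht
    rw [hs.apply_eq K.periodic_x, ht.apply_eq K.periodic_x, h2]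
  · by_cases hx : K.x s = K.x t
    swap
    · have h1 : ∀ᶠ q in (𝓝 s ×ˢ 𝓝 t) ×ˢ 𝓝[>] (0 : ℝ), 0 < (K.x q.1.1 - K.x q.1.2) ^ 2 := by
        have := K.smooth_x.continuous
        exact ContinuousAt.eventually_pos_pairs (f := fun q => (K.x q.1.1 - K.x q.1.2) ^ 2)
          (by fun_prop) (sq_pos_of_ne_zero (sub_ne_zero.2 hx))
      filter_upwards [h1] with q hq _ h
      simp [h] at hq
    by_cases hs : ∃ p ∈ cusps K.front, s ∈ B.params p
    · obtain ⟨p, hp, hs⟩ := hs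
      by_cases ht : t ∈ B.params p
      · obtain ⟨n, hn⟩ := (B.mem_params_iff hp).1 hs
        obtain ⟨m, hm⟩ := (B.mem_params_iff hp).1 ht
        have h1 : Tendsto (fun q : (ℝ × ℝ) × ℝ => ((q.1.1 + n, q.1.2 + m), q.2))
            ((𝓝 s ×ˢ 𝓝 t) ×ˢ 𝓝[>] (0 : ℝ)) ((𝓝 (s + n) ×ˢ 𝓝 (t + m)) ×ˢ 𝓝[>] (0 : ℝ)) :=
          ((((continuous_add_const (n : ℝ)).tendsto s).comp (tendsto_fst.comp tendsto_fst)).prodMk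
            (((continuous_add_const (m : ℝ)).tendsto t).comp
              (tendsto_snd.comp tendsto_fst))).prodMk tendsto_snd
        filter_upwards [h1.eventually (Δ.eventually_good_arc hw hp hn hm
          (by rw [K.periodic_x.add_int, K.periodic_x.add_int, hx]))] with q hq k1 k2
        simp only [K.periodic_x.add_int, SameParam.congr (SameParam.add_int q.1.1 n)
          (SameParam.add_int q.1.2 m)] at hq
        exact (hq k1 k2).of_sameParam hw.periodic (SameParam.add_int _ _) (SameParam.add_int _ _)
      · exact (Δ.eventually_good_of_mem_of_notMem hw hp hs ht hx).mono fun q hq _ _ => hq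
    · by_cases ht : ∃ p ∈ cusps K.front, t ∈ B.params p
      · obtain ⟨p, hp, ht⟩ := ht
        push Not at hs
        exact ((tendsto_pairs_swap s t).eventually
          (Δ.eventually_good_of_mem_of_notMem hw hp ht (hs p hp) hx.symm)).mono
          fun q hq _ _ => hq.symm
      · push Not at hs ht
        by_cases hst : SameParam s t
        · exact (tendsto_fst.eventually (eventually_sameParam_of_regular
            (B.deriv_x_ne_zero_of_notMem hs) hst)).mono fun q h h1 h2 => absurd (h h2) h1
        · exact (Δ.eventually_good_of_notMem hw hs ht hst hx).mono fun q hq _ _ => hq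

/-- There are no triple points outside the boxes. -/
theorem eventually_no_triple (B : FrontBoxes K) : ∀ᶠ ε in 𝓝[>] (0 : ℝ), ∀ r s t,
    (∀ p ∈ cusps K.front, r ∉ B.params p) → (∀ p ∈ cusps K.front, s ∉ B.params p) →
    K.x r = K.x s → K.x s = K.x t → ∀ τ ∈ Icc (0 : ℝ) ε,
    K.z r + τ * K.y r = K.z s + τ * K.y s → K.z s + τ * K.y s = K.z t + τ * K.y t →
    (∀ p ∈ cusps K.front, t ∉ B.params p) →
    SameParam r s ∨ SameParam s t ∨ SameParam r t := by
  refine eventually_forall_triples ?_ ?_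
  · intro r r' s s' t t' ε hr hs ht h
    simpa only [hr.apply_eq K.periodic_x, hs.apply_eq K.periodic_x, ht.apply_eq K.periodic_x,
      hr.apply_eq K.periodic_y, hs.apply_eq K.periodic_y, ht.apply_eq K.periodic_y,
      hr.apply_eq K.periodic_z, hs.apply_eq K.periodic_z, ht.apply_eq K.periodic_z,
      B.params_congr hr, B.params_congr hs, B.params_congr ht, SameParam.congr hr hs,
      SameParam.congr hs ht, SameParam.congr hr ht] using h
  · intro r s t
    have hy := K.smooth_y.continuous
    have hz := K.smooth_z.continuous
    have hxc := K.smooth_x.continuous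
    have hfar : ∀ s t : ℝ, K.front s ≠ K.front t → ∀ᶠ q in (𝓝 s ×ˢ 𝓝 t) ×ˢ 𝓝[>] (0 : ℝ),
        K.x q.1.1 = K.x q.1.2 → ∀ τ ∈ Icc (0 : ℝ) q.2,
        K.z q.1.1 + τ * K.y q.1.1 ≠ K.z q.1.2 + τ * K.y q.1.2 := by
      intro s t hne
      have h1 : 0 < |K.x s - K.x t| + |K.z s - K.z t| := by
        by_contra! hcon
        have h1 := abs_nonneg (K.x s - K.x t)
        have h2 := abs_nonneg (K.z s - K.z t)
        have h3 : |K.x s - K.x t| = 0 := by linarith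
        have h4 : |K.z s - K.z t| = 0 := by linarith
        exact hne (Prod.ext (sub_eq_zero.1 (abs_eq_zero.1 h3)) (sub_eq_zero.1 (abs_eq_zero.1 h4)))
      have h2 : ∀ᶠ q in (𝓝 s ×ˢ 𝓝 t) ×ˢ 𝓝[>] (0 : ℝ), 0 < |K.x q.1.1 - K.x q.1.2| +
          |K.z q.1.1 - K.z q.1.2| - q.2 * |K.y q.1.1 - K.y q.1.2| :=
        ContinuousAt.eventually_pos_pairs (f := fun q => |K.x q.1.1 - K.x q.1.2| +
          |K.z q.1.1 - K.z q.1.2| - q.2 * |K.y q.1.1 - K.y q.1.2|) (by fun_prop)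
          (by simpa using h1)
      filter_upwards [h2] with q h2 hx τ hτ h
      have e : K.z q.1.1 - K.z q.1.2 = -(τ * (K.y q.1.1 - K.y q.1.2)) := by linarith
      rw [hx, e, abs_neg, abs_mul, abs_of_nonneg hτ.1, sub_self, abs_zero, zero_add] at h2
      nlinarith [mul_le_mul_of_nonneg_right hτ.2 (abs_nonneg (K.y q.1.1 - K.y q.1.2))]
    have hnear : ∀ s t : ℝ, SameParam s t → ∀ᶠ q in 𝓝 s ×ˢ 𝓝 t,
        (∀ p ∈ cusps K.front, q.1 ∉ B.params p) → K.x q.1 = K.x q.2 → SameParam q.1 q.2 := by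
      intro s t hst
      by_cases h0 : deriv K.x s = 0
      · obtain ⟨p, hp, hsp⟩ := B.generic.exists_cusp h0
        obtain ⟨n, hn⟩ := hsp.symm
        have h1 : ∀ᶠ q in 𝓝 s, q ∈ B.params p := by
          have : ∀ᶠ q in 𝓝 s, q + (n : ℝ) ∈ Ioo (B.a p) (B.b p) :=
            (continuous_add_const (n : ℝ)).continuousAt.eventually
              (Ioo_mem_nhds (by simpa only [← hn] using B.a_lt hp)
                (by simpa only [← hn] using B.lt_b hp))
          exact this.mono fun q hq => (B.mem_params_iff hp).2 ⟨n, hq.1.le, hq.2.le⟩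
        exact (tendsto_fst.eventually h1).mono fun q hq h => absurd hq (h p hp)
      · exact (eventually_sameParam_of_regular h0 hst).mono fun q hq _ => hq
    have trs : Tendsto (fun q : (ℝ × ℝ × ℝ) × ℝ => ((q.1.1, q.1.2.1), q.2))
        ((𝓝 r ×ˢ 𝓝 s ×ˢ 𝓝 t) ×ˢ 𝓝[>] (0 : ℝ)) ((𝓝 r ×ˢ 𝓝 s) ×ˢ 𝓝[>] (0 : ℝ)) :=
      ((tendsto_fst.comp tendsto_fst).prodMk
        (tendsto_fst.comp (tendsto_snd.comp tendsto_fst))).prodMk tendsto_snd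
    have tst : Tendsto (fun q : (ℝ × ℝ × ℝ) × ℝ => ((q.1.2.1, q.1.2.2), q.2))
        ((𝓝 r ×ˢ 𝓝 s ×ˢ 𝓝 t) ×ˢ 𝓝[>] (0 : ℝ)) ((𝓝 s ×ˢ 𝓝 t) ×ˢ 𝓝[>] (0 : ℝ)) :=
      (tendsto_snd.comp tendsto_fst).prodMk tendsto_snd
    have trt : Tendsto (fun q : (ℝ × ℝ × ℝ) × ℝ => ((q.1.1, q.1.2.2), q.2))
        ((𝓝 r ×ˢ 𝓝 s ×ˢ 𝓝 t) ×ˢ 𝓝[>] (0 : ℝ)) ((𝓝 r ×ˢ 𝓝 t) ×ˢ 𝓝[>] (0 : ℝ)) :=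
      ((tendsto_fst.comp tendsto_fst).prodMk
        (tendsto_snd.comp (tendsto_snd.comp tendsto_fst))).prodMk tendsto_snd
    by_cases h1 : K.front r = K.front s
    swap
    · filter_upwards [trs.eventually (hfar r s h1)] with q hq _ _ hx _ τ hτ h
      exact absurd h (hq hx τ hτ)
    by_cases h2 : K.front s = K.front t
    swap
    · filter_upwards [tst.eventually (hfar s t h2)] with q hq _ _ _ hx τ hτ _ h
      exact absurd h (hq hx τ hτ)
    rcases B.generic.no_triple r s t h1 h2 with h | h | h
    · filter_upwards [(tendsto_fst.comp trs).eventually (hnear r s h)] with q hq k _ hx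
      exact fun _ _ _ _ _ _ => Or.inl (hq k hx)
    · filter_upwards [(tendsto_fst.comp tst).eventually (hnear s t h)] with q hq _ k _ hx
      exact fun _ _ _ _ _ => Or.inr (Or.inl (hq k hx))
    · filter_upwards [(tendsto_fst.comp trt).eventually (hnear r t h)] with q hq k _ hx hx'
      exact fun _ _ _ _ _ => Or.inr (Or.inr (hq k (hx.trans hx')))

end FrontBoxes.Deformation

/-! ### Curves in the plane -/

theorem hasDerivAt_prodMk {x w : ℝ → ℝ} (hx : ContDiff ℝ ∞ x) (hw : ContDiff ℝ ∞ w) (t : ℝ) :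
    HasDerivAt (fun t => (x t, w t)) (deriv x t, deriv w t) t :=
  (hx.hasDerivAt_top t).prodMk (hw.hasDerivAt_top t)

/-- Rescaling the vertical coordinate by a positive function of the horizontal one. -/
theorem IsGenericClosedCurve.rescale {x w f : ℝ → ℝ} (hx : ContDiff ℝ ∞ x) (hw : ContDiff ℝ ∞ w)
    (h : IsGenericClosedCurve fun t => (x t, w t)) (hf : ContDiff ℝ ∞ f) (hpos : ∀ ξ, 0 < f ξ) :
    IsGenericClosedCurve fun t => (x t, f (x t) * w t) := by
  have hper : ∀ t, x (t + 1) = x t ∧ w (t + 1) = w t := fun t => Prod.ext_iff.1 (h.periodic t)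
  have hd : ∀ t, HasDerivAt (fun t => (x t, f (x t) * w t))
      (deriv x t, deriv f (x t) * deriv x t * w t + f (x t) * deriv w t) t := fun t =>
    (hx.hasDerivAt_top t).prodMk
      (((hf.hasDerivAt_top (x t)).comp t (hx.hasDerivAt_top t)).mul (hw.hasDerivAt_top t))
  have heq : ∀ s t, (x s, f (x s) * w s) = (x t, f (x t) * w t) → (x s, w s) = (x t, w t) := by
    intro s t hst
    obtain ⟨h1, h2⟩ := Prod.ext_iff.1 hst
    simp only at h1 h2
    rw [h1] at h2
    exact Prod.ext h1 (mul_left_cancel₀ (hpos _).ne' h2)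
  refine ⟨hx.prodMk ((hf.comp hx).mul hw), fun t => ?_, fun t h0 => ?_, fun s t hst he => ?_,
    fun r s t h1 h2 => h.no_triple r s t (heq r s h1) (heq s t h2)⟩
  · simp only [(hper t).1, (hper t).2]
  · rw [(hd t).deriv] at h0
    obtain ⟨h1, h2⟩ := Prod.ext_iff.1 h0
    simp only [Prod.fst_zero, Prod.snd_zero] at h1 h2
    rw [h1, mul_zero, zero_mul, zero_add] at h2
    refine h.immersed t ?_
    rw [(hasDerivAt_prodMk hx hw t).deriv]
    exact Prod.ext h1 ((mul_eq_zero.1 h2).resolve_left (hpos _).ne')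
  · have h1 := h.transverse s t hst (heq s t he)
    obtain ⟨h2, h3⟩ := Prod.ext_iff.1 (heq s t he)
    simp only at h2 h3
    rw [(hasDerivAt_prodMk hx hw s).deriv, (hasDerivAt_prodMk hx hw t).deriv] at h1
    rw [(hd s).deriv, (hd t).deriv]
    simp only at h1 ⊢
    rw [h2, h3]
    have e : deriv x s * (deriv f (x t) * deriv x t * w t + f (x t) * deriv w t) -
        (deriv f (x t) * deriv x s * w t + f (x t) * deriv w s) * deriv x t =
        f (x t) * (deriv x s * deriv w t - deriv w s * deriv x t) := by ring
    rw [e]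
    exact mul_ne_zero (hpos _).ne' h1

/-- Linear interpolation between two functions. -/
def blend (θ : ℝ) (f g : ℝ → ℝ) (t : ℝ) : ℝ := (1 - θ) * f t + θ * g t

theorem blend_zero (f g : ℝ → ℝ) : blend 0 f g = f := funext fun t => by simp [blend]

theorem blend_one (f g : ℝ → ℝ) : blend 1 f g = g := funext fun t => by simp [blend]

theorem ContDiff.blend {f g : ℝ → ℝ} (hf : ContDiff ℝ ∞ f) (hg : ContDiff ℝ ∞ g) (θ : ℝ) :
    ContDiff ℝ ∞ (blend θ f g) :=
  (contDiff_const.mul hf).add (contDiff_const.mul hg)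

theorem deriv_blend {f g : ℝ → ℝ} (hf : ContDiff ℝ ∞ f) (hg : ContDiff ℝ ∞ g) (θ t : ℝ) :
    deriv (blend θ f g) t = (1 - θ) * deriv f t + θ * deriv g t :=
  (((hf.hasDerivAt_top t).const_mul (1 - θ)).add ((hg.hasDerivAt_top t).const_mul θ)).deriv

theorem Function.Periodic.blend {f g : ℝ → ℝ} (hf : Function.Periodic f 1)
    (hg : Function.Periodic g 1) (θ : ℝ) : Function.Periodic (blend θ f g) 1 := fun t => by
  simp only [_root_.blend, hf t, hg t]

theorem convex_comb_ne_zero {θ a b : ℝ} (hθ : θ ∈ Icc (0 : ℝ) 1) (h : 0 < a * b) :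
    (1 - θ) * a + θ * b ≠ 0 := by
  intro h0
  have h1 : (1 - θ) * a ^ 2 + θ * (a * b) = 0 := by linear_combination a * h0
  have h2 : (1 - θ) * (a * b) + θ * b ^ 2 = 0 := by linear_combination b * h0
  nlinarith [mul_nonneg (sub_nonneg.2 hθ.2) (sq_nonneg a), mul_nonneg hθ.1 (sq_nonneg b)]

namespace FrontBoxes

variable {K : LegendrianKnot} {B : FrontBoxes K}

/-- Three points on a vertical line in the same box. -/
theorem sameParam_of_three {p : ℝ} (hp : p ∈ cusps K.front) {r s t : ℝ}
    (hr : r ∈ B.params p) (hs : s ∈ B.params p) (ht : t ∈ B.params p) (hrs : K.x r = K.x s)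
    (hst : K.x s = K.x t) : SameParam r s ∨ SameParam s t ∨ SameParam r t := by
  obtain ⟨e, he⟩ := B.exists_isCuspSign hp
  obtain ⟨l, hl⟩ := (B.mem_params_iff hp).1 hr
  obtain ⟨m, hm⟩ := (B.mem_params_iff hp).1 hs
  obtain ⟨n, hn⟩ := (B.mem_params_iff hp).1 ht
  have key : ∀ (s t : ℝ) (m n : ℤ), s + m = t + n → SameParam s t := fun s t m n h =>
    ⟨n - m, by push_cast; linarith⟩
  rcases he.eq_or_branches hp hl hm (by simp only [K.periodic_x.add_int, hrs]) with h | h | h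
  · exact Or.inl (key _ _ _ _ h)
  · rcases he.eq_or_branches hp hm hn (by simp only [K.periodic_x.add_int, hst]) with h' | h' | h'
    · exact Or.inr (Or.inl (key _ _ _ _ h'))
    · exact absurd h'.1.2 (not_lt.2 h.2.1.le)
    · refine Or.inr (Or.inr (key _ _ _ _ (he.anti.injOn ⟨h.1.1, h.1.2.le⟩ ⟨h'.1.1, h'.1.2.le⟩ ?_)))
      simp only [K.periodic_x.add_int, hrs, hst]
  · rcases he.eq_or_branches hp hm hn (by simp only [K.periodic_x.add_int, hst]) with h' | h' | h'
    · exact Or.inr (Or.inl (key _ _ _ _ h'))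
    · refine Or.inr (Or.inr (key _ _ _ _ (he.mono.injOn ⟨h.2.1.le, h.2.2⟩ ⟨h'.2.1.le, h'.2.2⟩ ?_)))
      simp only [K.periodic_x.add_int, hrs, hst]
    · exact absurd h'.2.1 (not_lt.2 h.1.2.le)

namespace Deformation

variable {w : ℝ → ℝ} (Δ : B.Deformation w)

/-- The parameter `ε` of the deformation is small enough. -/
structure IsSmall (ε : ℝ) : Prop where
  pos : 0 < ε
  good : ∀ s t, ¬ SameParam s t → K.x s = K.x t → Δ.GoodPair ε s t
  no_triple : ∀ r s t,
    (∀ p ∈ cusps K.front, r ∉ B.params p) → (∀ p ∈ cusps K.front, s ∉ B.params p) →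
    K.x r = K.x s → K.x s = K.x t → ∀ τ ∈ Icc (0 : ℝ) ε,
    K.z r + τ * K.y r = K.z s + τ * K.y s → K.z s + τ * K.y s = K.z t + τ * K.y t →
    (∀ p ∈ cusps K.front, t ∉ B.params p) →
    SameParam r s ∨ SameParam s t ∨ SameParam r t
  κ_le_one : ∀ p ∈ cusps K.front, ∀ t, Δ.κ ε p t ≤ 1

theorem exists_isSmall (hw : B.IsResolutionHeight w) : ∃ ε, Δ.IsSmall ε := by
  have h : ∀ᶠ ε in 𝓝[>] (0 : ℝ), ∀ p ∈ cusps K.front, ∀ t, Δ.κ ε p t ≤ 1 :=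
    (eventually_all_finite B.generic.finite_cusps).2 fun p hp => Δ.eventually_κ_le_one hp
  obtain ⟨ε, h1, h2, h3, h4⟩ :=
    (eventually_eps_pos.and ((Δ.eventually_good hw).and ((eventually_no_triple B).and h))).exists
  exact ⟨ε, h1, h2, h3, h4⟩

variable {Δ} in
/-- The interpolated curves are generic. -/
theorem IsSmall.isGeneric (hw : B.IsResolutionHeight w) {ε θ : ℝ} (hε : Δ.IsSmall ε)
    (hθ : θ ∈ Icc (0 : ℝ) 1) (himm : ∀ t, deriv K.x t = 0 → 0 < deriv w t * deriv (Δ.W ε) t) :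
    IsGenericClosedCurve fun t => (K.x t, blend θ w (Δ.W ε) t) := by
  have hb := hw.smooth.blend (Δ.contDiff_W ε) θ
  have hd := hasDerivAt_prodMk K.smooth_x hb
  have hgood : ∀ s t, ¬ SameParam s t →
      (K.x s, blend θ w (Δ.W ε) s) = (K.x t, blend θ w (Δ.W ε) t) →
      deriv K.x s ≠ 0 ∧ deriv K.x t ≠ 0 ∧
      0 < (deriv w s / deriv K.x s - deriv w t / deriv K.x t) *
        (deriv (Δ.W ε) s / deriv K.x s - deriv (Δ.W ε) t / deriv K.x t) ∧
      ∀ p ∈ cusps K.front, (s ∈ B.params p ↔ t ∈ B.params p) := by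
    intro s t hst he
    obtain ⟨h1, h2⟩ := Prod.ext_iff.1 he
    rcases hε.good s t hst h1 with h | ⟨h3, h4, h5, -, h6⟩
    · refine absurd ?_ (convex_comb_ne_zero hθ h)
      simp only [blend] at h2
      linarith
    · exact ⟨h3, h4, h5, h6⟩
  refine ⟨K.smooth_x.prodMk hb, fun t => ?_, fun t h0 => ?_, fun s t hst he => ?_,
    fun r s t hrs hst => ?_⟩
  · exact Prod.ext (K.periodic_x t) (hw.periodic.blend (Δ.periodic_W ε) θ t)
  · rw [(hd t).deriv, deriv_blend hw.smooth (Δ.contDiff_W ε)] at h0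
    obtain ⟨h1, h2⟩ := Prod.ext_iff.1 h0
    exact convex_comb_ne_zero hθ (himm t h1) h2
  · obtain ⟨h1, h2, h3, -⟩ := hgood s t hst he
    rw [(hd s).deriv, (hd t).deriv, deriv_blend hw.smooth (Δ.contDiff_W ε),
      deriv_blend hw.smooth (Δ.contDiff_W ε)]
    intro h0
    refine convex_comb_ne_zero hθ h3 ?_
    simp only at h0
    field_simp
    linear_combination -h0
  · by_contra! hcon
    obtain ⟨n1, n2, n3⟩ := hcon
    have g1 := hgood r s n1 hrs
    have g2 := hgood s t n2 hst
    obtain ⟨e1, e2⟩ := Prod.ext_iff.1 hrs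
    obtain ⟨e3, e4⟩ := Prod.ext_iff.1 hst
    by_cases h : ∃ p ∈ cusps K.front, r ∈ B.params p
    · obtain ⟨p, hp, hr⟩ := h
      have hs := (g1.2.2.2 p hp).1 hr
      rcases sameParam_of_three hp hr hs ((g2.2.2.2 p hp).1 hs) e1 e3 with h | h | h
      · exact n1 h
      · exact n2 h
      · exact n3 h
    · push Not at h
      have hs : ∀ p ∈ cusps K.front, s ∉ B.params p := fun p hp => (g1.2.2.2 p hp).not.1 (h p hp)
      have ht : ∀ p ∈ cusps K.front, t ∉ B.params p := fun p hp => (g2.2.2.2 p hp).not.1 (hs p hp)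
      have key : ∀ u, (∀ p ∈ cusps K.front, u ∉ B.params p) →
          blend θ w (Δ.W ε) u = K.z u + θ * ε * K.y u := fun u hu => by
        rw [blend, hw.eq_of_notMem u hu, Δ.W_of_notMem hu]; ring
      simp only [key r h, key s hs, key t ht] at e2 e4
      rcases hε.no_triple r s t h hs e1 e3 (θ * ε)
        ⟨mul_nonneg hθ.1 hε.pos.le, mul_le_of_le_one_left hε.pos.le hθ.2⟩ e2 e4 ht with h | h | h
      · exact n1 h
      · exact n2 h
      · exact n3 h

theorem hasDerivAt_Y_cusp {t : ℝ} (h : deriv K.x t = 0) (ε : ℝ) :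
    ∃ k > 0, deriv (Δ.Y ε) t = k * deriv K.y t := by
  obtain ⟨p, hp, n, rfl⟩ := B.generic.exists_cusp h
  have hx0 : deriv K.x p = 0 := LegendrianKnot.deriv_x_of_mem_cusps hp
  refine ⟨Δ.κ ε p p, Δ.κ_pos ε p p, ?_⟩
  rw [(Δ.periodic_Y ε).deriv_one.add_int, K.periodic_y.deriv_one.add_int,
    (Δ.Y_of_mem hp (B.mem_params hp (B.self_mem hp)) ε).deriv_eq]
  have h1 := (Δ.hasDerivAt_κ hp ε p).mul ((K.smooth_y.hasDerivAt_top p).sub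
    ((((Δ.contDiff_slope hp).hasDerivAt_top p).const_mul (1 / ε + Δ.R p)).mul
      ((K.smooth_z.hasDerivAt_top p).sub_const (K.z p))))
  refine (h1.congr_deriv ?_).deriv
  simp only [K.legendrian, hx0]
  ring

/-- The deformation stays inside the boxes and outside them. -/
theorem mem_params_iff_blend {ε θ : ℝ} (hκ : ∀ p ∈ cusps K.front, ∀ t, Δ.κ ε p t ≤ 1)
    (hθ : θ ∈ Icc (0 : ℝ) 1) {p : ℝ} (hp : p ∈ cusps K.front) (t : ℝ) :
    t ∈ B.params p ↔ (K.x t, blend θ K.z (Δ.Z ε) t) ∈ Icc (B.u p) (B.v p) := by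
  have key : ∀ q ∈ cusps K.front, t ∈ B.params q →
      (K.x t, blend θ K.z (Δ.Z ε) t) ∈ Icc (B.u q) (B.v q) := by
    intro q hq ht
    have hzq := B.mem_Icc_snd (B.mem_params hq (B.self_mem hq))
    have hzt := B.mem_Icc_snd ht
    have hxt := B.mem_Icc_fst ht
    have hκ0 := (Δ.κ_pos ε q t).le
    have hκ1 := hκ q hq t
    have hconv : Convex ℝ (Icc (B.u q).2 (B.v q).2) := convex_Icc _ _
    have h1 : Δ.Z ε t ∈ Icc (B.u q).2 (B.v q).2 := by
      rw [(Δ.Z_of_mem hq ht ε).eq_of_nhds]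
      have := hconv hzq hzt (sub_nonneg.2 hκ1) hκ0 (by ring)
      simp only [smul_eq_mul] at this
      convert this using 1
      rw [arcZ]; ring
    have h2 : blend θ K.z (Δ.Z ε) t ∈ Icc (B.u q).2 (B.v q).2 := by
      have := hconv hzt h1 (sub_nonneg.2 hθ.2) hθ.1 (by ring)
      simp only [smul_eq_mul] at this
      exact this
    exact ⟨⟨hxt.1, h2.1⟩, ⟨hxt.2, h2.2⟩⟩
  refine ⟨key p hp, fun h => ?_⟩
  by_cases ht : ∃ q ∈ cusps K.front, t ∈ B.params q
  · obtain ⟨q, hq, ht⟩ := ht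
    by_contra hcon
    have hpq : p ≠ q := by rintro rfl; exact hcon ht
    exact Set.disjoint_left.1 (B.disjoint p hp q hq hpq) h (key q hq ht)
  · push Not at ht
    have e : blend θ K.z (Δ.Z ε) t = K.z t := by rw [blend, Δ.Z_of_notMem ht]; ring
    rw [e] at h
    exact h

theorem blend_embedded {ε θ : ℝ} (hκ : ∀ p ∈ cusps K.front, ∀ t, Δ.κ ε p t ≤ 1)
    (hθ : θ ∈ Icc (0 : ℝ) 1) {s t : ℝ} (hx : K.x s = K.x t)
    (hy : blend θ K.y (Δ.Y ε) s = blend θ K.y (Δ.Y ε) t)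
    (hz : blend θ K.z (Δ.Z ε) s = blend θ K.z (Δ.Z ε) t) : SameParam s t := by
  have hiff : ∀ p ∈ cusps K.front, (s ∈ B.params p ↔ t ∈ B.params p) := fun p hp => by
    rw [Δ.mem_params_iff_blend hκ hθ hp, Δ.mem_params_iff_blend hκ hθ hp, hx, hz]
  by_cases h : ∃ p ∈ cusps K.front, s ∈ B.params p
  · obtain ⟨p, hp, hs⟩ := h
    have ht := (hiff p hp).1 hs
    simp only [blend, (Δ.Z_of_mem hp hs ε).eq_of_nhds, (Δ.Z_of_mem hp ht ε).eq_of_nhds, arcZ,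
      Δ.κ_congr hx] at hz
    have h1 : ((1 - θ) * 1 + θ * Δ.κ ε p t) * (K.z s - K.z t) = 0 := by linear_combination hz
    have h2 := (mul_eq_zero.1 h1).resolve_left
      (convex_comb_ne_zero hθ (by simpa using Δ.κ_pos ε p t))
    obtain ⟨m, hm⟩ := (B.mem_params_iff hp).1 hs
    obtain ⟨n, hn⟩ := (B.mem_params_iff hp).1 ht
    have h3 : s + (m : ℝ) = t + n := by
      by_contra hne
      refine B.z_ne hp hm hn ?_ hne ?_
      · simp only [K.periodic_x.add_int, hx]
      · simp only [K.periodic_z.add_int]; linarith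
    exact ⟨n - m, by push_cast; linarith⟩
  · push Not at h
    have ht : ∀ p ∈ cusps K.front, t ∉ B.params p := fun p hp => (hiff p hp).not.1 (h p hp)
    refine K.embedded s t hx ?_ ?_
    · simp only [blend, Δ.Y_of_notMem h, Δ.Y_of_notMem ht] at hy; linarith
    · simp only [blend, Δ.Z_of_notMem h, Δ.Z_of_notMem ht] at hz; linarith

/-- The Legendrian knots joining `K` to a knot whose Lagrangian projection is, up to the vertical
scale, the curve `(x, W)`. -/
noncomputable def knot {ε θ : ℝ} (hκ : ∀ p ∈ cusps K.front, ∀ t, Δ.κ ε p t ≤ 1)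
    (hθ : θ ∈ Icc (0 : ℝ) 1) : LegendrianKnot where
  x := K.x
  y t := Real.exp (θ / ε * K.x t) * (blend θ K.y (Δ.Y ε) t + θ / ε * blend θ K.z (Δ.Z ε) t)
  z t := Real.exp (θ / ε * K.x t) * blend θ K.z (Δ.Z ε) t
  smooth_x := K.smooth_x
  smooth_y := (contDiff_const.mul K.smooth_x).exp.mul ((K.smooth_y.blend (Δ.contDiff_Y ε) θ).add
    (contDiff_const.mul (K.smooth_z.blend (Δ.contDiff_Z ε) θ)))
  smooth_z := (contDiff_const.mul K.smooth_x).exp.mul (K.smooth_z.blend (Δ.contDiff_Z ε) θ)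
  periodic_x := K.periodic_x
  periodic_y t := by
    simp only [K.periodic_x t, K.periodic_y.blend (Δ.periodic_Y ε) θ t,
      K.periodic_z.blend (Δ.periodic_Z ε) θ t]
  periodic_z t := by simp only [K.periodic_x t, K.periodic_z.blend (Δ.periodic_Z ε) θ t]
  immersed t := by
    rintro ⟨h1, h2, -⟩
    have hY := K.smooth_y.blend (Δ.contDiff_Y ε) θ
    have hZ := K.smooth_z.blend (Δ.contDiff_Z ε) θ
    have hd := ((K.smooth_x.hasDerivAt_top t).const_mul (θ / ε)).exp.mul
      ((hY.hasDerivAt_top t).add ((hZ.hasDerivAt_top t).const_mul (θ / ε)))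
    have h3 := hd.deriv
    have hdZ : deriv (blend θ K.z (Δ.Z ε)) t = 0 := by
      rw [deriv_blend K.smooth_z (Δ.contDiff_Z ε), K.legendrian, (Δ.hasDerivAt_Z ε t).deriv, h1]
      ring
    obtain ⟨k, hk, hkY⟩ := Δ.hasDerivAt_Y_cusp h1 ε
    have hy0 := K.deriv_y_ne_zero h1
    rw [h1, hdZ, deriv_blend K.smooth_y (Δ.contDiff_Y ε), hkY] at h3
    have h4 : Real.exp (θ / ε * K.x t) * ((1 - θ) * deriv K.y t + θ * (k * deriv K.y t)) = 0 := by
      rw [← h2]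
      refine Eq.trans ?_ h3.symm
      ring
    refine (mul_ne_zero (Real.exp_ne_zero _) (convex_comb_ne_zero hθ ?_)) h4
    have := mul_pos hk (mul_self_pos.2 hy0)
    linarith
  embedded s t hx hy hz := by
    rw [hx] at hy hz
    have hz' := mul_left_cancel₀ (Real.exp_ne_zero _) hz
    have hy' := mul_left_cancel₀ (Real.exp_ne_zero _) hy
    rw [hz'] at hy'
    exact Δ.blend_embedded hκ hθ hx (add_right_cancel hy') hz'
  legendrian t := by
    have hZ := K.smooth_z.blend (Δ.contDiff_Z ε) θ
    have hd := ((K.smooth_x.hasDerivAt_top t).const_mul (θ / ε)).exp.mul (hZ.hasDerivAt_top t)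
    refine hd.deriv.trans ?_
    rw [deriv_blend K.smooth_z (Δ.contDiff_Z ε), K.legendrian, (Δ.hasDerivAt_Z ε t).deriv]
    simp only [blend]
    ring

theorem smoothTransition_mem (τ : ℝ) : Real.smoothTransition τ ∈ Icc (0 : ℝ) 1 :=
  ⟨Real.smoothTransition.nonneg τ, Real.smoothTransition.le_one τ⟩

theorem contDiff_transition : ContDiff ℝ ∞ fun q : ℝ × ℝ => Real.smoothTransition q.1 :=
  Real.smoothTransition.contDiff.comp contDiff_fst

theorem contDiff_blend_pair {f g : ℝ → ℝ} (hf : ContDiff ℝ ∞ f) (hg : ContDiff ℝ ∞ g) :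
    ContDiff ℝ ∞ fun q : ℝ × ℝ => blend (Real.smoothTransition q.1) f g q.2 :=
  ((contDiff_const.sub contDiff_transition).mul (hf.comp contDiff_snd)).add
    (contDiff_transition.mul (hg.comp contDiff_snd))

theorem legendrianIsotopic {ε : ℝ} (hκ : ∀ p ∈ cusps K.front, ∀ t, Δ.κ ε p t ≤ 1) :
    LegendrianIsotopic K (Δ.knot hκ (θ := 1) ⟨zero_le_one, le_rfl⟩) := by
  have hE : ContDiff ℝ ∞ fun q : ℝ × ℝ =>
      Real.exp (Real.smoothTransition q.1 / ε * K.x q.2) :=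
    ((contDiff_transition.div_const ε).mul (K.smooth_x.comp contDiff_snd)).exp
  have hZ := contDiff_blend_pair K.smooth_z (Δ.contDiff_Z ε)
  have hY := contDiff_blend_pair K.smooth_y (Δ.contDiff_Y ε)
  refine ⟨fun τ => Δ.knot hκ (smoothTransition_mem τ), K.smooth_x.comp contDiff_snd,
    hE.mul (hY.add ((contDiff_transition.div_const ε).mul hZ)), hE.mul hZ, ?_, ?_⟩
  · ext t <;> simp [knot, Real.smoothTransition.zero, blend_zero]
  · ext t <;> simp [knot, Real.smoothTransition.one]

end Deformation

end FrontBoxes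

/-! ### Resolutions -/

theorem IsResolution.exists_height {K : LegendrianKnot} (hK : K.HasGenericFront) {D : KnotDiagram}
    (h : IsResolution K.front D) : ∃ (B : FrontBoxes K) (w : ℝ → ℝ), B.IsResolutionHeight w ∧
      ∀ t, D.curve t = (K.x t, w t) := by
  obtain ⟨hx, ⟨a, b, u, v, h1, h2, h3, h4, h5, h6⟩, -⟩ := h
  have hc : ∀ t, D.curve t = (K.x t, (D.curve t).2) := fun t => Prod.ext (hx t) rfl
  have hw : ContDiff ℝ ∞ fun t => (D.curve t).2 := D.generic.smooth.snd
  have hd : ∀ t, deriv D.curve t = (deriv K.x t, deriv (fun t => (D.curve t).2) t) := fun t => by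
    have := (hasDerivAt_prodMk K.smooth_x hw t).deriv
    rwa [← funext hc] at this
  refine ⟨⟨hK, a, b, u, v, h1, h2⟩, fun t => (D.curve t).2, ⟨hw, fun t => ?_, fun t h0 h0' => ?_,
    fun t ht => ?_, fun p hp t ht => ?_, fun p hp hl s hs t ht hst hst' => ?_,
    fun p hp hr => ?_, fun s t hst hx' hw' => ?_⟩, hc⟩
  · simp only [D.generic.periodic t]
  · exact D.generic.immersed t (by rw [hd t]; exact Prod.ext h0 h0')
  · exact (Prod.ext_iff.1 (h3 t ht)).2
  · exact ⟨(h4 p hp ht).1.2, (h4 p hp ht).2.2⟩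
  · exact h5 p hp hl hs ht (by rw [hc s, hc t]; exact Prod.ext hst hst')
  · obtain ⟨s₀, hs₀, t₀, ht₀, e, huniq⟩ := h6 p hp hr
    have e' := e
    rw [hc s₀, hc t₀] at e'
    exact ⟨s₀, hs₀, t₀, ht₀, (Prod.ext_iff.1 e').1, (Prod.ext_iff.1 e').2,
      fun s hs t ht hlt k1 k2 => huniq s hs t ht hlt (by rw [hc s, hc t]; exact Prod.ext k1 k2)⟩
  · have := D.generic.transverse s t hst (by rw [hc s, hc t]; exact Prod.ext hx' hw')
    rwa [hd s, hd t] at this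

/-- Every resolution is isotopic to the Lagrangian projection of a Legendrian knot isotopic to the
given one. -/
theorem IsResolution.exists_knot {K : LegendrianKnot} (hK : K.HasGenericFront) {D : KnotDiagram}
    (h : IsResolution K.front D) : ∃ (K' : LegendrianKnot) (D' : KnotDiagram),
      LegendrianIsotopic K K' ∧ K'.IsLagrangianProjection D' ∧ PlanarIsotopic D D' := by
  obtain ⟨B, w, hw, hc⟩ := h.exists_height hK
  obtain ⟨Δ⟩ := hw.nonempty_deformation
  obtain ⟨ε, hε⟩ := Δ.exists_isSmall hw
  have hε0 := hε.pos
  have himm : ∀ t, deriv K.x t = 0 → 0 < deriv w t * deriv (Δ.W ε) t := by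
    intro t ht
    obtain ⟨k, hk, hkY⟩ := Δ.hasDerivAt_Y_cusp ht ε
    have h1 : deriv (Δ.W ε) t = ε * (k * deriv K.y t) := by
      have := ((Δ.hasDerivAt_Z ε t).add (((Δ.contDiff_Y ε).hasDerivAt_top t).const_mul ε)).deriv
      rw [ht, mul_zero, zero_add, hkY] at this
      exact this
    obtain ⟨p, hp, hn⟩ := B.generic.exists_cusp ht
    have h2 := hw.deriv_mul_pos hp
    rw [h1, hn.apply_eq hw.periodic.deriv_one, hn.apply_eq K.periodic_y.deriv_one]
    have := mul_pos (mul_pos hε0 hk) h2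
    linarith
  set f : ℝ → ℝ → ℝ := fun θ ξ => (1 - θ + θ / ε) * Real.exp (θ / ε * ξ) with hf
  set C : ℝ → ℝ → ℝ × ℝ := fun τ t => (K.x t, f (Real.smoothTransition τ) (K.x t) *
    blend (Real.smoothTransition τ) w (Δ.W ε) t) with hC
  have hfpos : ∀ θ ∈ Icc (0 : ℝ) 1, ∀ ξ, 0 < f θ ξ := by
    intro θ hθ ξ
    refine mul_pos ?_ (Real.exp_pos _)
    have h0 := convex_comb_ne_zero hθ (a := 1) (b := 1 / ε) (by positivity)
    have h1 : (0 : ℝ) ≤ 1 - θ := sub_nonneg.2 hθ.2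
    have h2 : 0 ≤ θ / ε := div_nonneg hθ.1 hε0.le
    refine lt_of_le_of_ne (by linarith) fun h3 => h0 ?_
    rw [mul_one, mul_one_div]
    exact h3.symm
  have hgen : ∀ τ, IsGenericClosedCurve (C τ) := fun τ => by
    have hθ := FrontBoxes.Deformation.smoothTransition_mem τ
    exact IsGenericClosedCurve.rescale K.smooth_x (hw.smooth.blend (Δ.contDiff_W ε) _)
      (hε.isGeneric hw hθ himm) (f := f (Real.smoothTransition τ))
      (contDiff_const.mul (contDiff_const.mul contDiff_id).exp) (hfpos _ hθ)
  have hC1 : ∀ t, C 1 t = (K.x t, Real.exp (1 / ε * K.x t) * (Δ.Y ε t + 1 / ε * Δ.Z ε t)) := by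
    intro t
    simp only [hC, hf, Real.smoothTransition.one, blend_one, FrontBoxes.Deformation.W]
    congr 1
    field_simp
    ring
  have hCx : ∀ τ s t, C τ s = C τ t → K.x s = K.x t ∧ blend (Real.smoothTransition τ) w (Δ.W ε) s =
      blend (Real.smoothTransition τ) w (Δ.W ε) t := by
    intro τ s t hst
    obtain ⟨h1, h2⟩ := Prod.ext_iff.1 hst
    simp only [hC] at h1 h2
    rw [h1] at h2
    exact ⟨h1, mul_left_cancel₀
      (hfpos _ (FrontBoxes.Deformation.smoothTransition_mem τ) _).ne' h2⟩
  set K' := Δ.knot hε.κ_le_one (θ := 1) ⟨zero_le_one, le_rfl⟩ with hK'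
  have hK'x : K'.x = K.x := rfl
  have hK'y : ∀ t, K'.y t = Real.exp (1 / ε * K.x t) * (Δ.Y ε t + 1 / ε * Δ.Z ε t) := fun t => by
    simp only [hK', FrontBoxes.Deformation.knot, blend_one]
  have hK'z : ∀ t, K'.z t = Real.exp (1 / ε * K.x t) * Δ.Z ε t := fun t => by
    simp only [hK', FrontBoxes.Deformation.knot, blend_one]
  have hC1' : ∀ t, C 1 t = (K'.x t, K'.y t) := fun t => by rw [hC1, hK'x, hK'y]
  let D' : KnotDiagram :=
    { curve := C 1
      generic := hgen 1
      isOver := fun s t => K'.z t < K'.z s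
      isOver_congr := fun s s' t t' hs ht => by
        rw [hs.apply_eq K'.periodic_z, ht.apply_eq K'.periodic_z]
      isOver_iff_not := fun s t hst he => by
        rw [not_lt]
        refine ⟨le_of_lt, fun hle => lt_of_le_of_ne hle fun hz => hst ?_⟩
        rw [hC1', hC1'] at he
        exact K'.embedded s t (Prod.ext_iff.1 he).1 (Prod.ext_iff.1 he).2 hz.symm }
  refine ⟨K', D', Δ.legendrianIsotopic hε.κ_le_one, ⟨hC1', fun s t _ _ => Iff.rfl⟩, C, ?_, hgen, ?_,
    rfl, ?_⟩
  · have h1 := FrontBoxes.Deformation.contDiff_transition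
    have hx2 : ContDiff ℝ ∞ fun q : ℝ × ℝ => K.x q.2 := K.smooth_x.comp contDiff_snd
    have hE : ContDiff ℝ ∞ fun q : ℝ × ℝ =>
        Real.exp (Real.smoothTransition q.1 / ε * K.x q.2) := ((h1.div_const ε).mul hx2).exp
    exact hx2.prodMk ((((contDiff_const.sub h1).add (h1.div_const ε)).mul hE).mul
      (FrontBoxes.Deformation.contDiff_blend_pair hw.smooth (Δ.contDiff_W ε)))
  · funext t
    rw [hc t]
    simp [hC, hf, Real.smoothTransition.zero, blend_zero]
  · intro σ ρ hσ hρ hpath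
    have hgood : ∀ τ ∈ Icc (0 : ℝ) 1, deriv K.x (σ τ) ≠ 0 ∧ deriv K.x (ρ τ) ≠ 0 ∧
        0 < (deriv w (σ τ) / deriv K.x (σ τ) - deriv w (ρ τ) / deriv K.x (ρ τ)) *
          (Δ.Y ε (σ τ) - Δ.Y ε (ρ τ)) := by
      intro τ hτ
      obtain ⟨hns, he⟩ := hpath τ hτ
      obtain ⟨e1, e2⟩ := hCx τ _ _ he
      rcases hε.good _ _ hns e1 with h | ⟨h3, h4, -, h5, -⟩
      · refine absurd ?_ (convex_comb_ne_zero
          (FrontBoxes.Deformation.smoothTransition_mem τ) h)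
        simp only [blend] at e2
        linarith
      · exact ⟨h3, h4, h5⟩
    set S : ℝ → ℝ := fun τ =>
      deriv w (σ τ) / deriv K.x (σ τ) - deriv w (ρ τ) / deriv K.x (ρ τ) with hS
    have hx' := K.smooth_x.continuous_deriv_top
    have hw' := hw.smooth.continuous_deriv_top
    have hScont : ContinuousOn S (Icc 0 1) :=
      ((hw'.comp_continuousOn hσ).div (hx'.comp_continuousOn hσ) fun τ hτ => (hgood τ hτ).1).sub
        ((hw'.comp_continuousOn hρ).div (hx'.comp_continuousOn hρ) fun τ hτ => (hgood τ hτ).2.1)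
    have hSne : ∀ τ ∈ Icc (0 : ℝ) 1, S τ ≠ 0 := fun τ hτ h0 => by
      have := (hgood τ hτ).2.2
      simp only [hS] at h0
      rw [h0, zero_mul] at this
      exact lt_irrefl _ this
    have hsign : S 0 < 0 ↔ S 1 < 0 := by
      constructor
      · intro h0
        by_contra! h1
        obtain ⟨τ, hτ, hτ0⟩ := intermediate_value_Icc zero_le_one hScont ⟨h0.le, h1⟩
        exact hSne τ hτ hτ0
      · intro h1
        by_contra! h0
        obtain ⟨τ, hτ, hτ0⟩ := intermediate_value_Icc' zero_le_one hScont ⟨h1.le, h0⟩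
        exact hSne τ hτ hτ0
    have m0 : (0 : ℝ) ∈ Icc (0 : ℝ) 1 := ⟨le_rfl, zero_le_one⟩
    have m1 : (1 : ℝ) ∈ Icc (0 : ℝ) 1 := ⟨zero_le_one, le_rfl⟩
    have hslope : ∀ t, D.slope t = deriv w t / deriv K.x t := fun t => by
      have h1 : D.curve = fun t => (K.x t, w t) := funext hc
      rw [KnotDiagram.slope, h1, (hasDerivAt_prodMk K.smooth_x hw.smooth t).deriv]
    have hD : D.isOver (σ 0) (ρ 0) ↔ S 0 < 0 := by
      obtain ⟨hns, he⟩ := hpath 0 m0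
      obtain ⟨e1, e2⟩ := hCx 0 _ _ he
      rw [Real.smoothTransition.zero, blend_zero] at e2
      rw [h.2.2 _ _ hns (by rw [hc, hc, e1, e2]), hslope, hslope]
      exact sub_neg.symm
    have hD' : D'.isOver (σ 1) (ρ 1) ↔ S 1 < 0 := by
      obtain ⟨hns, he⟩ := hpath 1 m1
      obtain ⟨e1, e2⟩ := hCx 1 _ _ he
      rw [Real.smoothTransition.one, blend_one] at e2
      simp only [FrontBoxes.Deformation.W] at e2
      have hprod := (hgood 1 m1).2.2
      change K'.z (ρ 1) < K'.z (σ 1) ↔ _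
      rw [hK'z, hK'z, e1, mul_lt_mul_iff_right₀ (Real.exp_pos _)]
      change 0 < S 1 * _ at hprod
      constructor
      · intro hlt
        have h1 : Δ.Y ε (σ 1) - Δ.Y ε (ρ 1) < 0 := by
          by_contra! hcon
          have := mul_nonneg hε0.le hcon
          linarith
        by_contra! hcon
        exact absurd hprod (not_lt.2 (mul_nonpos_of_nonneg_of_nonpos hcon h1.le))
      · intro hlt
        have h1 : Δ.Y ε (σ 1) - Δ.Y ε (ρ 1) < 0 := by
          by_contra! hcon
          exact absurd hprod (not_lt.2 (mul_nonpos_of_nonpos_of_nonneg hlt.le hcon))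
        have := mul_neg_of_pos_of_neg hε0 h1
        linarith
    rw [hD, hD', hsign]

/-! ### Boxes around the cusps -/

/-- A cusp has arbitrarily small boxes around it, in which the slope is monotone and which leave
some vertical room around the front. -/
theorem LegendrianKnot.HasGenericFront.exists_isCuspBox {K : LegendrianKnot}
    (hK : K.HasGenericFront) {p : ℝ} (hp : p ∈ cusps K.front) {U : Set (ℝ × ℝ)}
    (hU : U ∈ 𝓝 (K.front p)) :
    ∃ (a b : ℝ) (u v : ℝ × ℝ), IsCuspBox K.front p a b u v ∧ Icc u v ⊆ U ∧
      (∀ s ∈ Ico a p, ∀ t ∈ Ioc p b, 0 < deriv K.y p * (K.y t - K.y s)) ∧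
      ∃ r > 0, (∀ t ∈ Icc a b, |K.z t - K.z p| < r) ∧
        ∀ ζ, |ζ - K.z p| ≤ r → ζ ∈ Icc u.2 v.2 := by
  have hx0 := LegendrianKnot.deriv_x_of_mem_cusps hp
  have hy0 := K.deriv_y_ne_zero hx0
  obtain ⟨e, he, hl, hr⟩ : ∃ e : ℝ, (e = 1 ∨ e = -1) ∧ (∀ᶠ t in 𝓝[<] p, e * deriv K.x t < 0) ∧
      ∀ᶠ t in 𝓝[>] p, 0 < e * deriv K.x t := by
    rcases hp.2 with h | h
    · exact ⟨1, Or.inl rfl, h.2.1.mono fun t (ht : deriv K.x t < 0) => by linarith,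
        h.2.2.mono fun t (ht : 0 < deriv K.x t) => by linarith⟩
    · exact ⟨-1, Or.inr rfl, h.2.1.mono fun t (ht : 0 < deriv K.x t) => by linarith,
        h.2.2.mono fun t (ht : deriv K.x t < 0) => by linarith⟩
  have hbr := eventually_branch_order K.smooth_x K.smooth_y K.smooth_z K.legendrian hy0 hl hr
  obtain ⟨A, hA, A', hA', hAA⟩ := mem_prod_iff.1 ((eventually_sub_pos K.smooth_y hy0).and hbr)
  obtain ⟨η, hη, hη'⟩ := Metric.nhds_basis_closedBall.mem_iff.1 (inter_mem (inter_mem hA hA')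
    (inter_mem (eventually_nhdsWithin_iff.1 hl) (eventually_nhdsWithin_iff.1 hr)))
  rw [Real.closedBall_eq_Icc] at hη'
  have hpair : ∀ s ∈ Icc (p - η) (p + η), ∀ t ∈ Icc (p - η) (p + η), s < p → p < t →
      0 < deriv K.y p * (K.y t - K.y s) ∧ (K.x s = K.x t → K.z s ≠ K.z t) := by
    intro s hs t ht h1 h2
    have h := hAA (show (s, t) ∈ A ×ˢ A' from ⟨(hη' hs).1.1, (hη' ht).1.2⟩)
    refine ⟨h.1 (h1.trans h2), fun hx hz => ?_⟩
    have := h.2 h1 h2 hx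
    simp [hz] at this
  have hX : Continuous fun t => e * K.x t := continuous_const.mul K.smooth_x.continuous
  have hanti : StrictAntiOn (fun t => e * K.x t) (Icc (p - η) p) := by
    refine strictAntiOn_of_deriv_neg (convex_Icc _ _) hX.continuousOn fun t ht => ?_
    rw [interior_Icc] at ht
    rw [deriv_const_mul_field]
    exact (hη' ⟨ht.1.le, by linarith [ht.2]⟩).2.1 ht.2
  have hmono : StrictMonoOn (fun t => e * K.x t) (Icc p (p + η)) := by
    refine strictMonoOn_of_deriv_pos (convex_Icc _ _) hX.continuousOn fun t ht => ?_
    rw [interior_Icc] at ht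
    rw [deriv_const_mul_field]
    exact (hη' ⟨by linarith [ht.1], ht.2.le⟩).2.2 ht.1
  have hW : U ∩ (K.front '' Icc (p + η) (p + 1 - η))ᶜ ∈ 𝓝 (K.front p) := by
    refine inter_mem hU ((isCompact_Icc.image K.continuous_front).isClosed.isOpen_compl.mem_nhds ?_)
    rintro ⟨t, ht, hpt⟩
    obtain ⟨n, hn⟩ := hK.crossing_regular p t hx0 hpt.symm
    have h1 : (-1 : ℝ) < n := by linarith [ht.2]
    have h2 : (n : ℝ) < 0 := by linarith [ht.1]
    norm_cast at h1 h2
    omega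
  obtain ⟨r, hr0, hrW⟩ := Metric.nhds_basis_closedBall.mem_iff.1 hW
  obtain ⟨δ, hδ, hδ'⟩ := Metric.nhds_basis_closedBall.mem_iff.1
    (K.smooth_z.continuous.continuousAt.preimage_mem_nhds (Metric.ball_mem_nhds (K.z p) hr0))
  rw [Real.closedBall_eq_Icc] at hδ'
  obtain ⟨ρ, hρ, hρη, hρδ⟩ : ∃ ρ > 0, ρ ≤ η ∧ ρ ≤ δ :=
    ⟨min η δ, lt_min hη hδ, min_le_left _ _, min_le_right _ _⟩
  have hA1 : e * K.x p < e * K.x (p - ρ) :=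
    hanti ⟨by linarith, by linarith⟩ ⟨by linarith, le_rfl⟩ (by linarith)
  have hB1 : e * K.x p < e * K.x (p + ρ) :=
    hmono ⟨le_rfl, by linarith⟩ ⟨by linarith, by linarith⟩ (by linarith)
  obtain ⟨d, hd, hdr, hda, hdb⟩ : ∃ d > 0, d ≤ r ∧ e * K.x p + d ≤ e * K.x (p - ρ) ∧
      e * K.x p + d ≤ e * K.x (p + ρ) := by
    refine ⟨min r (min (e * K.x (p - ρ) - e * K.x p) (e * K.x (p + ρ) - e * K.x p)),
      lt_min hr0 (lt_min (by linarith) (by linarith)), min_le_left _ _, ?_, ?_⟩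
    · linarith [(min_le_right r _).trans (min_le_left (e * K.x (p - ρ) - e * K.x p)
        (e * K.x (p + ρ) - e * K.x p))]
    · linarith [(min_le_right r _).trans (min_le_right (e * K.x (p - ρ) - e * K.x p)
        (e * K.x (p + ρ) - e * K.x p))]
  obtain ⟨a, ha, hax⟩ := intermediate_value_Icc' (by linarith : p - ρ ≤ p) hX.continuousOn
    (show e * K.x p + d ∈ Icc (e * K.x p) (e * K.x (p - ρ)) from ⟨by linarith, hda⟩)
  obtain ⟨b, hb, hbx⟩ := intermediate_value_Icc (by linarith : p ≤ p + ρ) hX.continuousOn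
    (show e * K.x p + d ∈ Icc (e * K.x p) (e * K.x (p + ρ)) from ⟨by linarith, hdb⟩)
  simp only at hax hbx
  have hap : a < p := lt_of_le_of_ne ha.2 fun h => by rw [h] at hax; linarith
  have hpb : p < b := lt_of_le_of_ne hb.1 fun h => by rw [← h] at hbx; linarith
  have hzr : ∀ t ∈ Icc a b, |K.z t - K.z p| < r := fun t ht =>
    hδ' (show t ∈ Icc (p - δ) (p + δ) from ⟨by linarith [ha.1, ht.1], by linarith [hb.2, ht.2]⟩)
  have hxe : ∀ t, |K.x t - K.x p| = |e * K.x t - e * K.x p| := fun t => by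
    rw [← mul_sub, abs_mul]
    rcases he with rfl | rfl <;> simp
  have hbox : Icc (K.x p - d, K.z p - r) (K.x p + d, K.z p + r) ⊆ Metric.closedBall (K.front p) r := by
    rintro ⟨ξ, ζ⟩ h
    rw [← closedBall_prod_same, Real.closedBall_eq_Icc, Real.closedBall_eq_Icc]
    have h1 : K.x p - d ≤ ξ := h.1.1
    have h2 : ξ ≤ K.x p + d := h.2.1
    exact ⟨⟨show K.x p - r ≤ ξ by linarith, show ξ ≤ K.x p + r by linarith⟩, h.1.2, h.2.2⟩
  refine ⟨a, b, (K.x p - d, K.z p - r), (K.x p + d, K.z p + r), ⟨hap, hpb, fun t => ⟨fun h => ?_, ?_⟩, ?_⟩,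
    fun q hq => (hrW (hbox hq)).1, fun s hs t ht => ?_, r, hr0, hzr, fun ζ hζ => ?_⟩
  · refine ⟨-⌊t - (p - η)⌋, ?_⟩
    set τ : ℝ := t + ((-⌊t - (p - η)⌋ : ℤ) : ℝ) with hτ
    have hF : K.front t = K.front τ := (K.periodic_front.add_int t _).symm
    have h1 : p - η ≤ τ := by
      have := Int.floor_le (t - (p - η)); push_cast at hτ; linarith
    have h2 : τ < p - η + 1 := by
      have := Int.lt_floor_add_one (t - (p - η)); push_cast at hτ; linarith
    have h3 : τ < p + η := by
      by_contra! hcon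
      refine (hrW (hbox h)).2 ⟨τ, ⟨hcon, by linarith⟩, hF.symm⟩
    rw [hF] at h
    have k1 : K.x p - d ≤ K.x τ := h.1.1
    have k2 : K.x τ ≤ K.x p + d := h.2.1
    have h4 : |K.x τ - K.x p| ≤ d := abs_le.2 ⟨by linarith, by linarith⟩
    rw [hxe] at h4
    have h5 := (abs_le.1 h4).2
    constructor
    · by_contra! hcon
      have := hanti ⟨h1, (hcon.trans hap).le⟩ ⟨by linarith [ha.1], ha.2⟩ hcon
      simp only at this
      linarith
    · by_contra! hcon
      have := hmono ⟨hb.1, by linarith [hb.2]⟩ ⟨(hpb.trans hcon).le, h3.le⟩ hcon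
      simp only at this
      linarith
  · rintro ⟨n, hn⟩
    rw [← K.periodic_front.add_int t n]
    generalize t + (n : ℝ) = τ at hn
    have h1 := abs_lt.1 (hzr τ hn)
    have h2 : |K.x τ - K.x p| ≤ d := by
      rw [hxe, abs_le]
      rcases le_total τ p with h | h
      · have k1 := hanti.antitoneOn ⟨by linarith [ha.1, hn.1], h⟩ ⟨by linarith, le_rfl⟩ h
        have k2 := hanti.antitoneOn ⟨by linarith [ha.1], ha.2⟩ ⟨by linarith [ha.1, hn.1], h⟩ hn.1
        exact ⟨by linarith, by linarith⟩
      · have k1 := hmono.monotoneOn ⟨le_rfl, by linarith⟩ ⟨h, by linarith [hb.2, hn.2]⟩ h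
        have k2 := hmono.monotoneOn ⟨h, by linarith [hb.2, hn.2]⟩ ⟨hb.1, by linarith [hb.2]⟩ hn.2
        exact ⟨by linarith, by linarith⟩
    have h3 := abs_le.1 h2
    exact ⟨⟨by simp only [front]; linarith, by simp only [front]; linarith⟩,
      ⟨by simp only [front]; linarith, by simp only [front]; linarith⟩⟩
  · have key : ∀ s ∈ Icc a b, ∀ t ∈ Icc a b, s < t → K.front s ≠ K.front t := by
      intro s hs t ht hst h
      obtain ⟨h1, h2⟩ := Prod.ext_iff.1 h
      simp only [front] at h1 h2
      have hs' : s ∈ Icc (p - η) (p + η) :=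
        ⟨by linarith [ha.1, hs.1], by linarith [hb.2, hs.2]⟩
      have ht' : t ∈ Icc (p - η) (p + η) :=
        ⟨by linarith [ha.1, ht.1], by linarith [hb.2, ht.2]⟩
      have hxe : e * K.x s = e * K.x t := by rw [h1]
      rcases le_or_gt t p with htp | htp
      · exact (hanti ⟨hs'.1, hst.le.trans htp⟩ ⟨ht'.1, htp⟩ hst).ne hxe.symm
      · rcases lt_or_ge s p with hsp | hsp
        · exact (hpair s hs' t ht' hsp htp).2 h1 h2
        · exact (hmono ⟨hsp, hs'.2⟩ ⟨htp.le, ht'.2⟩ hst).ne hxe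
    intro s hs t ht h
    rcases lt_trichotomy s t with hst | hst | hst
    · exact absurd h (key s hs t ht hst)
    · exact hst
    · exact absurd h.symm (key t ht s hs hst)
  · exact (hpair s ⟨by linarith [ha.1, hs.1], by linarith [hs.2]⟩ t
      ⟨by linarith [ht.1], by linarith [hb.2, ht.2]⟩ hs.2 ht.1).1
  · have := abs_le.1 hζ
    exact ⟨by simp only; linarith, by simp only; linarith⟩

/-- Boxes in which the slope is monotone and which leave some vertical room around the front. -/
structure FrontBoxes.IsTame {K : LegendrianKnot} (B : FrontBoxes K) (r : ℝ → ℝ) : Prop where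
  slope : ∀ p ∈ cusps K.front, ∀ s ∈ Ico (B.a p) p, ∀ t ∈ Ioc p (B.b p),
    0 < deriv K.y p * (K.y t - K.y s)
  z_lt : ∀ p ∈ cusps K.front, ∀ t ∈ Icc (B.a p) (B.b p), |K.z t - K.z p| < r p
  mem_of_le : ∀ p ∈ cusps K.front, ∀ ζ, |ζ - K.z p| ≤ r p → ζ ∈ Icc (B.u p).2 (B.v p).2

theorem LegendrianKnot.HasGenericFront.exists_isTame {K : LegendrianKnot}
    (hK : K.HasGenericFront) : ∃ (B : FrontBoxes K) (r : ℝ → ℝ), B.IsTame r := by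
  obtain ⟨U, hU, hdisj⟩ := (hK.finite_cusps.image K.front).t2_separation
  have h : ∀ p, ∃ (a b : ℝ) (u v : ℝ × ℝ) (r : ℝ), p ∈ cusps K.front →
      IsCuspBox K.front p a b u v ∧ Icc u v ⊆ U (K.front p) ∧
      (∀ s ∈ Ico a p, ∀ t ∈ Ioc p b, 0 < deriv K.y p * (K.y t - K.y s)) ∧
      (∀ t ∈ Icc a b, |K.z t - K.z p| < r) ∧
        ∀ ζ, |ζ - K.z p| ≤ r → ζ ∈ Icc u.2 v.2 := by
    intro p
    by_cases hp : p ∈ cusps K.front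
    · obtain ⟨a, b, u, v, h1, h2, h3, r, -, h4, h5⟩ :=
        hK.exists_isCuspBox hp ((hU (K.front p)).2.mem_nhds (hU _).1)
      exact ⟨a, b, u, v, r, fun _ => ⟨h1, h2, h3, h4, h5⟩⟩
    · exact ⟨0, 0, 0, 0, 0, fun h => absurd h hp⟩
  choose a b u v r h using h
  refine ⟨⟨hK, a, b, u, v, fun p hp => (h p hp).1, fun p hp q hq hpq => ?_⟩, r,
    fun p hp => (h p hp).2.2.1, fun p hp => (h p hp).2.2.2.1, fun p hp => (h p hp).2.2.2.2⟩
  refine (hdisj (mem_image_of_mem _ hp) (mem_image_of_mem _ hq) fun hF => hpq ?_).mono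
    (h p hp).2.1 (h q hq).2.1
  obtain ⟨n, hn⟩ := hK.crossing_regular p q (LegendrianKnot.deriv_x_of_mem_cusps hp) hF
  have h1 : (-1 : ℝ) < n := by linarith [hp.1.1, hq.1.2]
  have h2 : (n : ℝ) < 1 := by linarith [hp.1.2, hq.1.1]
  norm_cast at h1 h2
  obtain rfl : n = 0 := by omega
  simpa using hn

namespace FrontBoxes

variable {K : LegendrianKnot} {B : FrontBoxes K}

/-! ### Construction of a resolution -/

/-- Coefficients `α`, `γ`, functions of the horizontal coordinate, such that the arc at height
`α (z - z p) + γ (y - y p)` above the cusp `p` resolves the cusp in a box of height `2 r`. -/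
structure IsProfile (B : FrontBoxes K) (r p : ℝ) (α γ : ℝ → ℝ) : Prop where
  smooth_α : ContDiff ℝ ∞ α
  smooth_γ : ContDiff ℝ ∞ γ
  left : ∀ᶠ ξ in 𝓝 (K.x (B.a p)), α ξ = 1 ∧ γ ξ = 0
  right : ∀ᶠ ξ in 𝓝 (K.x (B.b p)), α ξ = 1 ∧ γ ξ = 0
  nonneg : ∀ ξ, 0 ≤ γ ξ
  pos : 0 < γ (K.x p)
  small : ∀ t ∈ Icc (B.a p) (B.b p),
    |α (K.x t) * (K.z t - K.z p) + γ (K.x t) * (K.y t - K.y p)| ≤ r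
  eq_one : IsLeftCusp K.front p → ∀ ξ, α ξ = 1
  crossing : IsRightCusp K.front p → ∃ m, K.x (B.a p) < m ∧ K.x (B.b p) < m ∧ m < K.x p ∧
    (∀ ξ < m, 0 < α ξ) ∧ (∀ ξ ≤ m, γ ξ = 0) ∧ (∀ᶠ ξ in 𝓝 m, α ξ = m - ξ ∧ γ ξ = 0) ∧
    ∀ ξ > m, α ξ < 0

/-- A cutoff function of the horizontal coordinate that is positive next to the cusp. -/
theorem exists_cutoff (e c δ : ℝ) (hδ : 0 < δ) : ∃ γ : ℝ → ℝ, ContDiff ℝ ∞ γ ∧ (∀ ξ, 0 ≤ γ ξ) ∧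
    (∀ ξ, γ ξ ≤ δ) ∧ (∀ ξ, e * ξ < c → 0 < γ ξ) ∧ ∀ ξ, c ≤ e * ξ → γ ξ = 0 := by
  refine ⟨fun ξ => δ * Real.smoothTransition (c - e * ξ), ?_, fun ξ => ?_, fun ξ => ?_,
    fun ξ h => ?_, fun ξ h => ?_⟩
  · exact contDiff_const.mul (Real.smoothTransition.contDiff.comp
      (contDiff_const.sub (contDiff_const.mul contDiff_id)))
  · exact mul_nonneg hδ.le (Real.smoothTransition.nonneg _)
  · exact mul_le_of_le_one_right hδ.le (Real.smoothTransition.le_one _)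
  · exact mul_pos hδ (Real.smoothTransition.pos_of_pos (by linarith))
  · simp only [Real.smoothTransition.zero_of_nonpos (show c - e * ξ ≤ 0 by linarith), mul_zero]

theorem IsTame.exists_isProfile {r : ℝ → ℝ} (hB : B.IsTame r) {p : ℝ} (hp : p ∈ cusps K.front) :
    ∃ α γ, B.IsProfile (r p) p α γ := by
  obtain ⟨e, he⟩ := B.exists_isCuspSign hp
  have hne : (Icc (B.a p) (B.b p)).Nonempty := ⟨p, B.self_mem hp⟩
  have hzc : Continuous fun t => |K.z t - K.z p| := by
    have := K.smooth_z.continuous; fun_prop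
  have hyc : Continuous fun t => |K.y t - K.y p| := by
    have := K.smooth_y.continuous; fun_prop
  obtain ⟨τ, hτ, hτz⟩ := isCompact_Icc.exists_isMaxOn hne hzc.continuousOn
  obtain ⟨σ, hσ, hσy⟩ := isCompact_Icc.exists_isMaxOn hne hyc.continuousOn
  have hq := hB.z_lt p hp τ hτ
  set M := |K.y σ - K.y p| with hM
  have hM0 : 0 ≤ M := abs_nonneg _
  set δ : ℝ := (r p - |K.z τ - K.z p|) / (M + 1) with hδ
  have hδ0 : 0 < δ := div_pos (by linarith) (by linarith)
  have hsmall : ∀ t ∈ Icc (B.a p) (B.b p), ∀ α γ : ℝ, |α| ≤ 1 → 0 ≤ γ → γ ≤ δ →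
      |α * (K.z t - K.z p) + γ * (K.y t - K.y p)| ≤ r p := by
    intro t ht α γ hα h0 hγ
    have h1 : |α * (K.z t - K.z p)| ≤ 1 * |K.z τ - K.z p| := by
      rw [abs_mul]
      exact mul_le_mul hα (hτz ht) (abs_nonneg _) zero_le_one
    have h2 : |γ * (K.y t - K.y p)| ≤ δ * M := by
      rw [abs_mul, abs_of_nonneg h0]
      exact mul_le_mul hγ (hσy ht) (abs_nonneg _) hδ0.le
    have h3 : δ * (M + 1) = r p - |K.z τ - K.z p| := div_mul_cancel₀ _ (by linarith)
    have h4 := abs_add_le (α * (K.z t - K.z p)) (γ * (K.y t - K.y p))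
    linarith
  have hXa : e * K.x p < e * K.x (B.a p) := he.height_pos hp ⟨le_rfl, B.a_lt hp⟩
  have hXb : e * K.x p < e * K.x (B.b p) :=
    he.mono ⟨le_rfl, (B.lt_b hp).le⟩ ⟨(B.lt_b hp).le, le_rfl⟩ (B.lt_b hp)
  have hzero : ∀ {γ : ℝ → ℝ} {c : ℝ}, (∀ ξ, c ≤ e * ξ → γ ξ = 0) → ∀ ξ, c < e * ξ →
      ∀ᶠ ξ' in 𝓝 ξ, γ ξ' = 0 := fun {γ c} h ξ hξ =>
    ((continuous_const_mul e).continuousAt.eventually (lt_mem_nhds hξ)).mono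
      fun ξ' hξ' => h ξ' (le_of_lt hξ')
  rcases he.cases with ⟨rfl, h⟩ | ⟨rfl, h⟩
  · obtain ⟨c, hc1, hc2⟩ := exists_between (lt_min hXa hXb)
    obtain ⟨γ, g1, g2, g3, g4, g5⟩ := exists_cutoff 1 c δ hδ0
    refine ⟨fun _ => 1, γ, contDiff_const, g1, ?_, ?_, g2, g4 _ hc1, fun t ht => ?_,
      fun _ _ => rfl, fun h' => ?_⟩
    · exact (hzero g5 _ (lt_min_iff.1 hc2).1).mono fun ξ h => ⟨rfl, h⟩
    · exact (hzero g5 _ (lt_min_iff.1 hc2).2).mono fun ξ h => ⟨rfl, h⟩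
    · exact hsmall t ht _ _ (by simp) (g2 _) (g3 _)
    · exact absurd (he.eq_neg_one h') (by norm_num)
  · obtain ⟨m, hm1, hm2⟩ : ∃ m, max (max (K.x (B.a p)) (K.x (B.b p))) (K.x p - 1) < m ∧
        m < K.x p :=
      exists_between (max_lt (max_lt (by linarith) (by linarith)) (by linarith))
    obtain ⟨⟨hma, hmb⟩, hmp⟩ : (K.x (B.a p) < m ∧ K.x (B.b p) < m) ∧ K.x p - 1 < m := by
      simpa only [max_lt_iff] using hm1
    obtain ⟨c, hc1, hc2⟩ := exists_between (max_lt hma hmb)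
    obtain ⟨hca, hcb⟩ := max_lt_iff.1 hc1
    obtain ⟨G, G1, G2, -, -, G5, G6, G7, G8⟩ := exists_ramp c m hc2
    obtain ⟨γ, g1, g2, g3, g4, g5⟩ := exists_cutoff (-1) (-((m + K.x p) / 2)) δ hδ0
    have hG0 : ∀ ξ < c, ∀ᶠ ξ' in 𝓝 ξ, 1 - deriv G ξ' = 1 := fun ξ hξ => by
      filter_upwards [gt_mem_nhds hξ] with ξ' hξ'
      have : G =ᶠ[𝓝 ξ'] fun _ => 0 := by
        filter_upwards [gt_mem_nhds hξ'] with η hη using G2 η (le_of_lt hη)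
      rw [this.deriv_eq, deriv_const, sub_zero]
    refine ⟨fun ξ => 1 - deriv G ξ, γ, contDiff_const.sub (contDiff_infty_iff_deriv.1 G1).2, g1,
      (hG0 _ hca).and (hzero g5 _ (by linarith)), (hG0 _ hcb).and (hzero g5 _ (by linarith)), g2,
      g4 _ (by linarith), fun t ht => ?_, fun h' => ?_, fun _ => ⟨m, hma, hmb, hm2,
      fun ξ hξ => by linarith [G6 ξ hξ], fun ξ hξ => g5 ξ (by linarith),
      ?_, fun ξ hξ => by linarith [G8 ξ (le_of_lt hξ)]⟩⟩
    · refine hsmall t ht _ _ ?_ (g2 _) (g3 _)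
      have hxt : K.x t ≤ K.x p := by
        rcases le_total t p with htp | htp
        · have := he.anti.antitoneOn ⟨ht.1, htp⟩ ⟨(B.a_lt hp).le, le_rfl⟩ htp
          linarith
        · have := he.mono.monotoneOn ⟨le_rfl, (B.lt_b hp).le⟩ ⟨htp, ht.2⟩ htp
          linarith
      rw [abs_le]
      rcases lt_or_ge (K.x t) m with hlt | hge
      · exact ⟨by linarith [G6 _ hlt], by linarith [G5 (K.x t)]⟩
      · have := G8 _ hge
        exact ⟨by linarith, by linarith⟩
    · exact absurd (he.eq_one h') (by norm_num)
    · filter_upwards [G7, hzero g5 m (by linarith)] with ξ h1 h2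
      exact ⟨by rw [h1]; ring, h2⟩

/-- If two points of the curve `(x, w)` agree and one is in a box, so is the other. -/
theorem mem_params_of_eq {w : ℝ → ℝ} (hper : Function.Periodic w 1)
    (heq : ∀ t, (∀ p ∈ cusps K.front, t ∉ B.params p) → w t = K.z t)
    (hmaps : ∀ p ∈ cusps K.front, ∀ t ∈ Icc (B.a p) (B.b p), w t ∈ Icc (B.u p).2 (B.v p).2)
    {p s t : ℝ} (hp : p ∈ cusps K.front) (hs : s ∈ B.params p) (hx : K.x s = K.x t)
    (hw : w s = w t) : t ∈ B.params p := by
  have hm : ∀ q ∈ cusps K.front, ∀ t ∈ B.params q, w t ∈ Icc (B.u q).2 (B.v q).2 := by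
    intro q hq t ht
    obtain ⟨n, hn⟩ := (B.mem_params_iff hq).1 ht
    rw [← hper.add_int t n]
    exact hmaps q hq _ hn
  have h1 := B.mem_Icc_fst hs
  have h2 := hm p hp s hs
  rw [hx] at h1
  rw [hw] at h2
  by_cases ht : ∃ q ∈ cusps K.front, t ∈ B.params q
  · obtain ⟨q, hq, ht⟩ := ht
    by_cases hqp : q = p
    · rwa [← hqp]
    · have h3 := B.mem_Icc_fst ht
      have h4 := hm q hq t ht
      exact (Set.disjoint_left.1 (B.disjoint q hq p hp hqp)
        (show (K.x t, w t) ∈ Icc (B.u q) (B.v q) from ⟨⟨h3.1, h4.1⟩, h3.2, h4.2⟩)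
        (show (K.x t, w t) ∈ Icc (B.u p) (B.v p) from ⟨⟨h1.1, h2.1⟩, h1.2, h2.2⟩)).elim
  · push Not at ht
    rw [heq t ht] at h2
    exact B.mem_params_of_mem h1 h2

theorem IsTame.exists_isResolutionHeight {r : ℝ → ℝ} (hB : B.IsTame r) :
    ∃ w, B.IsResolutionHeight w := by
  have hprof : ∀ p, ∃ α γ, p ∈ cusps K.front → B.IsProfile (r p) p α γ := fun p => by
    by_cases hp : p ∈ cusps K.front
    · obtain ⟨α, γ, h⟩ := hB.exists_isProfile hp
      exact ⟨α, γ, fun _ => h⟩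
    · exact ⟨0, 0, fun h => absurd h hp⟩
  choose α γ hprof using hprof
  set φ : ℝ → ℝ → ℝ := fun p t =>
    (α p (K.x t) - 1) * (K.z t - K.z p) + γ p (K.x t) * (K.y t - K.y p) with hφ
  have hend : ∀ p c, (∀ᶠ ξ in 𝓝 (K.x c), α p ξ = 1 ∧ γ p ξ = 0) → ∀ᶠ t in 𝓝 c, φ p t = 0 := by
    intro p c h
    filter_upwards [K.smooth_x.continuous.continuousAt.eventually h] with t ht
    simp only [hφ, ht.1, ht.2]
    ring
  have harc : B.IsArcFamily φ := by
    refine ⟨fun p hp t => ?_, fun p hp => hend p _ (hprof p hp).left,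
      fun p hp => hend p _ (hprof p hp).right⟩
    simp only [hφ, K.periodic_x t, K.periodic_y t, K.periodic_z t]
  have hφs : ∀ p ∈ cusps K.front, ContDiff ℝ ∞ (φ p) := fun p hp =>
    ((((hprof p hp).smooth_α.comp K.smooth_x).sub contDiff_const).mul
      (K.smooth_z.sub contDiff_const)).add
      (((hprof p hp).smooth_γ.comp K.smooth_x).mul (K.smooth_y.sub contDiff_const))
  set w : ℝ → ℝ := fun t => K.z t + B.glue φ t with hw
  have hws : ContDiff ℝ ∞ w := K.smooth_z.add (harc.contDiff_glue hφs)
  have hwp : Function.Periodic w 1 := fun t => by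
    simp only [hw, K.periodic_z t, harc.periodic_glue t]
  have hwmem : ∀ p ∈ cusps K.front, ∀ t ∈ B.params p, w =ᶠ[𝓝 t] fun t =>
      K.z p + (α p (K.x t) * (K.z t - K.z p) + γ p (K.x t) * (K.y t - K.y p)) := by
    intro p hp t ht
    filter_upwards [harc.glue_of_mem hp ht] with s hs
    simp only [hw]
    rw [hs]
    ring
  have hwout : ∀ t, (∀ p ∈ cusps K.front, t ∉ B.params p) → w =ᶠ[𝓝 t] K.z := by
    intro t ht
    filter_upwards [glue_of_notMem (φ := φ) ht] with s hs
    simp only [hw, hs, Pi.zero_apply, add_zero]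
  have heq : ∀ t, (∀ p ∈ cusps K.front, t ∉ B.params p) → w t = K.z t :=
    fun t ht => (hwout t ht).eq_of_nhds
  have hmaps : ∀ p ∈ cusps K.front, ∀ t ∈ Icc (B.a p) (B.b p),
      w t ∈ Icc (B.u p).2 (B.v p).2 := fun p hp t ht => by
    refine hB.mem_of_le p hp _ ?_
    rw [(hwmem p hp t (B.mem_params hp ht)).eq_of_nhds, add_sub_cancel_left]
    exact (hprof p hp).small t ht
  have hdiff : ∀ p ∈ cusps K.front, ∀ s ∈ Ico (B.a p) p, ∀ t ∈ Ioc p (B.b p), K.x s = K.x t →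
      w t - w s = α p (K.x s) * (K.z t - K.z s) + γ p (K.x s) * (K.y t - K.y s) := by
    intro p hp s hs t ht hx
    have hs' := B.mem_params hp ⟨hs.1, (hs.2.trans (B.lt_b hp)).le⟩
    have ht' := B.mem_params hp ⟨((B.a_lt hp).trans ht.1).le, ht.2⟩
    rw [(hwmem p hp s hs').eq_of_nhds, (hwmem p hp t ht').eq_of_nhds, hx]
    ring
  have hleft : ∀ p ∈ cusps K.front, IsLeftCusp K.front p → ∀ s ∈ Ico (B.a p) p,
      ∀ t ∈ Ioc p (B.b p), K.x s = K.x t → w s ≠ w t := by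
    intro p hp hl s hs t ht hx h
    obtain ⟨e, he⟩ := B.exists_isCuspSign hp
    obtain rfl := he.eq_one hl
    have h1 := hdiff p hp s hs t ht hx
    have h2 := he.z_order hp hs ht hx
    have h3 := mul_nonneg ((hprof p hp).nonneg (K.x s)) (hB.slope p hp s hs t ht).le
    rw [(hprof p hp).eq_one hl, h, sub_self] at h1
    have h4 : deriv K.y p * (1 * (K.z t - K.z s) + γ p (K.x s) * (K.y t - K.y s)) = 0 := by
      rw [← h1, mul_zero]
    linarith
  have hright : ∀ p ∈ cusps K.front, IsRightCusp K.front p → ∃ m, K.x (B.a p) < m ∧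
      K.x (B.b p) < m ∧ m < K.x p ∧ (∀ᶠ ξ in 𝓝 m, α p ξ = m - ξ ∧ γ p ξ = 0) ∧
      ∀ s ∈ Ico (B.a p) p, ∀ t ∈ Ioc p (B.b p), K.x s = K.x t → (w s = w t ↔ K.x s = m) := by
    intro p hp hr
    obtain ⟨e, he⟩ := B.exists_isCuspSign hp
    obtain rfl := he.eq_neg_one hr
    obtain ⟨m, hm1, hm2, hm3, hm4, hm5, hm6, hm7⟩ := (hprof p hp).crossing hr
    refine ⟨m, hm1, hm2, hm3, hm6, fun s hs t ht hx => ?_⟩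
    have h1 := hdiff p hp s hs t ht hx
    have h2 := he.z_order hp hs ht hx
    have h3 := mul_nonneg ((hprof p hp).nonneg (K.x s)) (hB.slope p hp s hs t ht).le
    constructor
    · intro h
      rw [h, sub_self] at h1
      have h4 : α p (K.x s) * (-1 * deriv K.y p * (K.z t - K.z s)) =
          γ p (K.x s) * (deriv K.y p * (K.y t - K.y s)) := by
        linear_combination deriv K.y p * h1
      rcases lt_trichotomy (K.x s) m with hlt | heq | hgt
      · have := mul_pos (hm4 _ hlt) h2
        rw [h4, hm5 _ hlt.le, zero_mul] at this
        exact absurd this (lt_irrefl _)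
      · exact heq
      · have := mul_neg_of_neg_of_pos (hm7 _ hgt) h2
        linarith
    · intro h
      rw [h, hm6.self_of_nhds.1, hm6.self_of_nhds.2] at h1
      linarith
  refine ⟨w, hws, hwp, fun t hx0 => ?_, heq, hmaps, fun p hp hl s hs t ht hx hst => ?_,
    fun p hp hr => ?_, fun s t hst hx hwst => ?_⟩
  · obtain ⟨p, hp, hpt⟩ := B.generic.exists_cusp hx0
    have ht := (B.params_congr hpt).2 (B.mem_params hp (B.self_mem hp))
    have hP := hprof p hp
    have h1 := ((hP.smooth_α.hasDerivAt_top (K.x t)).comp t (K.smooth_x.hasDerivAt_top t)).mul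
      ((K.smooth_z.hasDerivAt_top t).sub_const (K.z p))
    have h2 := ((hP.smooth_γ.hasDerivAt_top (K.x t)).comp t (K.smooth_x.hasDerivAt_top t)).mul
      ((K.smooth_y.hasDerivAt_top t).sub_const (K.y p))
    have h3 : deriv w t = γ p (K.x p) * deriv K.y t := by
      refine ((((h1.add h2).const_add (K.z p)).congr_of_eventuallyEq (hwmem p hp t ht)).congr_deriv
        ?_).deriv
      simp only [Function.comp_apply, hx0, K.legendrian, hpt.apply_eq K.periodic_x]
      ring
    rw [h3]
    exact mul_ne_zero hP.pos.ne' (K.deriv_y_ne_zero hx0)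
  · obtain ⟨e, he⟩ := B.exists_isCuspSign hp
    rcases he.eq_or_branches hp hs ht hx with h | h | h
    · exact h
    · exact absurd hst (hleft p hp hl s h.1 t h.2 hx)
    · exact absurd hst.symm (hleft p hp hl t h.1 s h.2 hx.symm)
  · obtain ⟨m, hm1, hm2, hm3, -, hm4⟩ := hright p hp hr
    obtain ⟨e, he⟩ := B.exists_isCuspSign hp
    obtain rfl := he.eq_neg_one hr
    have hap := B.a_lt hp
    have hpb := B.lt_b hp
    obtain ⟨s₀, hs₀, hs₀x⟩ := intermediate_value_Icc hap.le K.smooth_x.continuous.continuousOn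
      ⟨hm1.le, hm3.le⟩
    obtain ⟨t₀, ht₀, ht₀x⟩ := intermediate_value_Icc' hpb.le K.smooth_x.continuous.continuousOn
      ⟨hm2.le, hm3.le⟩
    have hs1 : B.a p < s₀ := lt_of_le_of_ne hs₀.1 fun h => by rw [h] at hm1; exact hm1.ne hs₀x
    have hs2 : s₀ < p := lt_of_le_of_ne hs₀.2 fun h => by rw [← h] at hm3; exact hm3.ne' hs₀x
    have ht1 : p < t₀ := lt_of_le_of_ne ht₀.1 fun h => by rw [h] at hm3; exact hm3.ne' ht₀x
    have ht2 : t₀ < B.b p := lt_of_le_of_ne ht₀.2 fun h => by rw [← h] at hm2; exact hm2.ne ht₀x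
    have hx₀ : K.x s₀ = K.x t₀ := hs₀x.trans ht₀x.symm
    refine ⟨s₀, ⟨hs1, hs2⟩, t₀, ⟨ht1, ht2⟩, hx₀,
      (hm4 s₀ ⟨hs1.le, hs2⟩ t₀ ⟨ht1, ht2.le⟩ hx₀).2 hs₀x, fun s hs t ht hlt hx hst => ?_⟩
    rcases he.eq_or_branches hp hs ht hx with h | h | h
    · exact absurd h hlt.ne
    · have hxs := (hm4 s h.1 t h.2 hx).1 hst
      constructor
      · refine he.anti.injOn ⟨h.1.1, h.1.2.le⟩ hs₀ ?_
        simp only [hxs, hs₀x]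
      · refine he.mono.injOn ⟨h.2.1.le, h.2.2⟩ ht₀ ?_
        simp only [← hx, hxs, ht₀x]
    · exact absurd (h.1.2.trans h.2.1) (not_lt.2 hlt.le)
  · by_cases hbox : ∃ p ∈ cusps K.front, s ∈ B.params p ∨ t ∈ B.params p
    · obtain ⟨p, hp, hmem⟩ := hbox
      have hboth : s ∈ B.params p ∧ t ∈ B.params p := hmem.elim
        (fun h => ⟨h, mem_params_of_eq hwp heq hmaps hp h hx hwst⟩)
        fun h => ⟨mem_params_of_eq hwp heq hmaps hp h hx.symm hwst.symm, h⟩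
      have main : ∀ s ∈ Ico (B.a p) p, ∀ t ∈ Ioc p (B.b p), K.x s = K.x t → w s = w t →
          deriv K.x s * deriv w t - deriv w s * deriv K.x t ≠ 0 := by
        intro s hs t ht hx hst
        have hs' : s ∈ Icc (B.a p) (B.b p) := ⟨hs.1, (hs.2.trans (B.lt_b hp)).le⟩
        have ht' : t ∈ Icc (B.a p) (B.b p) := ⟨((B.a_lt hp).trans ht.1).le, ht.2⟩
        rcases hp.2 with hl | hr
        · exact absurd hst (hleft p hp hl s hs t ht hx)
        obtain ⟨m, -, -, -, hm, hm4⟩ := hright p hp hr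
        have hxm := (hm4 s hs t ht hx).1 hst
        have hd : ∀ σ ∈ Icc (B.a p) (B.b p), K.x σ = m →
            deriv w σ = -deriv K.x σ * (K.z σ - K.z p) := by
          intro σ hσ hσm
          have h1 : w =ᶠ[𝓝 σ] fun t => K.z p + (m - K.x t) * (K.z t - K.z p) := by
            rw [← hσm] at hm ⊢
            filter_upwards [hwmem p hp σ (B.mem_params hp hσ),
              K.smooth_x.continuous.continuousAt.eventually hm] with τ h1 h2
            rw [h1, h2.1, h2.2]
            ring
          have h2 := (((K.smooth_x.hasDerivAt_top σ).const_sub m).mul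
            ((K.smooth_z.hasDerivAt_top σ).sub_const (K.z p))).const_add (K.z p)
          refine ((h2.congr_of_eventuallyEq h1).congr_deriv ?_).deriv
          rw [hσm]
          ring
        rw [hd s hs' hxm, hd t ht' (hx ▸ hxm)]
        have e1 : deriv K.x s * (-deriv K.x t * (K.z t - K.z p)) -
            -deriv K.x s * (K.z s - K.z p) * deriv K.x t =
            deriv K.x s * deriv K.x t * (K.z s - K.z t) := by ring
        rw [e1]
        exact mul_ne_zero (mul_ne_zero (fun h => hs.2.ne (B.eq_of_deriv_eq_zero hp hs' h))
          fun h => ht.1.ne' (B.eq_of_deriv_eq_zero hp ht' h))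
          (sub_ne_zero.2 (B.z_ne hp hs' ht' hx (hs.2.trans ht.1).ne))
      obtain ⟨m, hm⟩ := (B.mem_params_iff hp).1 hboth.1
      obtain ⟨n, hn⟩ := (B.mem_params_iff hp).1 hboth.2
      obtain ⟨e, he⟩ := B.exists_isCuspSign hp
      have hx' : K.x (s + m) = K.x (t + n) := by rw [K.periodic_x.add_int, K.periodic_x.add_int, hx]
      have hw' : w (s + m) = w (t + n) := by rw [hwp.add_int, hwp.add_int, hwst]
      rw [← K.periodic_x.deriv_one.add_int s m, ← K.periodic_x.deriv_one.add_int t n,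
        ← hwp.deriv_one.add_int s m, ← hwp.deriv_one.add_int t n]
      rcases he.eq_or_branches hp hm hn hx' with h | h | h
      · exact absurd ⟨n - m, by push_cast; linarith⟩ hst
      · exact main _ h.1 _ h.2 hx' hw'
      · intro h0
        exact main _ h.1 _ h.2 hx'.symm hw'.symm (by linear_combination -h0)
    · push Not at hbox
      have hs : ∀ p ∈ cusps K.front, s ∉ B.params p := fun p hp => (hbox p hp).1
      have ht : ∀ p ∈ cusps K.front, t ∉ B.params p := fun p hp => (hbox p hp).2
      rw [(hwout s hs).deriv_eq, (hwout t ht).deriv_eq, K.legendrian, K.legendrian]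
      have e1 : deriv K.x s * (K.y t * deriv K.x t) - K.y s * deriv K.x s * deriv K.x t =
          deriv K.x s * deriv K.x t * (K.y t - K.y s) := by ring
      rw [e1]
      refine mul_ne_zero (mul_ne_zero (B.deriv_x_ne_zero_of_notMem hs)
        (B.deriv_x_ne_zero_of_notMem ht)) (sub_ne_zero.2 fun hy => hst ?_)
      rw [heq s hs, heq t ht] at hwst
      exact K.embedded s t hx hy.symm hwst

/-- The curve `(x, w)` with the strand of smaller slope passing over is a resolution. -/
theorem IsResolutionHeight.exists_isResolution {w : ℝ → ℝ} (hw : B.IsResolutionHeight w) :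
    ∃ D : KnotDiagram, IsResolution K.front D := by
  have hmem : ∀ {p s t : ℝ}, p ∈ cusps K.front → s ∈ B.params p → K.x s = K.x t → w s = w t →
      t ∈ B.params p := fun hp hs hx h =>
    mem_params_of_eq hw.periodic hw.eq_of_notMem hw.maps hp hs hx h
  have hd : ∀ t, deriv (fun t => (K.x t, w t)) t = (deriv K.x t, deriv w t) := fun t =>
    (hasDerivAt_prodMk K.smooth_x hw.smooth t).deriv
  have hreg : ∀ s t, ¬ SameParam s t → K.x s = K.x t → w s = w t → deriv K.x s ≠ 0 := by
    intro s t hst hx hwst h0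
    obtain ⟨p, hp, hps⟩ := B.generic.exists_cusp h0
    have hs := (B.params_congr hps).2 (B.mem_params hp (B.self_mem hp))
    obtain ⟨n, hn⟩ := (B.mem_params_iff hp).1 (hmem hp hs hx hwst)
    obtain ⟨e, he⟩ := B.exists_isCuspSign hp
    rcases he.eq_or_branches hp (B.self_mem hp) hn
      (by rw [K.periodic_x.add_int, ← hx, hps.apply_eq K.periodic_x]) with h | h | h
    · exact hst (hps.trans (h ▸ SameParam.add_int t n))
    · exact lt_irrefl _ h.1.2
    · exact lt_irrefl _ h.2.1
  have hgen : IsGenericClosedCurve fun t => (K.x t, w t) := by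
    refine ⟨K.smooth_x.prodMk hw.smooth, fun t => Prod.ext (K.periodic_x t) (hw.periodic t),
      fun t h => ?_, fun s t hst h => ?_, fun r s t hrs hst => ?_⟩
    · rw [hd, Prod.mk_eq_zero] at h
      exact hw.immersed t h.1 h.2
    · rw [hd, hd]
      exact hw.transverse s t hst (Prod.ext_iff.1 h).1 (Prod.ext_iff.1 h).2
    · obtain ⟨hx1, hw1⟩ := Prod.ext_iff.1 hrs
      obtain ⟨hx2, hw2⟩ := Prod.ext_iff.1 hst
      simp only at hx1 hw1 hx2 hw2
      by_cases hbox : ∃ p ∈ cusps K.front, s ∈ B.params p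
      · obtain ⟨p, hp, hs⟩ := hbox
        exact sameParam_of_three hp (hmem hp hs hx1.symm hw1.symm) hs (hmem hp hs hx2 hw2) hx1 hx2
      · push Not at hbox
        have hr : ∀ p ∈ cusps K.front, r ∉ B.params p := fun p hp h =>
          hbox p hp (hmem hp h hx1 hw1)
        have ht : ∀ p ∈ cusps K.front, t ∉ B.params p := fun p hp h =>
          hbox p hp (hmem hp h hx2.symm hw2.symm)
        rw [hw.eq_of_notMem r hr, hw.eq_of_notMem s hbox] at hw1
        rw [hw.eq_of_notMem s hbox, hw.eq_of_notMem t ht] at hw2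
        exact B.generic.no_triple r s t (Prod.ext hx1 hw1) (Prod.ext hx2 hw2)
  let D : KnotDiagram :=
    { curve := fun t => (K.x t, w t)
      generic := hgen
      isOver := fun s t => deriv w s / deriv K.x s < deriv w t / deriv K.x t
      isOver_congr := fun s s' t t' hs ht => by
        rw [hs.apply_eq K.periodic_x.deriv_one, ht.apply_eq K.periodic_x.deriv_one,
          hs.apply_eq hw.periodic.deriv_one, ht.apply_eq hw.periodic.deriv_one]
      isOver_iff_not := fun s t hst h => by
        obtain ⟨hx, hwst⟩ := Prod.ext_iff.1 h
        simp only at hx hwst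
        have hs := hreg s t hst hx hwst
        have ht := hreg t s (fun h => hst h.symm) hx.symm hwst.symm
        rw [not_lt]
        refine ⟨le_of_lt, fun hle => lt_of_le_of_ne hle fun heq => ?_⟩
        rw [div_eq_div_iff hs ht] at heq
        exact hw.transverse s t hst hx hwst (by linarith) }
  refine ⟨D, fun _ => rfl, ⟨B.a, B.b, B.u, B.v, B.isCuspBox, B.disjoint, fun t ht => ?_,
    fun p hp t ht => ?_, fun p hp hl s hs t ht h => ?_, fun p hp hr => ?_⟩, fun s t _ _ => ?_⟩
  · exact Prod.ext rfl (hw.eq_of_notMem t ht)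
  · have h1 := B.mem_Icc_fst (B.mem_params hp ht)
    have h2 := hw.maps p hp t ht
    exact ⟨⟨h1.1, h2.1⟩, h1.2, h2.2⟩
  · exact hw.left p hp hl s hs t ht (Prod.ext_iff.1 h).1 (Prod.ext_iff.1 h).2
  · obtain ⟨s₀, hs₀, t₀, ht₀, hx, hwst, huniq⟩ := hw.right p hp hr
    exact ⟨s₀, hs₀, t₀, ht₀, Prod.ext hx hwst, fun s hs t ht hst h =>
      huniq s hs t ht hst (Prod.ext_iff.1 h).1 (Prod.ext_iff.1 h).2⟩
  · simp only [KnotDiagram.slope, D, hd]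

end FrontBoxes

theorem mainTheorem5 (K : LegendrianKnot) (hK : K.HasGenericFront) :
    (∃ D : KnotDiagram, IsResolution K.front D) ∧
    ∀ D : KnotDiagram, IsResolution K.front D →
      ∃ (K' : LegendrianKnot) (D' : KnotDiagram),
        LegendrianIsotopic K K' ∧ K'.IsLagrangianProjection D' ∧ PlanarIsotopic D D' := by
  obtain ⟨B, r, hB⟩ := hK.exists_isTame
  obtain ⟨w, hw⟩ := hB.exists_isResolutionHeight
  exact ⟨hw.exists_isResolution, fun D hD => hD.exists_knot hK⟩
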